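/- **Setting.** Let $L,\rho,\mu,\kappa>0$ and let $\Phi:\mathbb R\to[0,\infty)$ be continuous, of class $C^2$ on $\mathbb R\setminus\{1,-1\}$, constant on $(-\infty,-1]$ and on $[1,\infty)$, convex on $[-1,1]$, nonincreasing on $[-1,0]$, nondecreasing on $[0,1]$, with $\Phi(s)\ge\kappa s^2$ for $s\in[-1,1]$. For real $s$ let $\partial\Phi'(s)\subset\mathbb R$ be the set $\{\Phi'(s)\}$ if $|s|<1$, $\{0\}$ if $|s|>1$, $\{y\in\mathbb R: 0\le y\le\Phi'(1^-)\}$ if $s=1$, and $\{y\in\mathbb R:\Phi'(-1^+)\le y\le0\}$ if $s=-1$, where the one-sided limits $\Phi'(1^-),\Phi'(-1^+)$ are taken in $[-\infty,\infty]$. Given $u_0\in H^2(0,L)$ and $u_1\in L^2(0,L)$, a *dissipative solution* of $$\begin{cases}\rho\,\partial_{tt}^2u=-\mu\,\partial_{xxxx}^4u-\Phi'(u), & t>0,\ 0<x<L,\\ \partial_{xx}^2u=\partial_{xxx}^3u=0, & t>0,\ x\in\{0,L\},\\ u(0,\cdot)=u_0,\quad \partial_tu(0,\cdot)=u_1 &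 \text{on }(0,L)\end{cases}\tag{P}$$ is a continuous function $u:[0,\infty)\times[0,L]\to\mathbb R$ whose distributional derivatives satisfy $\partial_tu,\partial_{xx}^2u\in L^\infty(0,\infty;L^2(0,L))$ and such that: 1. there is a function $h:[0,\infty)\times[0,L]\to\mathbb R$, integrable on $(0,T)\times(0,L)$ for every $T>0$, with $h(t,x)\in\partial\Phi'(u(t,x))$ for all $(t,x)$, and for every $\varphi\in C_c^\infty(\mathbb R^2)$ $$\int_0^\infty\!\!\int_0^L\big(\rho u\,\partial_{tt}^2\varphi+\mu\,\partial_{xx}^2u\,\partial_{xx}^2\varphi+h\varphi\big)\,dx\,dt-\int_0^L\rho u_1\varphi(0,x)\,dx+\int_0^L\rho u_0\,\partial_t\varphi(0,x)\,dx=0;$$ 2. for almost every $t>0$, $$\int_0^L\Big(\tfrac{\rho(\partial_tu(t,x))^2+\mu(\partial_{xx}^2u(t,x))^2}{2}+\Phi(u(t,x))\Big)dx\le\int_0^L\Big(\tfrac{\rho u_1^2+\mu(u_0'')^2}{2}+\Phi(u_0)\Big)dx.$$ A dissipative solution of the *linear beam problem* is defined in the same way with $\Phi$ replaced by $0$ (so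 that $h=0$). **Theorem (Linearization Property).** Let $u_{0,n}\in H^2(0,L)$ and $u_{1,n}\in L^2(0,L)$ for $n\in\mathbb N$, let $u_n$ be a dissipative solution of (P) and $v_n$ a dissipative solution of the linear beam problem, both with initial data $u_{0,n},u_{1,n}$. Assume that $u_{0,n}\rightharpoonup0$ weakly in $H^2(0,L)$, that $u_{1,n}\rightharpoonup0$ weakly in $L^2(0,L)$, and that $$\limsup_{n\to\infty}\int_0^L\frac{\rho u_{1,n}^2+\mu(u_{0,n}'')^2}{2}\,dx<\frac{4\kappa\mu}{\max\{3,2\kappa\}}.$$ Then for every $T\ge0$ $$\|\partial_t(u_n-v_n)\|_{L^\infty(0,T;L^2(0,L))}+\|\partial_{xx}^2(u_n-v_n)\|_{L^\infty(0,T;L^2(0,L))}\to0\qquad\text{as }n\to\infty.$$ -/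

import Mathlib

open MeasureTheory Set Filter Topology
open scoped ContDiff ENNReal

noncomputable section

namespace AdhesiveBeam

/-! ### The spaces `L²(0,L)` and `H²(0,L)` -/

/-- The Hilbert space `L²(0,L)`. -/
abbrev L2 (L : ℝ) : Type := Lp ℝ 2 (volume.restrict (Ioo (0 : ℝ) L))

/-- `g` is the weak derivative of `f` on the interval `(0,L)` (for `f, g ∈ L²(0,L)`). -/
def IsWeakDeriv (L : ℝ) (f g : L2 L) : Prop :=
  ∀ φ : ℝ → ℝ, ContDiff ℝ ∞ φ → HasCompactSupport φ → tsupport φ ⊆ Ioo 0 L →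
    ∫ x in Ioo 0 L, f x * deriv φ x = - ∫ x in Ioo 0 L, g x * φ x

lemma integrable_mul_test {L : ℝ} (f : L2 L) {φ : ℝ → ℝ} (hφ : Continuous φ)
    (hc : HasCompactSupport φ) :
    Integrable (fun x => f x * φ x) (volume.restrict (Ioo 0 L)) := by
  have h1 : MemLp f 2 (volume.restrict (Ioo 0 L)) := Lp.memLp f
  have h2 : MemLp φ 2 (volume.restrict (Ioo 0 L)) := (hφ.memLp_of_hasCompactSupport hc).restrict _
  exact h1.integrable_mul h2

lemma IsWeakDeriv.zero (L : ℝ) : IsWeakDeriv L 0 0 := by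
  intro φ _ _ _
  have h : ∀ ψ : ℝ → ℝ, ∫ x in Ioo 0 L, (0 : L2 L) x * ψ x = 0 := by
    intro ψ
    apply integral_eq_zero_of_ae
    filter_upwards [Lp.coeFn_zero ℝ 2 (volume.restrict (Ioo (0 : ℝ) L))] with x hx
    rw [hx, Pi.zero_apply, zero_mul]
  rw [h, h, neg_zero]

lemma IsWeakDeriv.add {L : ℝ} {f g f' g' : L2 L} (hf : IsWeakDeriv L f f')
    (hg : IsWeakDeriv L g g') : IsWeakDeriv L (f + g) (f' + g') := by
  intro φ hφ hc hs
  have h : ∀ (a b : L2 L) {ψ : ℝ → ℝ}, Continuous ψ → HasCompactSupport ψ →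
      ∫ x in Ioo 0 L, (a + b : L2 L) x * ψ x =
        (∫ x in Ioo 0 L, a x * ψ x) + ∫ x in Ioo 0 L, b x * ψ x := by
    intro a b ψ hψ hcψ
    rw [← integral_add (integrable_mul_test a hψ hcψ) (integrable_mul_test b hψ hcψ)]
    apply integral_congr_ae
    filter_upwards [Lp.coeFn_add a b] with x hx
    rw [hx, Pi.add_apply, add_mul]
  rw [h f g (hφ.continuous_deriv (by simp)) hc.deriv, h f' g' hφ.continuous hc,
    hf φ hφ hc hs, hg φ hφ hc hs, neg_add]

lemma IsWeakDeriv.smul {L : ℝ} {f f' : L2 L} (c : ℝ) (hf : IsWeakDeriv L f f') :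
    IsWeakDeriv L (c • f) (c • f') := by
  intro φ hφ hc hs
  have h : ∀ (a : L2 L) (ψ : ℝ → ℝ),
      ∫ x in Ioo 0 L, (c • a : L2 L) x * ψ x = c * ∫ x in Ioo 0 L, a x * ψ x := by
    intro a ψ
    rw [← integral_const_mul]
    apply integral_congr_ae
    filter_upwards [Lp.coeFn_smul c a] with x hx
    rw [hx, Pi.smul_apply, smul_eq_mul, mul_assoc]
  rw [h, h, hf φ hφ hc hs, mul_neg]

/-- The Sobolev space `H²(0,L)`, realised as the space of triples `(f, f', f'')` of elements of
`L²(0,L)` in which each entry is the weak derivative of the preceding one. The norm inherited from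
the `ℓ²`-product is the usual one, `‖f‖² + ‖f'‖² + ‖f''‖²` being its square. -/
def H2 (L : ℝ) : Submodule ℝ (PiLp 2 (fun _ : Fin 3 => L2 L)) where
  carrier := {p | IsWeakDeriv L (p 0) (p 1) ∧ IsWeakDeriv L (p 1) (p 2)}
  zero_mem' := ⟨IsWeakDeriv.zero L, IsWeakDeriv.zero L⟩
  add_mem' := fun ha hb => ⟨ha.1.add hb.1, ha.2.add hb.2⟩
  smul_mem' := fun c _ ha => ⟨ha.1.smul c, ha.2.smul c⟩

/-- The function underlying an element of `H²(0,L)`. -/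
def H2.fn {L : ℝ} (u : H2 L) : L2 L := u.1 0

/-- The second weak derivative of an element of `H²(0,L)`. -/
def H2.dxx {L : ℝ} (u : H2 L) : L2 L := u.1 2

/-! ### Weak derivatives in space-time and the norm of `L^∞(0,T;L²(0,L))` -/

/-- The open space-time strip `(0,∞) × (0,L)`. -/
def strip (L : ℝ) : Set (ℝ × ℝ) := Ioi 0 ×ˢ Ioo 0 L

/-- Smooth test functions with compact support in `(0,∞) × (0,L)`. -/
def IsInteriorTest (L : ℝ) (φ : ℝ → ℝ → ℝ) : Prop :=
  ContDiff ℝ ∞ (Function.uncurry φ) ∧ HasCompactSupport (Function.uncurry φ) ∧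
    tsupport (Function.uncurry φ) ⊆ strip L

/-- `g = ∂ₜ u` in the sense of distributions on `(0,∞) × (0,L)`, with `u, g` locally integrable. -/
def IsWeakDt (L : ℝ) (u g : ℝ → ℝ → ℝ) : Prop :=
  LocallyIntegrableOn (Function.uncurry u) (strip L) ∧
  LocallyIntegrableOn (Function.uncurry g) (strip L) ∧
  ∀ φ : ℝ → ℝ → ℝ, IsInteriorTest L φ →
    ∫ p in strip L, u p.1 p.2 * deriv (fun t => φ t p.2) p.1 =
      - ∫ p in strip L, g p.1 p.2 * φ p.1 p.2

/-- `g = ∂ₓₓ u` in the sense of distributions on `(0,∞) × (0,L)`, with `u, g` locally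
integrable. -/
def IsWeakDxx (L : ℝ) (u g : ℝ → ℝ → ℝ) : Prop :=
  LocallyIntegrableOn (Function.uncurry u) (strip L) ∧
  LocallyIntegrableOn (Function.uncurry g) (strip L) ∧
  ∀ φ : ℝ → ℝ → ℝ, IsInteriorTest L φ →
    ∫ p in strip L, u p.1 p.2 * iteratedDeriv 2 (fun x => φ p.1 x) p.2 =
      ∫ p in strip L, g p.1 p.2 * φ p.1 p.2

/-- The norm of `g` in `L^∞(I;L²(0,L))`, for a set `I` of times. -/
def normLinfL2 (I : Set ℝ) (L : ℝ) (g : ℝ → ℝ → ℝ) : ℝ≥0∞ :=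
  essSup (fun t => eLpNorm (g t) 2 (volume.restrict (Ioo 0 L))) (volume.restrict I)

/-- `g ∈ L^∞(0,∞;L²(0,L))`. -/
def MemLinfL2 (L : ℝ) (g : ℝ → ℝ → ℝ) : Prop :=
  AEStronglyMeasurable (Function.uncurry g) (volume.restrict (strip L)) ∧
    normLinfL2 (Ioi 0) L g < ⊤

/-! ### The adhesion potential -/

/-- The structural assumptions on the potential `Φ`, with coercivity constant `κ`. -/
structure IsAdhesionPotential (Φ : ℝ → ℝ) (κ : ℝ) : Prop where
  continuous : Continuous Φ
  contDiffOn : ContDiffOn ℝ 2 Φ {1, -1}ᶜ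
  nonneg : ∀ s, 0 ≤ Φ s
  const_left : ∀ s ≤ -1, Φ s = Φ (-1)
  const_right : ∀ s, 1 ≤ s → Φ s = Φ 1
  convexOn : ConvexOn ℝ (Icc (-1) 1) Φ
  antitoneOn : AntitoneOn Φ (Icc (-1) 0)
  monotoneOn : MonotoneOn Φ (Icc 0 1)
  kappa_pos : 0 < κ
  lower_bound : ∀ s ∈ Icc (-1 : ℝ) 1, κ * s ^ 2 ≤ Φ s

/-- `y ∈ ∂Φ'(s)`: `y = Φ'(s)` if `|s| < 1`, `y = 0` if `|s| > 1`, `0 ≤ y ≤ Φ'(1⁻)` if `s = 1` and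
`Φ'(-1⁺) ≤ y ≤ 0` if `s = -1`. The one-sided limits are taken in `[-∞,∞]`. -/
def InSubdiff (Φ : ℝ → ℝ) (s y : ℝ) : Prop :=
  (|s| < 1 → y = deriv Φ s) ∧
  (1 < |s| → y = 0) ∧
  (s = 1 → 0 ≤ y ∧
    ∃ l : EReal, Tendsto (fun r => ((deriv Φ r : ℝ) : EReal)) (𝓝[<] 1) (𝓝 l) ∧ (y : EReal) ≤ l) ∧
  (s = -1 → y ≤ 0 ∧
    ∃ l : EReal, Tendsto (fun r => ((deriv Φ r : ℝ) : EReal)) (𝓝[>] (-1)) (𝓝 l) ∧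
      l ≤ (y : EReal))

/-! ### Dissipative solutions -/

/-- The energy `∫₀ᴸ ((ρ p² + μ q²)/2 + Φ(f)) dx` of a state with displacement `f`, velocity `p` and
second space derivative `q`. -/
def energy (L ρ μ : ℝ) (Φ : ℝ → ℝ) (f p q : ℝ → ℝ) : ℝ :=
  ∫ x in Ioo 0 L, ((ρ * p x ^ 2 + μ * q x ^ 2) / 2 + Φ (f x))

/-- The weak formulation, with test functions in `C_c^∞(ℝ²)`, of
`ρ ∂ₜₜ u = -μ ∂ₓₓₓₓ u - h`, `∂ₓₓ u = ∂ₓₓₓ u = 0` at `x = 0, L`, `u(0) = u₀`, `∂ₜ u(0) = u₁`. Here `uxx`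
stands for `∂ₓₓ u`. -/
def WeakFormulation (L ρ μ : ℝ) (u₀ u₁ : ℝ → ℝ) (u uxx h : ℝ → ℝ → ℝ) : Prop :=
  ∀ φ : ℝ → ℝ → ℝ, ContDiff ℝ ∞ (Function.uncurry φ) → HasCompactSupport (Function.uncurry φ) →
    (∫ p in strip L,
        (ρ * u p.1 p.2 * iteratedDeriv 2 (fun t => φ t p.2) p.1
          + μ * uxx p.1 p.2 * iteratedDeriv 2 (fun x => φ p.1 x) p.2
          + h p.1 p.2 * φ p.1 p.2))
      - (∫ x in Ioo 0 L, ρ * u₁ x * φ 0 x)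
      + (∫ x in Ioo 0 L, ρ * u₀ x * deriv (fun t => φ t x) 0) = 0

/-- `u : [0,∞) × [0,L] → ℝ` is a dissipative solution of the beam problem with potential `Φ` and
initial data `u₀ ∈ H²(0,L)`, `u₁ ∈ L²(0,L)`. (The values of `u` outside `[0,∞) × [0,L]` are
irrelevant.) For `Φ = 0` this is the linear beam problem. -/
def IsDissipativeSolution (L ρ μ : ℝ) (Φ : ℝ → ℝ) (u₀ : H2 L) (u₁ : L2 L) (u : ℝ → ℝ → ℝ) : Prop :=
  ContinuousOn (Function.uncurry u) (Ici 0 ×ˢ Icc 0 L) ∧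
  ∃ ut uxx h : ℝ → ℝ → ℝ,
    IsWeakDt L u ut ∧ IsWeakDxx L u uxx ∧ MemLinfL2 L ut ∧ MemLinfL2 L uxx ∧
    (∀ T : ℝ, IntegrableOn (Function.uncurry h) (Ioo 0 T ×ˢ Ioo 0 L)) ∧
    (∀ t ∈ Ici (0 : ℝ), ∀ x ∈ Icc 0 L, InSubdiff Φ (u t x) (h t x)) ∧
    WeakFormulation L ρ μ (H2.fn u₀) u₁ u uxx h ∧
    ∀ᵐ t ∂(volume.restrict (Ioi (0 : ℝ))),
      energy L ρ μ Φ (u t) (ut t) (uxx t) ≤ energy L ρ μ Φ (H2.fn u₀) u₁ (H2.dxx u₀)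

end AdhesiveBeam

end

/-! Weakly vanishing data make the linear solutions `v n` small in the supremum norm on bounded time
intervals, and near zero the adhesion force is Lipschitz with `Φ'(0) = 0`. So the force felt by `u
n` is small, and the difference `u n - v n`, which solves a forced linear equation with zero data,
is small in energy.

Uniform smallness of `v n` (`linear_tendsto_uniformly`): the energy inequality bounds `∂ₓₓ v n` in
`L²`, so by the interpolation inequality `IsWeakD2.exists_sup_bound` it is enough that `v n` tends
to zero in `L²`, uniformly in time. For that the equation is integrated once in time and tested with
the solution itself (`IsBeamCurve.linear_norm_sq_le`). The velocity data then enter only through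
pairings with functions bounded in `H²`, which vanish uniformly by `exists_tendsto_weak_bound`; the
same lemma gives strong `L²` convergence of the initial displacements.

Comparison (`IsSolution.nonlinear_estimate`): as long as `|u| ≤ 1/2` the force is at most `C₁ |u|`.
With the weight `exp (-lam t)`, the energy estimate for the difference `w = u - v` gains a factor `1
/ lam`, so for large `lam` the weighted supremum of `w` is at most half that of `u`. Hence `|u| ≤ 2
δ exp (lam t)` if `|v| ≤ δ`. A first-exit-time argument (`IsSolution.abs_lt_half`) shows that `u`
never leaves `|u| < 1/2`, and the energy of `w` is then of size `δ`.

The energy identities are justified for weak solutions by mollifying in time. This requires the weak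
equation to hold against every `H²` function of `x`, not only smooth ones:
`IsWeakD2.inner_add_inner_eq_zero`. -/

noncomputable section

namespace AdhesiveBeam

/-! ### Functions as elements of `L²(0,L)` -/

/-- The class in `L²(0,L)` of a square integrable function (and `0` otherwise). -/
def ofFun (L : ℝ) (φ : ℝ → ℝ) : L2 L :=
  open Classical in
  if h : MemLp φ 2 (volume.restrict (Ioo (0 : ℝ) L)) then h.toLp φ else 0

lemma coeFn_ofFun {L : ℝ} {φ : ℝ → ℝ} (h : MemLp φ 2 (volume.restrict (Ioo (0 : ℝ) L))) :
    ofFun L φ =ᵐ[volume.restrict (Ioo (0 : ℝ) L)] φ := by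
  rw [ofFun, dif_pos h]
  exact h.coeFn_toLp

lemma ofFun_congr_ae {L : ℝ} {φ ψ : ℝ → ℝ} (h : φ =ᵐ[volume.restrict (Ioo (0 : ℝ) L)] ψ) :
    ofFun L φ = ofFun L ψ := by
  by_cases hφ : MemLp φ 2 (volume.restrict (Ioo (0 : ℝ) L))
  · have hψ := (memLp_congr_ae h).1 hφ
    exact Lp.ext (((coeFn_ofFun hφ).trans h).trans (coeFn_ofFun hψ).symm)
  · have hψ := fun hh => hφ ((memLp_congr_ae h).2 hh)
    rw [ofFun, ofFun, dif_neg hφ, dif_neg hψ]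

lemma ofFun_congr {L : ℝ} {φ ψ : ℝ → ℝ} (h : ∀ x ∈ Ioo 0 L, φ x = ψ x) :
    ofFun L φ = ofFun L ψ :=
  ofFun_congr_ae ((ae_restrict_iff' measurableSet_Ioo).2 (ae_of_all _ h))

lemma ofFun_coeFn {L : ℝ} (f : L2 L) : ofFun L f = f :=
  Lp.ext (coeFn_ofFun (Lp.memLp f))

lemma memLp_of_bound {L C : ℝ} {φ : ℝ → ℝ}
    (hm : AEStronglyMeasurable φ (volume.restrict (Ioo (0 : ℝ) L)))
    (h : ∀ x ∈ Ioo 0 L, |φ x| ≤ C) : MemLp φ 2 (volume.restrict (Ioo (0 : ℝ) L)) :=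
  MemLp.of_bound hm C ((ae_restrict_iff' measurableSet_Ioo).2 (ae_of_all _ h))

lemma memLp_of_continuousOn {L : ℝ} {φ : ℝ → ℝ} (h : ContinuousOn φ (Icc 0 L)) :
    MemLp φ 2 (volume.restrict (Ioo (0 : ℝ) L)) := by
  obtain ⟨C, hC⟩ := isCompact_Icc.exists_bound_of_continuousOn h
  exact memLp_of_bound ((h.mono Ioo_subset_Icc_self).aestronglyMeasurable measurableSet_Ioo)
    fun x hx => hC x (Ioo_subset_Icc_self hx)

lemma memLp_of_continuous {L : ℝ} {φ : ℝ → ℝ} (h : Continuous φ) :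
    MemLp φ 2 (volume.restrict (Ioo (0 : ℝ) L)) :=
  memLp_of_continuousOn h.continuousOn

lemma inner_eq_integral {L : ℝ} (f g : L2 L) :
    inner ℝ f g = ∫ x in Ioo 0 L, f x * g x := by
  rw [L2.inner_def]
  refine integral_congr_ae (ae_of_all _ fun x => ?_)
  simp [mul_comm]

lemma inner_ofFun {L : ℝ} (f : L2 L) {φ : ℝ → ℝ}
    (h : MemLp φ 2 (volume.restrict (Ioo (0 : ℝ) L))) :
    inner ℝ f (ofFun L φ) = ∫ x in Ioo 0 L, f x * φ x := by
  rw [inner_eq_integral]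
  refine integral_congr_ae ?_
  filter_upwards [coeFn_ofFun h] with x hx
  rw [hx]

lemma ofFun_add {L : ℝ} {φ ψ : ℝ → ℝ} (h : MemLp φ 2 (volume.restrict (Ioo (0 : ℝ) L)))
    (h' : MemLp ψ 2 (volume.restrict (Ioo (0 : ℝ) L))) :
    ofFun L (fun x => φ x + ψ x) = ofFun L φ + ofFun L ψ := by
  refine Lp.ext ?_
  filter_upwards [coeFn_ofFun h, coeFn_ofFun h', coeFn_ofFun (h.add h'),
    Lp.coeFn_add (ofFun L φ) (ofFun L ψ)] with x h1 h2 h3 h4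
  rw [h4, Pi.add_apply, h1, h2]
  exact h3

lemma ofFun_const_mul {L : ℝ} {φ : ℝ → ℝ} (c : ℝ)
    (h : MemLp φ 2 (volume.restrict (Ioo (0 : ℝ) L))) :
    ofFun L (fun x => c * φ x) = c • ofFun L φ := by
  refine Lp.ext ?_
  filter_upwards [coeFn_ofFun h, coeFn_ofFun (h.const_mul c),
    Lp.coeFn_smul c (ofFun L φ)] with x h1 h2 h3
  rw [h3, Pi.smul_apply, h1, h2, smul_eq_mul]

lemma ofFun_sub {L : ℝ} {φ ψ : ℝ → ℝ} (h : MemLp φ 2 (volume.restrict (Ioo (0 : ℝ) L)))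
    (h' : MemLp ψ 2 (volume.restrict (Ioo (0 : ℝ) L))) :
    ofFun L (fun x => φ x - ψ x) = ofFun L φ - ofFun L ψ := by
  refine Lp.ext ?_
  filter_upwards [coeFn_ofFun h, coeFn_ofFun h', coeFn_ofFun (h.sub h'),
    Lp.coeFn_sub (ofFun L φ) (ofFun L ψ)] with x h1 h2 h3 h4
  rw [h4, Pi.sub_apply, h1, h2]
  exact h3

lemma norm_le_of_ae_bound {L C : ℝ} (hC : 0 ≤ C) (f : L2 L)
    (h : ∀ᵐ x ∂(volume.restrict (Ioo (0 : ℝ) L)), |f x| ≤ C) : ‖f‖ ≤ √L * C := by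
  have h' : ∀ᵐ x ∂(volume.restrict (Ioo (0 : ℝ) L)), ‖f x‖ ≤ C := h
  have := Lp.norm_le_of_ae_bound hC h'
  refine this.trans (le_of_eq ?_)
  have e : ((measureUnivNNReal (volume.restrict (Ioo (0 : ℝ) L)) : NNReal) : ℝ) = max L 0 := by
    change (volume.restrict (Ioo (0 : ℝ) L) univ).toReal = _
    simp [ENNReal.toReal_ofReal']
  have e2 : √L = √(max L 0) := by
    rcases le_total 0 L with h0 | h0
    · rw [max_eq_left h0]
    · rw [max_eq_right h0, Real.sqrt_zero, Real.sqrt_eq_zero_of_nonpos h0]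
  rw [e, e2, Real.sqrt_eq_rpow]
  norm_num

lemma norm_ofFun_le {L C : ℝ} (hC : 0 ≤ C) {φ : ℝ → ℝ}
    (h : ∀ x ∈ Ioo 0 L, |φ x| ≤ C) : ‖ofFun L φ‖ ≤ √L * C := by
  by_cases hφ : MemLp φ 2 (volume.restrict (Ioo (0 : ℝ) L))
  · refine norm_le_of_ae_bound hC _ ?_
    filter_upwards [coeFn_ofFun hφ, ae_restrict_mem measurableSet_Ioo] with x h1 h2
    rw [h1]
    exact h x h2
  · rw [ofFun, dif_neg hφ, norm_zero]
    positivity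

lemma norm_sq_eq_integral {L : ℝ} (f : L2 L) : ‖f‖ ^ 2 = ∫ x in Ioo 0 L, f x ^ 2 := by
  rw [← real_inner_self_eq_norm_sq, inner_eq_integral]
  simp only [pow_two]

lemma integrable_L2 {L : ℝ} (f : L2 L) : Integrable f (volume.restrict (Ioo 0 L)) :=
  (Lp.memLp f).integrable one_le_two

/-! ### Test functions on `(0,L)` -/

/-- `φ` is a test function on `(0,L)`. -/
structure IsTest (L : ℝ) (φ : ℝ → ℝ) : Prop where
  contDiff : ContDiff ℝ ∞ φ
  compact : HasCompactSupport φ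
  subset : tsupport φ ⊆ Ioo 0 L

lemma contDiff_deriv {φ : ℝ → ℝ} (h : ContDiff ℝ ∞ φ) : ContDiff ℝ ∞ (deriv φ) :=
  (contDiff_infty_iff_deriv.1 h).2

lemma IsTest.deriv {L : ℝ} {φ : ℝ → ℝ} (h : IsTest L φ) : IsTest L (deriv φ) :=
  ⟨contDiff_deriv h.contDiff, h.compact.deriv, (tsupport_deriv_subset).trans h.subset⟩

lemma IsTest.continuous {L : ℝ} {φ : ℝ → ℝ} (h : IsTest L φ) : Continuous φ :=
  h.contDiff.continuous

lemma IsTest.memLp {L : ℝ} {φ : ℝ → ℝ} (h : IsTest L φ) :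
    MemLp φ 2 (volume.restrict (Ioo (0 : ℝ) L)) :=
  memLp_of_continuous h.continuous

lemma IsTest.eq_zero {L : ℝ} {φ : ℝ → ℝ} (h : IsTest L φ) {x : ℝ} (hx : x ∉ Ioo 0 L) :
    φ x = 0 :=
  image_eq_zero_of_notMem_tsupport fun hh => hx (h.subset hh)

lemma IsTest.setIntegral_mul {L : ℝ} {φ : ℝ → ℝ} (h : IsTest L φ) (f : ℝ → ℝ) :
    ∫ x in Ioo 0 L, f x * φ x = ∫ x, f x * φ x :=
  setIntegral_eq_integral_of_forall_compl_eq_zero fun x hx => by rw [h.eq_zero hx, mul_zero]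

/-- Test functions are dense in `L²(0,L)`. -/
lemma eq_zero_of_inner_test {L : ℝ} (r : L2 L)
    (h : ∀ φ, IsTest L φ → inner ℝ r (ofFun L φ) = 0) : r = 0 := by
  have hloc : LocallyIntegrableOn (r : ℝ → ℝ) (Ioo 0 L) volume :=
    (show IntegrableOn (r : ℝ → ℝ) (Ioo 0 L) volume from integrable_L2 r).locallyIntegrableOn
  have := isOpen_Ioo.ae_eq_zero_of_integral_contDiff_smul_eq_zero hloc (fun φ h1 h2 h3 => by
    have ht : IsTest L φ := ⟨h1, h2, h3⟩
    have h4 := h φ ht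
    rw [inner_ofFun _ ht.memLp, ht.setIntegral_mul] at h4
    simpa [mul_comm] using h4)
  refine Lp.ext ?_
  filter_upwards [(ae_restrict_iff' measurableSet_Ioo).2 this, Lp.coeFn_zero ℝ 2 _] with x hx h0
  rw [hx, h0, Pi.zero_apply]

/-! ### Second weak derivatives -/

/-- `g` is the second weak derivative of `f` on `(0,L)`. -/
def IsWeakD2 (L : ℝ) (f g : L2 L) : Prop :=
  ∀ φ : ℝ → ℝ, IsTest L φ → inner ℝ f (ofFun L (deriv (deriv φ))) = inner ℝ g (ofFun L φ)

lemma IsWeakD2.sub {L : ℝ} {f g f' g' : L2 L} (h : IsWeakD2 L f g) (h' : IsWeakD2 L f' g') :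
    IsWeakD2 L (f - f') (g - g') := by
  intro φ hφ
  rw [inner_sub_left, inner_sub_left, h φ hφ, h' φ hφ]

lemma IsWeakD2.of_tendsto {L : ℝ} {ι : Type*} {l : Filter ι} [l.NeBot] {f g : ι → L2 L}
    {f' g' : L2 L} (hf : Tendsto f l (𝓝 f')) (hg : Tendsto g l (𝓝 g'))
    (h : ∀ᶠ i in l, IsWeakD2 L (f i) (g i)) : IsWeakD2 L f' g' := by
  intro φ hφ
  refine tendsto_nhds_unique (hf.inner tendsto_const_nhds)
    ((hg.inner tendsto_const_nhds).congr' ?_)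
  filter_upwards [h] with i hi
  exact (hi φ hφ).symm

/-- The second weak derivative of an element of `H²(0,L)`. -/
lemma H2.isWeakD2 {L : ℝ} (u : H2 L) : IsWeakD2 L (H2.fn u) (H2.dxx u) := by
  intro φ hφ
  rw [inner_ofFun _ hφ.deriv.deriv.memLp, inner_ofFun _ hφ.memLp]
  have h1 := u.2.1 (deriv φ) hφ.deriv.contDiff hφ.deriv.compact hφ.deriv.subset
  have h2 := u.2.2 φ hφ.contDiff hφ.compact hφ.subset
  unfold H2.fn H2.dxx
  linarith

/-- Integration by parts against a test function. -/
lemma integral_mul_deriv_test {L : ℝ} {ψ φ : ℝ → ℝ} (hψ : ContDiff ℝ ∞ ψ) (hφ : IsTest L φ) :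
    ∫ x, ψ x * deriv φ x = - ∫ x, deriv ψ x * φ x := by
  have hψ' := contDiff_deriv hψ
  refine integral_mul_deriv_eq_deriv_mul_of_integrable
    (fun x _ => (hψ.differentiable (by simp) x).hasDerivAt)
    (fun x _ => (hφ.contDiff.differentiable (by simp) x).hasDerivAt) ?_ ?_ ?_
  · exact (hψ.continuous.mul hφ.deriv.continuous).integrable_of_hasCompactSupport
      hφ.deriv.compact.mul_left
  · exact (hψ'.continuous.mul hφ.continuous).integrable_of_hasCompactSupport hφ.compact.mul_left
  · exact (hψ.continuous.mul hφ.continuous).integrable_of_hasCompactSupport hφ.compact.mul_left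

lemma isWeakD2_of_contDiff (L : ℝ) {ψ : ℝ → ℝ} (hψ : ContDiff ℝ ∞ ψ) :
    IsWeakD2 L (ofFun L ψ) (ofFun L (deriv (deriv ψ))) := by
  intro φ hφ
  have hψ' := contDiff_deriv hψ
  rw [real_inner_comm, real_inner_comm (ofFun L φ), inner_ofFun _ (memLp_of_continuous hψ.continuous),
    inner_ofFun _ (memLp_of_continuous (contDiff_deriv hψ').continuous)]
  have e : ∀ {a b : ℝ → ℝ}, IsTest L a → ∫ x in Ioo 0 L, ofFun L a x * b x = ∫ x, b x * a x := by
    intro a b ha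
    rw [← ha.setIntegral_mul]
    refine integral_congr_ae ?_
    filter_upwards [coeFn_ofFun ha.memLp] with x hx
    rw [hx, mul_comm]
  rw [e hφ.deriv.deriv, e hφ, integral_mul_deriv_test hψ hφ.deriv, integral_mul_deriv_test hψ' hφ,
    neg_neg]

/-! ### Antiderivatives -/

lemma contDiff_primitive {g : ℝ → ℝ} (hg : ContDiff ℝ ∞ g) (a : ℝ) :
    ContDiff ℝ ∞ (fun x => ∫ y in a..x, g y) ∧ deriv (fun x => ∫ y in a..x, g y) = g := by
  have hd : ∀ x, HasDerivAt (fun x => ∫ y in a..x, g y) (g x) x := fun x =>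
    hg.continuous.integral_hasStrictDerivAt a x |>.hasDerivAt
  have hd' : deriv (fun x => ∫ y in a..x, g y) = g := funext fun x => (hd x).deriv
  refine ⟨contDiff_infty_iff_deriv.2 ⟨fun x => (hd x).differentiableAt, ?_⟩, hd'⟩
  rw [hd']
  exact hg

lemma IsTest.exists_Icc {L : ℝ} (hL : 0 < L) {φ : ℝ → ℝ} (h : IsTest L φ) :
    ∃ a b, 0 < a ∧ a ≤ b ∧ b < L ∧ ∀ x, x ∉ Icc a b → φ x = 0 := by
  rcases (tsupport φ).eq_empty_or_nonempty with he | hne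
  · refine ⟨L / 2, L / 2, by linarith, le_rfl, by linarith, fun x _ => ?_⟩
    exact image_eq_zero_of_notMem_tsupport (by simp [he])
  · obtain ⟨a, ha, ha'⟩ := h.compact.isCompact.exists_isLeast hne
    obtain ⟨b, hb, hb'⟩ := h.compact.isCompact.exists_isGreatest hne
    refine ⟨a, b, (h.subset ha).1, ha' hb, (h.subset hb).2, fun x hx => ?_⟩
    exact image_eq_zero_of_notMem_tsupport fun hh => hx ⟨ha' hh, hb' hh⟩

/-- To the right of the support of `ζ` the primitive equals the full integral, so the vanishing mean
is what makes its support compact in `(0,L)`. -/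
lemma IsTest.exists_primitive {L : ℝ} (hL : 0 < L) {ζ : ℝ → ℝ} (h : IsTest L ζ)
    (h0 : ∫ x in 0..L, ζ x = 0) : ∃ Z, IsTest L Z ∧ Z = (fun x => ∫ y in 0..x, ζ y) ∧
      _root_.deriv Z = ζ := by
  obtain ⟨a, b, ha, hab, hb, hz⟩ := h.exists_Icc hL
  obtain ⟨h1, h2⟩ := contDiff_primitive h.contDiff 0
  have hsupp : tsupport (fun x => ∫ y in 0..x, ζ y) ⊆ Icc a b := by
    refine closure_minimal (fun x hx => ?_) isClosed_Icc
    by_contra hxx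
    apply hx
    rw [mem_Icc, not_and_or, not_le, not_le] at hxx
    rcases hxx with hxa | hxb
    · refine intervalIntegral.integral_zero_ae (ae_of_all _ fun y hy => hz y fun hy' => ?_)
      rcases mem_uIoc.1 hy with h | h <;> linarith [h.1, h.2, hy'.1, hy'.2]
    · have hi : ∀ p q, IntervalIntegrable ζ volume p q := fun p q =>
        h.continuous.intervalIntegrable p q
      have : ∫ y in x..L, ζ y = 0 := by
        refine intervalIntegral.integral_zero_ae (ae_of_all _ fun y hy => hz y fun hy' => ?_)
        rcases mem_uIoc.1 hy with h | h <;> linarith [h.1, h.2, hy'.1, hy'.2]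
      have h3 := intervalIntegral.integral_add_adjacent_intervals (hi 0 x) (hi x L)
      simp only
      linarith
  exact ⟨_, ⟨h1, HasCompactSupport.intro' isCompact_Icc isClosed_Icc (fun x hx => by
    by_contra hh; exact hx (hsupp (subset_closure hh))), fun x hx =>
      ⟨ha.trans_le (hsupp hx).1, (hsupp hx).2.trans_lt hb⟩⟩, rfl, h2⟩

lemma IsTest.intervalIntegral_mul {L : ℝ} (hL : 0 < L) {φ : ℝ → ℝ} (h : IsTest L φ) (f : ℝ → ℝ) :
    ∫ x in 0..L, f x * φ x = ∫ x, f x * φ x := by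
  rw [intervalIntegral.integral_of_le hL.le, integral_Ioc_eq_integral_Ioo, h.setIntegral_mul]

/-- Two primitives are taken in turn. Integration by parts turns the first moment of `ζ` into minus
the mean of the first primitive, so the second one is again a test function. -/
lemma IsTest.exists_primitive2 {L : ℝ} (hL : 0 < L) {ζ : ℝ → ℝ} (h : IsTest L ζ)
    (h0 : ∫ x, ζ x = 0) (h1 : ∫ x, x * ζ x = 0) :
    ∃ Z, IsTest L Z ∧ _root_.deriv (_root_.deriv Z) = ζ := by
  have e0 := h.intervalIntegral_mul hL (fun _ => 1)
  simp only [one_mul] at e0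
  obtain ⟨Z, hZ, -, hZ'⟩ := h.exists_primitive hL (e0.trans h0)
  have e1 := hZ.intervalIntegral_mul hL (fun _ => 1)
  simp only [one_mul] at e1
  have hp := integral_mul_deriv_test contDiff_id hZ
  simp only [id, deriv_id', one_mul, hZ', h1] at hp
  obtain ⟨Y, hY, -, hY'⟩ := hZ.exists_primitive hL (by rw [e1]; linarith)
  exact ⟨Y, hY, by rw [hY', hZ']⟩

/-! ### The twofold antiderivative -/

lemma abs_max_sub_le (x x' y : ℝ) : |max (x - y) 0 - max (x' - y) 0| ≤ |x - x'| := by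
  have := abs_max_sub_max_le_abs (x - y) (x' - y) 0
  simpa using this

/-- The twofold antiderivative of `g` that vanishes with its first derivative at `0`. -/
def anti2 (L : ℝ) (g : L2 L) (x : ℝ) : ℝ := inner ℝ g (ofFun L fun y => max (x - y) 0)

/-- The twofold antiderivative of `p` that vanishes with its first derivative at `L`. -/
def coanti2 (L : ℝ) (p : L2 L) (y : ℝ) : ℝ := inner ℝ p (ofFun L fun x => max (x - y) 0)

lemma memLp_kernel (L x : ℝ) :
    MemLp (fun y => max (x - y) 0) 2 (volume.restrict (Ioo (0 : ℝ) L)) :=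
  memLp_of_continuous (by fun_prop)

lemma memLp_cokernel (L y : ℝ) :
    MemLp (fun x => max (x - y) 0) 2 (volume.restrict (Ioo (0 : ℝ) L)) :=
  memLp_of_continuous (by fun_prop)

/-- The kernel `(x - y)⁺` is 1-Lipschitz in `x`, so Cauchy–Schwarz gives the bound. -/
lemma anti2_sub_le {L : ℝ} (g : L2 L) (x x' : ℝ) :
    |anti2 L g x - anti2 L g x'| ≤ √L * ‖g‖ * |x - x'| := by
  unfold anti2
  rw [← inner_sub_right, ← ofFun_sub (memLp_kernel L x) (memLp_kernel L x')]
  refine (abs_real_inner_le_norm _ _).trans ?_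
  have := norm_ofFun_le (L := L) (abs_nonneg (x - x')) fun y _ => abs_max_sub_le x x' y
  calc ‖g‖ * _ ≤ ‖g‖ * (√L * |x - x'|) := by gcongr
    _ = _ := by ring

lemma continuous_anti2 {L : ℝ} (g : L2 L) : Continuous (anti2 L g) := by
  have : LipschitzWith (√L * ‖g‖).toNNReal (anti2 L g) := by
    refine LipschitzWith.of_dist_le_mul fun x y => ?_
    rw [Real.dist_eq, Real.dist_eq, Real.coe_toNNReal _ (by positivity)]
    exact anti2_sub_le g x y
  exact this.continuous

lemma abs_coanti2_le {L : ℝ} (p : L2 L) {y : ℝ} (hy : y ∈ Ioo 0 L) :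
    |coanti2 L p y| ≤ ‖p‖ * (√L * L) := by
  refine (abs_real_inner_le_norm _ _).trans ?_
  have hL : 0 < L := hy.1.trans hy.2
  gcongr
  refine norm_ofFun_le hL.le fun x hx => ?_
  rw [abs_of_nonneg (le_max_right _ _)]
  exact max_le (by linarith [hx.2, hy.1]) hL.le

lemma continuous_coanti2 {L : ℝ} (p : L2 L) : Continuous (coanti2 L p) := by
  have : LipschitzWith (√L * ‖p‖).toNNReal (coanti2 L p) := by
    refine LipschitzWith.of_dist_le_mul fun x x' => ?_
    rw [Real.dist_eq, Real.dist_eq, Real.coe_toNNReal _ (by positivity)]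
    unfold coanti2
    rw [← inner_sub_right, ← ofFun_sub (memLp_cokernel L x) (memLp_cokernel L x')]
    refine (abs_real_inner_le_norm _ _).trans ?_
    have := norm_ofFun_le (L := L) (abs_nonneg (x - x')) (φ := fun t => max (t - x) 0 - max (t - x') 0)
      fun y _ => by
        have := abs_max_sub_max_le_abs (y - x) (y - x') 0
        rw [abs_sub_comm x x']
        simpa using this
    calc ‖p‖ * _ ≤ ‖p‖ * (√L * |x - x'|) := by gcongr
      _ = _ := by ring
  exact this.continuous

/-- Fubini's theorem for the kernel `(x - y)⁺`. -/
lemma inner_anti2 {L : ℝ} (p g : L2 L) :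
    inner ℝ p (ofFun L (anti2 L g)) = inner ℝ g (ofFun L (coanti2 L p)) := by
  rw [inner_ofFun _ (memLp_of_continuous (continuous_anti2 g)),
    inner_ofFun _ (memLp_of_continuous (continuous_coanti2 p))]
  have e1 : ∀ x, p x * anti2 L g x = ∫ y in Ioo 0 L, max (x - y) 0 * (p x * g y) := by
    intro x
    rw [anti2, inner_ofFun _ (memLp_kernel L x), ← integral_const_mul]
    congr 1
    ext y
    ring
  have e2 : ∀ y, g y * coanti2 L p y = ∫ x in Ioo 0 L, max (x - y) 0 * (p x * g y) := by
    intro y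
    rw [coanti2, inner_ofFun _ (memLp_cokernel L y), ← integral_const_mul]
    congr 1
    ext x
    ring
  simp only [e1, e2]
  refine integral_integral_swap ?_
  have h := (integrable_L2 p).mul_prod (integrable_L2 g)
  refine h.bdd_mul (c := L) (Continuous.aestronglyMeasurable (by fun_prop)) ?_
  rw [Measure.prod_restrict]
  refine (ae_restrict_iff' (measurableSet_Ioo.prod measurableSet_Ioo)).2 (ae_of_all _ ?_)
  rintro ⟨x, y⟩ ⟨hx, hy⟩
  simp only [mem_Ioo] at hx hy
  rw [Real.norm_eq_abs, abs_of_nonneg (le_max_right _ _)]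
  exact max_le (by simp only; linarith) (by linarith)

/-- Taylor's formula at `L` with integral remainder; the boundary terms there vanish because `φ` is
a test function. -/
lemma coanti2_deriv_deriv {L : ℝ} {φ : ℝ → ℝ} (hφ : IsTest L φ) {y : ℝ}
    (hy : y ∈ Ioo 0 L) : coanti2 L (ofFun L (deriv (deriv φ))) y = φ y := by
  rw [coanti2, inner_ofFun _ (memLp_cokernel L y)]
  have e : ∫ x in Ioo 0 L, ofFun L (deriv (deriv φ)) x * max (x - y) 0
      = ∫ x in Ioo 0 L, deriv (deriv φ) x * max (x - y) 0 := by
    refine integral_congr_ae ?_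
    filter_upwards [coeFn_ofFun hφ.deriv.deriv.memLp] with x hx
    rw [hx]
  have hLe : (0 : ℝ) ≤ L := (hy.1.trans hy.2).le
  have hc : Continuous fun x => deriv (deriv φ) x * max (x - y) 0 :=
    hφ.deriv.deriv.continuous.mul (by fun_prop)
  rw [e, ← integral_Ioc_eq_integral_Ioo, ← intervalIntegral.integral_of_le hLe,
    ← intervalIntegral.integral_add_adjacent_intervals (b := y) (hc.intervalIntegrable _ _)
      (hc.intervalIntegrable _ _)]
  have e1 : ∫ x in (0:ℝ)..y, deriv (deriv φ) x * max (x - y) 0 = 0 := by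
    refine intervalIntegral.integral_zero_ae (ae_of_all _ fun x hx => ?_)
    rw [uIoc_of_le hy.1.le] at hx
    rw [max_eq_right (by linarith [hx.2]), mul_zero]
  have e2 : ∫ x in y..L, deriv (deriv φ) x * max (x - y) 0
      = ∫ x in y..L, (x - y) * deriv (deriv φ) x := by
    refine intervalIntegral.integral_congr fun x hx => ?_
    rw [uIcc_of_le hy.2.le] at hx
    rw [max_eq_left (by linarith [hx.1]), mul_comm]
  have d1 : ∀ x, HasDerivAt (deriv φ) (deriv (deriv φ) x) x := fun x =>
    (hφ.deriv.contDiff.differentiable (by simp) x).hasDerivAt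
  have d0 : ∀ x, HasDerivAt φ (deriv φ x) x := fun x =>
    (hφ.contDiff.differentiable (by simp) x).hasDerivAt
  rw [e1, e2, intervalIntegral.integral_mul_deriv_eq_deriv_mul (u := fun x => x - y)
    (u' := fun _ => 1) (fun x _ => (hasDerivAt_id x).sub_const y) (fun x _ => d1 x) (by simp)
    (hφ.deriv.deriv.continuous.intervalIntegrable _ _)]
  simp only [one_mul]
  rw [intervalIntegral.integral_eq_sub_of_hasDerivAt (fun x _ => d0 x)
    (hφ.deriv.continuous.intervalIntegrable _ _), hφ.eq_zero (x := L) (by simp),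
    hφ.deriv.eq_zero (x := L) (by simp)]
  ring

/-- By duality: Fubini moves the twofold integration onto `φ''`, where it gives back `φ`. No
derivative of `anti2` is computed. -/
lemma isWeakD2_anti2 {L : ℝ} (g : L2 L) : IsWeakD2 L (ofFun L (anti2 L g)) g := by
  intro φ hφ
  rw [real_inner_comm, inner_anti2]
  congr 1
  exact ofFun_congr fun y hy => coanti2_deriv_deriv hφ hy

/-! ### Functions with vanishing second derivative -/

/-- A biorthogonal family to `1` and `x`. With a normalised bump `β`, take `ζ₁ = -β'` and correct
`β` by the multiple of `β'` that kills its first moment. -/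
lemma exists_dual_tests {L : ℝ} (hL : 0 < L) : ∃ ζ₀ ζ₁ : ℝ → ℝ, IsTest L ζ₀ ∧ IsTest L ζ₁ ∧
    ∫ x, ζ₀ x = 1 ∧ ∫ x, x * ζ₀ x = 0 ∧ ∫ x, ζ₁ x = 0 ∧ ∫ x, x * ζ₁ x = 1 := by
  let b : ContDiffBump (L / 2) := ⟨L / 8, L / 4, by linarith, by linarith⟩
  have hb : IsTest L (b.normed volume) := by
    refine ⟨b.contDiff_normed, b.hasCompactSupport_normed, ?_⟩
    rw [b.tsupport_normed_eq, Real.closedBall_eq_Icc]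
    intro x hx
    simp only [b, mem_Icc, mem_Ioo] at hx ⊢
    constructor <;> linarith [hx.1, hx.2]
  have h1 : ∫ x, b.normed volume x = 1 := b.integral_normed
  set β := b.normed volume with hβ
  have i1 : ∀ {φ : ℝ → ℝ}, IsTest L φ → Integrable φ := fun h =>
    h.continuous.integrable_of_hasCompactSupport h.compact
  have i2 : ∀ {φ : ℝ → ℝ}, IsTest L φ → Integrable fun x => x * φ x := fun h =>
    (continuous_id.mul h.continuous).integrable_of_hasCompactSupport h.compact.mul_left
  have h2 : ∫ x, deriv β x = 0 := by
    have := integral_mul_deriv_test (ψ := fun _ => (1 : ℝ)) contDiff_const hb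
    simpa using this
  have h3 : ∫ x, x * deriv β x = -1 := by
    have := integral_mul_deriv_test (ψ := fun x : ℝ => x) contDiff_id hb
    simpa [h1] using this
  have hsub : ∀ (c d : ℝ), IsTest L (fun x => c * β x + d * deriv β x) := by
    intro c d
    refine ⟨(contDiff_const.mul hb.contDiff).add (contDiff_const.mul hb.deriv.contDiff), ?_, ?_⟩
    · exact hb.compact.mul_left.add hb.deriv.compact.mul_left
    · refine (tsupport_add _ _).trans (union_subset ?_ ?_)
      · exact (tsupport_mul_subset_right).trans hb.subset
      · exact (tsupport_mul_subset_right).trans hb.deriv.subset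
  have e1 : ∀ c d : ℝ, ∫ x, (c * β x + d * deriv β x) = c := by
    intro c d
    rw [integral_add ((i1 hb).const_mul _) ((i1 hb.deriv).const_mul _), integral_const_mul,
      integral_const_mul, h1, h2]
    ring
  have e2 : ∀ c d : ℝ, ∫ x, x * (c * β x + d * deriv β x) = c * (∫ x, x * β x) - d := by
    intro c d
    have : ∀ x, x * (c * β x + d * deriv β x) = c * (x * β x) + d * (x * deriv β x) := by
      intro x; ring
    simp only [this]
    rw [integral_add ((i2 hb).const_mul _) ((i2 hb.deriv).const_mul _), integral_const_mul,
      integral_const_mul, h3]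
    ring
  exact ⟨_, _, hsub 1 (∫ x, x * β x), hsub 0 (-1), e1 _ _, by rw [e2]; ring, e1 _ _,
    by rw [e2]; ring⟩

lemma ofFun_affine {L : ℝ} (α β : ℝ) :
    ofFun L (fun x => α + β * x) = α • ofFun L (fun _ => 1) + β • ofFun L (fun x => x) := by
  rw [← ofFun_const_mul α (memLp_of_continuous continuous_const),
    ← ofFun_const_mul β (memLp_of_continuous continuous_id'),
    ← ofFun_add (memLp_of_continuous (by fun_prop)) (memLp_of_continuous (by fun_prop))]
  simp

/-- The lemma of du Bois-Reymond at second order: removing from `ζ` its two moments along the dual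
pair leaves the second derivative of a test function, which `f` does not see. So `f` acts on `ζ`
through its moments only, as an affine function does. -/
lemma IsWeakD2.eq_affine {L : ℝ} (hL : 0 < L) {f : L2 L} (h : IsWeakD2 L f 0) :
    ∃ α β : ℝ, f = ofFun L (fun x => α + β * x) := by
  obtain ⟨ζ₀, ζ₁, t0, t1, a0, a1, b0, b1⟩ := exists_dual_tests hL
  set c₀ := inner ℝ f (ofFun L ζ₀) with hc0
  set c₁ := inner ℝ f (ofFun L ζ₁) with hc1
  refine ⟨c₀, c₁, sub_eq_zero.1 (eq_zero_of_inner_test _ fun ζ hζ => ?_)⟩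
  have i1 : ∀ {φ : ℝ → ℝ}, IsTest L φ → Integrable φ := fun h =>
    h.continuous.integrable_of_hasCompactSupport h.compact
  have i2 : ∀ {φ : ℝ → ℝ}, IsTest L φ → Integrable fun x => x * φ x := fun h =>
    (continuous_id.mul h.continuous).integrable_of_hasCompactSupport h.compact.mul_left
  set m₀ := ∫ x, ζ x with hm0
  set m₁ := ∫ x, x * ζ x with hm1
  have hq : IsTest L (fun x => ζ x + (-m₀ * ζ₀ x + -m₁ * ζ₁ x)) := by
    refine ⟨hζ.contDiff.add ((contDiff_const.mul t0.contDiff).add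
      (contDiff_const.mul t1.contDiff)), ?_, ?_⟩
    · exact hζ.compact.add (t0.compact.mul_left.add t1.compact.mul_left)
    · refine (tsupport_add _ _).trans (union_subset hζ.subset
        ((tsupport_add _ _).trans (union_subset ?_ ?_)))
      · exact (tsupport_mul_subset_right).trans t0.subset
      · exact (tsupport_mul_subset_right).trans t1.subset
  have z0 : ∫ x, (ζ x + (-m₀ * ζ₀ x + -m₁ * ζ₁ x)) = 0 := by
    have i3 : Integrable fun x => -m₀ * ζ₀ x + -m₁ * ζ₁ x :=
      ((i1 t0).const_mul _).add ((i1 t1).const_mul _)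
    rw [integral_add (i1 hζ) i3, integral_add ((i1 t0).const_mul _) ((i1 t1).const_mul _), integral_const_mul,
      integral_const_mul, a0, b0]
    ring
  have z1 : ∫ x, x * (ζ x + (-m₀ * ζ₀ x + -m₁ * ζ₁ x)) = 0 := by
    have : ∀ x, x * (ζ x + (-m₀ * ζ₀ x + -m₁ * ζ₁ x))
      = x * ζ x + (-m₀ * (x * ζ₀ x) + -m₁ * (x * ζ₁ x)) := by intro x; ring
    simp only [this]
    have i3 : Integrable fun x => -m₀ * (x * ζ₀ x) + -m₁ * (x * ζ₁ x) :=
      ((i2 t0).const_mul _).add ((i2 t1).const_mul _)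
    rw [integral_add (i2 hζ) i3, integral_add ((i2 t0).const_mul _) ((i2 t1).const_mul _), integral_const_mul,
      integral_const_mul, a1, b1]
    ring
  obtain ⟨Z, hZ, hZ'⟩ := hq.exists_primitive2 hL z0 z1
  have h1 := h Z hZ
  have m3 : MemLp (fun x => -m₀ * ζ₀ x + -m₁ * ζ₁ x) 2 (volume.restrict (Ioo (0 : ℝ) L)) :=
    (t0.memLp.const_mul _).add (t1.memLp.const_mul _)
  rw [hZ', inner_zero_left, ofFun_add hζ.memLp m3,
    ofFun_add (t0.memLp.const_mul _) (t1.memLp.const_mul _), ofFun_const_mul _ t0.memLp,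
    ofFun_const_mul _ t1.memLp, inner_add_right, inner_add_right, inner_smul_right,
    inner_smul_right] at h1
  have h2 : inner ℝ (ofFun L fun x => c₀ + c₁ * x) (ofFun L ζ) = c₀ * m₀ + c₁ * m₁ := by
    rw [real_inner_comm, ofFun_affine, inner_add_right, inner_smul_right, inner_smul_right,
      real_inner_comm, real_inner_comm _ (ofFun L ζ), inner_ofFun _ hζ.memLp, inner_ofFun _ hζ.memLp,
      hm0, hm1]
    congr 2
    · have := hζ.setIntegral_mul (fun _ => 1)
      simp only [one_mul] at this
      rw [← this]
      refine integral_congr_ae ?_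
      filter_upwards [coeFn_ofFun (L := L) (memLp_of_continuous (continuous_const (y := (1 : ℝ))))]
        with x hx
      rw [hx, one_mul]
    · rw [← hζ.setIntegral_mul]
      refine integral_congr_ae ?_
      filter_upwards [coeFn_ofFun (L := L) (memLp_of_continuous continuous_id')] with x hx
      rw [hx]
  rw [inner_sub_left, h2]
  linarith

/-- The structure of the functions with a second weak derivative in `L²(0,L)`. -/
lemma IsWeakD2.exists_eq {L : ℝ} (hL : 0 < L) {f g : L2 L} (h : IsWeakD2 L f g) :
    ∃ α β : ℝ, f = ofFun L (fun x => α + β * x) + ofFun L (anti2 L g) := by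
  have h0 := h.sub (isWeakD2_anti2 g)
  rw [sub_self] at h0
  obtain ⟨α, β, hab⟩ := h0.eq_affine hL
  exact ⟨α, β, by rw [← hab]; abel⟩

/-! ### From smooth test functions to test functions in `H²` -/

/-- Only values on `(0,L)` enter, so `ψ` may be multiplied by a cutoff equal to `1` there. -/
lemma inner_eq_zero_of_contDiff {L : ℝ} {r₁ r₂ : L2 L}
    (h : ∀ ψ : ℝ → ℝ, ContDiff ℝ ∞ ψ → HasCompactSupport ψ →
      inner ℝ r₁ (ofFun L ψ) + inner ℝ r₂ (ofFun L (deriv (deriv ψ))) = 0)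
    {ψ : ℝ → ℝ} (hψ : ContDiff ℝ ∞ ψ) :
    inner ℝ r₁ (ofFun L ψ) + inner ℝ r₂ (ofFun L (deriv (deriv ψ))) = 0 := by
  let b : ContDiffBump (0 : ℝ) := ⟨|L| + 1, |L| + 2, by positivity, by linarith⟩
  have hb : ∀ x ∈ Ioo 0 L, (fun x => b x * ψ x) =ᶠ[𝓝 x] ψ := by
    intro x hx
    have : x ∈ Metric.ball (0 : ℝ) (|L| + 1) := by
      rw [Metric.mem_ball, Real.dist_eq, sub_zero, abs_of_pos hx.1]
      linarith [hx.2, le_abs_self L]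
    filter_upwards [b.eventuallyEq_one_of_mem_ball this] with y hy
    rw [hy, Pi.one_apply, one_mul]
  have := h (fun x => b x * ψ x) (b.contDiff.mul hψ) b.hasCompactSupport.mul_right
  rwa [ofFun_congr fun x hx => (hb x hx).eq_of_nhds,
    ofFun_congr fun x hx => (hb x hx).deriv.deriv_eq] at this

/-- An identity known for smooth `ψ` passes to every `H²` function without a density theorem. Every
such function is affine plus `anti2 g`; affine functions are smooth, and on `anti2 g` the identity
pairs `g` with a fixed `L²` function that turns out to vanish. As `ψ` is free at the endpoints, the
natural boundary conditions are encoded too. -/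
lemma IsWeakD2.inner_add_inner_eq_zero {L : ℝ} (hL : 0 < L) {r₁ r₂ : L2 L}
    (h : ∀ ψ : ℝ → ℝ, ContDiff ℝ ∞ ψ → HasCompactSupport ψ →
      inner ℝ r₁ (ofFun L ψ) + inner ℝ r₂ (ofFun L (deriv (deriv ψ))) = 0)
    {f g : L2 L} (hfg : IsWeakD2 L f g) : inner ℝ r₁ f + inner ℝ r₂ g = 0 := by
  have haff : ∀ α β : ℝ, inner ℝ r₁ (ofFun L (fun x => α + β * x)) = 0 := by
    intro α β
    have := inner_eq_zero_of_contDiff h (ψ := fun x => α + β * x) (by fun_prop)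
    have e : deriv (deriv fun x : ℝ => α + β * x) = fun _ => 0 := by
      have : deriv (fun x : ℝ => α + β * x) = fun _ => β := by
        ext x
        simp
      rw [this]
      ext x
      simp
    have e0 : ofFun L (fun _ => (0:ℝ)) = 0 := by
      have := ofFun_const_mul (L := L) 0 (memLp_of_continuous (continuous_const (y := (0 : ℝ))))
      simpa using this
    rwa [e, e0, inner_zero_right, add_zero] at this
  -- It suffices to pair with tests `ζ`. The double primitive of `ζ` is smooth, hence admissible,
  -- and differs from `anti2 ζ` by an affine function, which `r₁` annihilates.
  have hK : ofFun L (coanti2 L r₁) + r₂ = 0 := by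
    refine eq_zero_of_inner_test _ fun ζ hζ => ?_
    obtain ⟨p1, p2⟩ := contDiff_primitive hζ.contDiff 0
    obtain ⟨q1, q2⟩ := contDiff_primitive p1 0
    have h1 := isWeakD2_of_contDiff L q1
    have h2 := inner_eq_zero_of_contDiff h q1
    rw [q2, p2] at h1 h2
    obtain ⟨α, β, hab⟩ := h1.exists_eq hL
    rw [hab, inner_add_right, haff, zero_add, inner_anti2] at h2
    rw [inner_add_left, real_inner_comm]
    exact h2
  obtain ⟨α, β, rfl⟩ := hfg.exists_eq hL
  rw [inner_add_right, haff, zero_add, inner_anti2, real_inner_comm, ← inner_add_left, hK,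
    inner_zero_left]

/-! ### Quantitative bounds -/

lemma inner_ofFun_ofFun {L : ℝ} (hL : 0 ≤ L) {φ ψ : ℝ → ℝ} (hφ : Continuous φ)
    (hψ : Continuous ψ) : inner ℝ (ofFun L φ) (ofFun L ψ) = ∫ x in 0..L, φ x * ψ x := by
  rw [inner_ofFun _ (memLp_of_continuous hψ), intervalIntegral.integral_of_le hL,
    integral_Ioc_eq_integral_Ioo]
  refine integral_congr_ae ?_
  filter_upwards [coeFn_ofFun (L := L) (memLp_of_continuous hφ)] with x hx
  rw [hx]

lemma abs_anti2_le {L : ℝ} (g : L2 L) {x : ℝ} (hx : x ∈ Ioo 0 L) :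
    |anti2 L g x| ≤ ‖g‖ * (√L * L) := by
  refine (abs_real_inner_le_norm _ _).trans ?_
  have hL : 0 < L := hx.1.trans hx.2
  gcongr
  refine norm_ofFun_le hL.le fun y hy => ?_
  rw [abs_of_nonneg (le_max_right _ _)]
  exact max_le (by linarith [hx.2, hy.1]) hL.le

lemma norm_anti2_le {L : ℝ} (hL : 0 < L) (g : L2 L) :
    ‖ofFun L (anti2 L g)‖ ≤ L ^ 2 * ‖g‖ := by
  refine (norm_ofFun_le (by positivity) fun x hx => abs_anti2_le g hx).trans (le_of_eq ?_)
  calc √L * (‖g‖ * (√L * L)) = (√L * √L) * (L * ‖g‖) := by ring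
    _ = _ := by rw [Real.mul_self_sqrt hL.le]; ring

/-- The affine part `f - anti2 g` has `L²` norm at most `(1 + L²)(‖f‖ + ‖g‖)`. Its slope is read off
by pairing with `x - L/2`, which is orthogonal to constants, and its constant term by pairing with
`1`. -/
lemma IsWeakD2.exists_eq_bound {L : ℝ} (hL : 0 < L) : ∃ C : ℝ, 0 ≤ C ∧
    ∀ f g : L2 L, IsWeakD2 L f g →
      ∃ α β : ℝ, f = ofFun L (fun x => α + β * x) + ofFun L (anti2 L g) ∧
        |α| ≤ C * (‖f‖ + ‖g‖) ∧ |β| ≤ C * (‖f‖ + ‖g‖) := by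
  -- The factor `12 / L ^ 3` inverts the integral of `x (x - L/2)` over `(0,L)`.
  set B := 12 / L ^ 3 * (√L * L) * (1 + L ^ 2) with hB
  set A := (1 / L) * (√L * (1 + L ^ 2) + B * (L ^ 2 / 2)) with hA
  have hB0 : 0 ≤ B := by positivity
  have hA0 : 0 ≤ A := by positivity
  refine ⟨A + B, by positivity, fun f g h => ?_⟩
  obtain ⟨α, β, hab⟩ := h.exists_eq hL
  set S := ‖f‖ + ‖g‖ with hS
  have hS0 : 0 ≤ S := by positivity
  set P := ofFun L (fun x => α + β * x) with hP
  have hPn : ‖P‖ ≤ (1 + L ^ 2) * S := by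
    have : P = f - ofFun L (anti2 L g) := by rw [hab]; abel
    rw [this]
    refine (norm_sub_le _ _).trans ?_
    have h1 := norm_anti2_le hL g
    have h2 := norm_nonneg f
    have h3 := norm_nonneg g
    have : (1 + L ^ 2) * S = ‖f‖ + L ^ 2 * ‖g‖ + (‖g‖ + L ^ 2 * ‖f‖) := by rw [hS]; ring
    have : 0 ≤ ‖g‖ + L ^ 2 * ‖f‖ := by positivity
    linarith
  have hβ : |β| ≤ B * S := by
    have e : inner ℝ P (ofFun L (fun x => x - L / 2)) = β * (L ^ 3 / 12) := by
      rw [hP, inner_ofFun_ofFun hL.le (by fun_prop) (by fun_prop),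
        intervalIntegral.integral_eq_sub_of_hasDerivAt
          (f := fun x => α * x ^ 2 / 2 - α * L / 2 * x + β * x ^ 3 / 3 - β * L * x ^ 2 / 4)
          (fun x _ => ?_) (Continuous.intervalIntegrable (by fun_prop) _ _)]
      · ring
      · have h1 := (hasDerivAt_pow 2 x).const_mul (α / 2)
        have h2 := (hasDerivAt_id x).const_mul (α * L / 2)
        have h3 := (hasDerivAt_pow 3 x).const_mul (β / 3)
        have h4 := (hasDerivAt_pow 2 x).const_mul (β * L / 4)
        refine (((h1.sub h2).add h3).sub h4).congr_deriv ?_ |>.congr_of_eventuallyEq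
          (Eventually.of_forall fun y => ?_)
        · push_cast; ring
        · simp; ring
    have h1 := abs_real_inner_le_norm P (ofFun L (fun x => x - L / 2))
    have h2 : ‖ofFun L (fun x => x - L / 2)‖ ≤ √L * L := norm_ofFun_le hL.le fun x hx => by
      rw [abs_le]; constructor <;> linarith [hx.1, hx.2]
    rw [e, abs_mul, abs_of_pos (by positivity : 0 < L ^ 3 / 12)] at h1
    have h3 : |β| * (L ^ 3 / 12) ≤ (1 + L ^ 2) * S * (√L * L) := h1.trans (by gcongr)
    have h4 : B * S = (1 + L ^ 2) * S * (√L * L) / (L ^ 3 / 12) := by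
      rw [hB]; field_simp
    rw [h4, le_div_iff₀ (by positivity)]
    exact h3
  have hα : |α| ≤ A * S := by
    have e : inner ℝ P (ofFun L (fun _ => 1)) = α * L + β * (L ^ 2 / 2) := by
      rw [hP, inner_ofFun_ofFun hL.le (by fun_prop) (by fun_prop),
        intervalIntegral.integral_eq_sub_of_hasDerivAt
          (f := fun x => α * x + β * x ^ 2 / 2)
          (fun x _ => ?_) (Continuous.intervalIntegrable (by fun_prop) _ _)]
      · ring
      · have h2 := (hasDerivAt_id x).const_mul α
        have h4 := (hasDerivAt_pow 2 x).const_mul (β / 2)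
        refine (h2.add h4).congr_deriv ?_ |>.congr_of_eventuallyEq
          (Eventually.of_forall fun y => ?_)
        · push_cast; ring
        · simp; ring
    have h1 := abs_real_inner_le_norm P (ofFun L (fun _ => 1))
    have h2 : ‖ofFun L (fun _ => 1)‖ ≤ √L * 1 := norm_ofFun_le zero_le_one fun x hx => by simp
    have h3 : |α * L + β * (L ^ 2 / 2)| ≤ (1 + L ^ 2) * S * (√L * 1) := by
      rw [← e]; exact h1.trans (by gcongr)
    have h5 : |α| * L ≤ (1 + L ^ 2) * S * (√L * 1) + B * S * (L ^ 2 / 2) := by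
      have h6 : |α| * L = |α * L + β * (L ^ 2 / 2) - β * (L ^ 2 / 2)| := by
        rw [add_sub_cancel_right, abs_mul, abs_of_pos hL]
      rw [h6]
      refine (abs_sub _ _).trans (add_le_add h3 ?_)
      rw [abs_mul, abs_of_pos (by positivity : 0 < L ^ 2 / 2)]
      gcongr
    have h4 : A * S = ((1 + L ^ 2) * S * (√L * 1) + B * S * (L ^ 2 / 2)) / L := by
      rw [hA]; field_simp
    rw [h4, le_div_iff₀ hL]
    exact h5
  exact ⟨α, β, hab, hα.trans (by nlinarith), hβ.trans (by nlinarith)⟩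

/-- An interpolation inequality between `L²(0,L)` and `H²(0,L)`. -/
lemma IsWeakD2.exists_sup_bound {L : ℝ} (hL : 0 < L) : ∃ C : ℝ, 0 ≤ C ∧
    ∀ f g : L2 L, IsWeakD2 L f g → ∀ r : ℝ, 0 < r → r ≤ L →
      ∀ᵐ x ∂(volume.restrict (Ioo (0 : ℝ) L)), |f x| ≤ ‖f‖ / √r + C * (‖f‖ + ‖g‖) * r := by
  obtain ⟨C, hC, hb⟩ := IsWeakD2.exists_eq_bound hL
  -- The constant is a Lipschitz constant of the continuous representative of `f`, relative to `‖f‖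
  -- + ‖g‖`: `C` for the affine part, `√L` for `anti2 g`.
  refine ⟨C + √L, by positivity, fun f g h r hr hrL => ?_⟩
  obtain ⟨α, β, hab, -, hβ⟩ := hb f g h
  set S := ‖f‖ + ‖g‖ with hS
  have hS0 : 0 ≤ S := by positivity
  set M := (C + √L) * S with hM
  have hM0 : 0 ≤ M := by positivity
  set F : ℝ → ℝ := fun x => α + β * x + anti2 L g x with hF
  have hFc : Continuous F := by
    have := continuous_anti2 g
    fun_prop
  have hfF : f =ᵐ[volume.restrict (Ioo (0 : ℝ) L)] F := by
    have : f = ofFun L F := by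
      rw [hab, hF, ofFun_add (memLp_of_continuous (by fun_prop))
        (memLp_of_continuous (continuous_anti2 g))]
    rw [this]
    exact coeFn_ofFun (memLp_of_continuous hFc)
  have hLip : ∀ x y, |F x - F y| ≤ M * |x - y| := by
    intro x y
    have h1 := anti2_sub_le g x y
    have h2 : F x - F y = β * (x - y) + (anti2 L g x - anti2 L g y) := by simp only [hF]; ring
    rw [h2]
    refine (abs_add_le _ _).trans ?_
    rw [abs_mul]
    have h3 : ‖g‖ ≤ S := by rw [hS]; linarith [norm_nonneg f]
    calc |β| * |x - y| + |anti2 L g x - anti2 L g y|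
        ≤ C * S * |x - y| + √L * S * |x - y| := by
          refine add_le_add (by gcongr) (h1.trans (by gcongr))
      _ = _ := by rw [hM]; ring
  filter_upwards [hfF, ae_restrict_mem measurableSet_Ioo] with x hx hx0
  rw [hx]
  by_contra! hcon
  set q := ‖f‖ / √r with hq
  have hq0 : 0 ≤ q := by positivity
  -- The interval `[a, a + r]` lies in `[0,L]` and contains `x`. If the bound failed at `x`, the
  -- Lipschitz estimate would give `|F| > ‖f‖ / √r` on all of it, and integrating the square would
  -- exceed `‖f‖²`.
  set a := min x (L - r) with ha
  have ha1 : a ≤ x := min_le_left _ _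
  have ha2 : a + r ≤ L := by linarith [min_le_right x (L - r)]
  have ha3 : x ≤ a + r := by
    rw [ha]
    rcases le_total x (L - r) with h' | h'
    · rw [min_eq_left h']; linarith
    · rw [min_eq_right h']; linarith [hx0.2]
  have ha0 : 0 ≤ a := le_min hx0.1.le (by linarith)
  have hlow : ∀ y ∈ Icc a (a + r), (|F x| - M * r) ^ 2 ≤ F y ^ 2 := by
    intro y hy
    have h1 := hLip x y
    have h2 : |x - y| ≤ r := by
      rw [abs_le]; constructor <;> linarith [hy.1, hy.2]
    have h3 : |F x| - |F y| ≤ |F x - F y| := abs_sub_abs_le_abs_sub _ _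
    have h4 : M * |x - y| ≤ M * r := by gcongr
    rw [← sq_abs (F y)]
    exact pow_le_pow_left₀ (by linarith) (by linarith) 2
  have h1 : r * (|F x| - M * r) ^ 2 ≤ ∫ y in a..(a + r), F y ^ 2 := by
    have := intervalIntegral.integral_mono_on (a := a) (b := a + r) (μ := volume)
      (f := fun _ => (|F x| - M * r) ^ 2) (g := fun y => F y ^ 2) (by linarith)
      (by simp) ((hFc.pow 2).intervalIntegrable _ _) hlow
    rw [intervalIntegral.integral_const, smul_eq_mul] at this
    linarith
  have h2 : ∫ y in a..(a + r), F y ^ 2 ≤ ‖f‖ ^ 2 := by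
    rw [norm_sq_eq_integral, intervalIntegral.integral_of_le (by linarith),
      integral_Ioc_eq_integral_Ioo]
    have e : ∫ y in Ioo 0 L, f y ^ 2 = ∫ y in Ioo 0 L, F y ^ 2 := by
      refine integral_congr_ae ?_
      filter_upwards [hfF] with y hy
      rw [hy]
    rw [e]
    refine setIntegral_mono_set ?_ (ae_of_all _ fun y => sq_nonneg _)
      (Ioo_subset_Ioo ha0 ha2).eventuallyLE
    exact ((hFc.pow 2).integrableOn_Icc (a := 0) (b := L)).mono_set Ioo_subset_Icc_self
  have h3 : ‖f‖ ^ 2 = r * q ^ 2 := by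
    rw [hq, div_pow, Real.sq_sqrt hr.le]
    field_simp
  have h4 : q ^ 2 < (|F x| - M * r) ^ 2 :=
    pow_lt_pow_left₀ (by linarith) hq0 two_ne_zero
  nlinarith

/-- A weakly convergent sequence converges uniformly on bounded subsets of `H²(0,L)`. -/
lemma exists_tendsto_weak_bound {L : ℝ} (hL : 0 < L) {p : ℕ → L2 L} {R : ℝ}
    (hR : ∀ n, ‖p n‖ ≤ R) (hp : ∀ q : L2 L, Tendsto (fun n => inner ℝ (p n) q) atTop (𝓝 0)) :
    ∃ κ : ℕ → ℝ, (∀ n, 0 ≤ κ n) ∧ Tendsto κ atTop (𝓝 0) ∧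
      ∀ n, ∀ f g : L2 L, IsWeakD2 L f g → |inner ℝ (p n) f| ≤ κ n * (‖f‖ + ‖g‖) := by
  obtain ⟨C, hC, hb⟩ := IsWeakD2.exists_eq_bound hL
  -- Compactness of twofold integration: weak convergence gives pointwise convergence of `coanti2 L
  -- (p n)`, and the uniform bound allows dominated convergence.
  have hK : Tendsto (fun n => ‖ofFun L (coanti2 L (p n))‖) atTop (𝓝 0) := by
    have hsq : Tendsto (fun n => ‖ofFun L (coanti2 L (p n))‖ ^ 2) atTop (𝓝 0) := by
      have e : ∀ n, ‖ofFun L (coanti2 L (p n))‖ ^ 2 = ∫ x in Ioo 0 L, coanti2 L (p n) x ^ 2 := by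
        intro n
        rw [norm_sq_eq_integral]
        refine integral_congr_ae ?_
        filter_upwards [coeFn_ofFun (L := L) (memLp_of_continuous (continuous_coanti2 (p n)))]
          with y hy
        rw [hy]
      simp only [e]
      have e0 : ∫ x in Ioo 0 L, (fun _ => (0 : ℝ)) x = 0 := integral_zero _ _
      refine Eq.subst (motive := fun c => Tendsto _ atTop (𝓝 c)) e0 ?_
      refine tendsto_integral_of_dominated_convergence (fun _ => (R * (√L * L)) ^ 2)
        (fun n => ((continuous_coanti2 (p n)).pow 2).aestronglyMeasurable)
        (integrable_const (μ := volume.restrict (Ioo 0 L)) ((R * (√L * L)) ^ 2))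
        (fun n => ?_) (ae_of_all _ fun y => ?_)
      · filter_upwards [ae_restrict_mem measurableSet_Ioo] with y hy
        rw [Real.norm_eq_abs, abs_pow]
        refine pow_le_pow_left₀ (abs_nonneg _) ((abs_coanti2_le _ hy).trans ?_) 2
        have := hR n
        gcongr
      · have := (hp (ofFun L fun x => max (x - y) 0)).pow 2
        simpa [coanti2] using this
    have := hsq.sqrt
    simpa using this
  refine ⟨fun n => C * |inner ℝ (p n) (ofFun L fun _ => 1)| + C * |inner ℝ (p n) (ofFun L fun x => x)|
    + ‖ofFun L (coanti2 L (p n))‖, fun n => by positivity, ?_, fun n f g h => ?_⟩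
  · have := (((hp (ofFun L fun _ => 1)).abs.const_mul C).add
      ((hp (ofFun L fun x => x)).abs.const_mul C)).add hK
    simpa using this
  · obtain ⟨α, β, hab, hα, hβ⟩ := hb f g h
    set S := ‖f‖ + ‖g‖ with hS
    have hg : ‖g‖ ≤ S := by rw [hS]; linarith [norm_nonneg f]
    -- The affine part needs only two scalar limits; the rest is moved onto `coanti2 L (p n)`, which
    -- converges strongly.
    have e : inner ℝ (p n) f = α * inner ℝ (p n) (ofFun L fun _ => 1)
        + β * inner ℝ (p n) (ofFun L fun x => x) + inner ℝ g (ofFun L (coanti2 L (p n))) := by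
      rw [hab, inner_add_right, inner_anti2, ofFun_affine, inner_add_right, inner_smul_right,
        inner_smul_right]
    rw [e]
    refine (abs_add_le _ _).trans ?_
    refine (add_le_add (abs_add_le _ _) (abs_real_inner_le_norm _ _)).trans ?_
    rw [abs_mul, abs_mul]
    calc _ ≤ C * S * |inner ℝ (p n) (ofFun L fun _ => 1)|
          + C * S * |inner ℝ (p n) (ofFun L fun x => x)| + S * ‖ofFun L (coanti2 L (p n))‖ := by
          gcongr
      _ = _ := by ring

/-! ### Mollification in time -/

/-- `η` is a mollifier supported in `[-ε,ε]`. -/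
structure IsMollifier (ε : ℝ) (η : ℝ → ℝ) : Prop where
  contDiff : ContDiff ℝ ∞ η
  eq_zero : ∀ x, ε < |x| → η x = 0
  nonneg : ∀ x, 0 ≤ η x
  integral : ∫ x, η x = 1

lemma hasCompactSupport_of_abs {ε : ℝ} {η : ℝ → ℝ} (h : ∀ x, ε < |x| → η x = 0) :
    HasCompactSupport η :=
  HasCompactSupport.intro (isCompact_closedBall (0 : ℝ) ε) fun x hx => h x (by
    rwa [Metric.mem_closedBall, Real.dist_eq, sub_zero, not_le] at hx)

lemma deriv_eq_zero_of_abs {ε : ℝ} {η : ℝ → ℝ} (h : ∀ x, ε < |x| → η x = 0) {x : ℝ}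
    (hx : ε < |x|) : deriv η x = 0 := by
  have : η =ᶠ[𝓝 x] fun _ => 0 := by
    filter_upwards [(isOpen_lt continuous_const continuous_abs).mem_nhds hx] with y hy
    exact h y hy
  rw [this.deriv_eq, deriv_const]

section Convolution

variable {L : ℝ}

/-- The convolution in time of a scalar function and a curve in `L²(0,L)`. -/
def tconv (η : ℝ → ℝ) (X : ℝ → L2 L) : ℝ → L2 L :=
  convolution η X (ContinuousLinearMap.lsmul ℝ ℝ) volume

lemma tconv_apply (η : ℝ → ℝ) (X : ℝ → L2 L) (s : ℝ) :
    tconv η X s = ∫ t, η (s - t) • X t :=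
  convolution_lsmul_swap

lemma integrable_tconv {η : ℝ → ℝ} {X : ℝ → L2 L} (hη : Continuous η) (hc : HasCompactSupport η)
    (hX : LocallyIntegrable X) (s : ℝ) : Integrable fun t => η (s - t) • X t := by
  refine hX.integrable_smul_left_of_hasCompactSupport (hη.comp (by fun_prop)) ?_
  exact hc.comp_homeomorph (Homeomorph.subLeft s)

lemma hasDerivAt_tconv {η : ℝ → ℝ} {X : ℝ → L2 L} (hη : ContDiff ℝ ∞ η)
    (hc : HasCompactSupport η) (hX : LocallyIntegrable X) (s : ℝ) :
    HasDerivAt (tconv η X) (tconv (deriv η) X s) s :=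
  HasCompactSupport.hasDerivAt_convolution_left _ hc (hη.of_le (by exact_mod_cast le_top)) hX s

lemma continuous_tconv {η : ℝ → ℝ} {X : ℝ → L2 L} (hη : ContDiff ℝ ∞ η)
    (hc : HasCompactSupport η) (hX : LocallyIntegrable X) : Continuous (tconv η X) :=
  continuous_iff_continuousAt.2 fun s => (hasDerivAt_tconv hη hc hX s).continuousAt

lemma inner_integral_left {ι : Type*} [MeasurableSpace ι] {m : Measure ι} {X : ι → L2 L}
    (hX : Integrable X m) (q : L2 L) : inner ℝ (∫ t, X t ∂m) q = ∫ t, inner ℝ (X t) q ∂m := by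
  rw [real_inner_comm, ← integral_inner hX]
  simp only [real_inner_comm]

lemma isWeakD2_integral {ι : Type*} [MeasurableSpace ι] {m : Measure ι} {X Y : ι → L2 L}
    (hX : Integrable X m) (hY : Integrable Y m)
    (h : ∀ φ, IsTest L φ → ∀ᵐ t ∂m, inner ℝ (X t) (ofFun L (deriv (deriv φ)))
      = inner ℝ (Y t) (ofFun L φ)) :
    IsWeakD2 L (∫ t, X t ∂m) (∫ t, Y t ∂m) := by
  intro φ hφ
  rw [inner_integral_left hX, inner_integral_left hY]
  exact integral_congr_ae (h φ hφ)

lemma isWeakD2_tconv {η : ℝ → ℝ} {X Y : ℝ → L2 L} (hη : Continuous η)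
    (hc : HasCompactSupport η) (hX : LocallyIntegrable X) (hY : LocallyIntegrable Y)
    (h : ∀ φ, IsTest L φ → ∀ᵐ t, inner ℝ (X t) (ofFun L (deriv (deriv φ)))
      = inner ℝ (Y t) (ofFun L φ)) (s : ℝ) : IsWeakD2 L (tconv η X s) (tconv η Y s) := by
  rw [tconv_apply, tconv_apply]
  refine isWeakD2_integral (integrable_tconv hη hc hX s) (integrable_tconv hη hc hY s)
    fun φ hφ => ?_
  filter_upwards [h φ hφ] with t ht
  rw [real_inner_smul_left, real_inner_smul_left, ht]

lemma tconv_eq_zero {ε : ℝ} {η : ℝ → ℝ} (hz : ∀ x, ε < |x| → η x = 0) {X : ℝ → L2 L}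
    (hX : ∀ t ≤ 0, X t = 0) {s : ℝ} (hs : s < -ε) : tconv η X s = 0 := by
  rw [tconv_apply]
  refine integral_eq_zero_of_ae (ae_of_all _ fun t => ?_)
  rcases le_or_gt t 0 with ht | ht
  · simp [hX t ht]
  · simp only [Pi.zero_apply]
    rw [hz _ (lt_abs.2 (Or.inr (by linarith))), zero_smul]

lemma norm_tconv_le {ε B : ℝ} {η : ℝ → ℝ} (hη : IsMollifier ε η) {X : ℝ → L2 L} {s : ℝ}
    (hX : ∀ᵐ t, |s - t| ≤ ε → ‖X t‖ ≤ B) : ‖tconv η X s‖ ≤ B := by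
  rw [tconv_apply]
  have hc := hasCompactSupport_of_abs hη.eq_zero
  have hi : Integrable η := hη.contDiff.continuous.integrable_of_hasCompactSupport hc
  have hi' : Integrable fun t => η (s - t) * B := (hi.comp_sub_left s).mul_const B
  refine (norm_integral_le_of_norm_le hi' ?_).trans ?_
  · filter_upwards [hX] with t ht
    rw [norm_smul, Real.norm_eq_abs, abs_of_nonneg (hη.nonneg _)]
    by_cases h : |s - t| ≤ ε
    · have := ht h
      have := hη.nonneg (s - t)
      gcongr
    · rw [hη.eq_zero _ (not_le.1 h)]
      simp
  · rw [integral_mul_const, integral_sub_left_eq_self (fun t => η t), hη.integral, one_mul]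

end Convolution

/-- Convergence at Lebesgue points lets bounds on mollified curves pass to the limit for almost
every time. Radii below `1` ensure that the mollified curves vanish at time `-1`, where the
integrations in time start. -/
lemma exists_mollifiers : ∃ (ε : ℕ → ℝ) (η : ℕ → ℝ → ℝ), (∀ k, 0 < ε k ∧ ε k < 1) ∧
    Tendsto ε atTop (𝓝 0) ∧ (∀ k, IsMollifier (ε k) (η k)) ∧
    ∀ {L : ℝ} {X : ℝ → L2 L}, LocallyIntegrable X →
      ∀ᵐ s, Tendsto (fun k => tconv (η k) X s) atTop (𝓝 (X s)) := by
  let b : ℕ → ContDiffBump (0 : ℝ) := fun k =>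
    ⟨1 / ((k : ℝ) + 2) / 2, 1 / ((k : ℝ) + 2), by positivity, half_lt_self (by positivity)⟩
  have hlim : Tendsto (fun k => (b k).rOut) atTop (𝓝 0) := by
    have := (tendsto_one_div_add_atTop_nhds_zero_nat (𝕜 := ℝ)).comp (tendsto_add_atTop_nat 1)
    refine this.congr fun k => ?_
    simp only [b, Function.comp]
    push_cast
    ring
  refine ⟨fun k => (b k).rOut, fun k => (b k).normed volume, fun k => ⟨(b k).rOut_pos, ?_⟩, hlim,
    fun k => ⟨(b k).contDiff_normed, fun x hx => ?_, fun x => (b k).nonneg_normed x,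
      (b k).integral_normed⟩, fun {L X} hX => ?_⟩
  · simp only [b]
    rw [div_lt_one (by positivity)]
    have : (0 : ℝ) ≤ k := Nat.cast_nonneg k
    linarith
  · have : x ∉ Function.support ((b k).normed volume) := by
      rw [(b k).support_normed_eq, Metric.mem_ball, Real.dist_eq, sub_zero, not_lt]
      exact hx.le
    simpa using this
  · refine ContDiffBump.ae_convolution_tendsto_right_of_locallyIntegrable (K := 2) hlim
      (Eventually.of_forall fun k => ?_) hX
    simp only [b]
    linarith

/-! ### The beam equation for curves in `L²(0,L)` -/

/-- The curve `X : ℝ → L²(0,L)`, extended by zero to negative times, with second space derivative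
`Y`, solves `ρ X'' + μ ∂ₓₓ Y + F = 0` for times less than `τ`, with data `u₀, u₁`. -/
structure IsBeamCurve (L ρ μ τ : ℝ) (u₀ u₁ : L2 L) (X Y F : ℝ → L2 L) : Prop where
  locX : LocallyIntegrable X
  locY : LocallyIntegrable Y
  locF : LocallyIntegrable F
  zeroX : ∀ t ≤ 0, X t = 0
  zeroY : ∀ t ≤ 0, Y t = 0
  weak : ∀ φ, IsTest L φ → ∀ᵐ t, inner ℝ (X t) (ofFun L (deriv (deriv φ)))
      = inner ℝ (Y t) (ofFun L φ)
  eqn : ∀ θ : ℝ → ℝ, ContDiff ℝ ∞ θ → HasCompactSupport θ → tsupport θ ⊆ Iio τ →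
    ∀ f g : L2 L, IsWeakD2 L f g →
      ρ * inner ℝ (∫ t, deriv (deriv θ) t • X t) f + μ * inner ℝ (∫ t, θ t • Y t) g
        + inner ℝ (∫ t, θ t • F t) f - ρ * θ 0 * inner ℝ u₁ f + ρ * deriv θ 0 * inner ℝ u₀ f = 0

/-! ### Linearity of the equation and its mollified form -/

namespace IsBeamCurve

variable {L ρ μ τ : ℝ} {u₀ u₁ : L2 L} {X Y F : ℝ → L2 L}

/-- In `weak` the exceptional null set depends on the test function. Mollified curves satisfy the
relation at every time for all tests at once, and it survives the limit outside a single null set.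
-/
lemma ae_isWeakD2 (h : IsBeamCurve L ρ μ τ u₀ u₁ X Y F) : ∀ᵐ t, IsWeakD2 L (X t) (Y t) := by
  obtain ⟨ε, η, -, -, hη, hlim⟩ := exists_mollifiers
  filter_upwards [hlim h.locX, hlim h.locY] with t h1 h2
  exact IsWeakD2.of_tendsto h1 h2 (Eventually.of_forall fun k =>
    isWeakD2_tconv (hη k).contDiff.continuous (hasCompactSupport_of_abs (hη k).eq_zero)
      h.locX h.locY h.weak t)

lemma sub {u₀' u₁' : L2 L} {X' Y' F' : ℝ → L2 L} (h : IsBeamCurve L ρ μ τ u₀ u₁ X Y F)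
    (h' : IsBeamCurve L ρ μ τ u₀' u₁' X' Y' F') :
    IsBeamCurve L ρ μ τ (u₀ - u₀') (u₁ - u₁') (X - X') (Y - Y') (F - F') := by
  refine ⟨h.locX.sub h'.locX, h.locY.sub h'.locY, h.locF.sub h'.locF, fun t ht => ?_,
    fun t ht => ?_, fun φ hφ => ?_, fun θ h1 h2 h3 f g hfg => ?_⟩
  · simp [h.zeroX t ht, h'.zeroX t ht]
  · simp [h.zeroY t ht, h'.zeroY t ht]
  · filter_upwards [h.weak φ hφ, h'.weak φ hφ] with t e1 e2
    simp only [Pi.sub_apply, inner_sub_left, e1, e2]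
  · have a1 := h.eqn θ h1 h2 h3 f g hfg
    have a2 := h'.eqn θ h1 h2 h3 f g hfg
    have i : ∀ {ζ : ℝ → ℝ} {Z Z' : ℝ → L2 L}, Continuous ζ → HasCompactSupport ζ →
        LocallyIntegrable Z → LocallyIntegrable Z' →
        ∫ t, ζ t • (Z - Z') t = (∫ t, ζ t • Z t) - ∫ t, ζ t • Z' t := by
      intro ζ Z Z' c1 c2 l1 l2
      rw [← integral_sub (l1.integrable_smul_left_of_hasCompactSupport c1 c2)
        (l2.integrable_smul_left_of_hasCompactSupport c1 c2)]
      simp only [Pi.sub_apply, smul_sub]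
    rw [i (contDiff_deriv (contDiff_deriv h1)).continuous h2.deriv.deriv h.locX h'.locX,
      i h1.continuous h2 h.locY h'.locY, i h1.continuous h2 h.locF h'.locF]
    simp only [inner_sub_left]
    linarith

/-- The time test function is `t ↦ η (s - t)`, supported before `τ` because `s + ε < τ`. The jumps
at time zero of the curve extended by zero appear as the sources `η u₁` and `η' u₀`. -/
lemma tconv_eqn (h : IsBeamCurve L ρ μ τ u₀ u₁ X Y F) {ε : ℝ} {η : ℝ → ℝ}
    (hη : ContDiff ℝ ∞ η) (hz : ∀ x, ε < |x| → η x = 0) {s : ℝ} (hs : s + ε < τ) {f g : L2 L}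
    (hfg : IsWeakD2 L f g) :
    ρ * inner ℝ (tconv (deriv (deriv η)) X s) f + μ * inner ℝ (tconv η Y s) g
      + inner ℝ (tconv η F s) f = ρ * η s * inner ℝ u₁ f + ρ * deriv η s * inner ℝ u₀ f := by
  have hc := hasCompactSupport_of_abs hz
  have d : ∀ {ζ : ℝ → ℝ}, ContDiff ℝ ∞ ζ →
      deriv (fun t => ζ (s - t)) = fun t => - deriv ζ (s - t) := by
    intro ζ hζ
    ext t
    rw [deriv_comp_const_sub]
  have h3 : tsupport (fun t => η (s - t)) ⊆ Iio τ := by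
    refine (closure_minimal (fun t ht => ?_) isClosed_Icc : _ ⊆ Icc (s - ε) (s + ε)).trans
      fun t ht => ht.2.trans_lt hs
    by_contra hcon
    refine ht (hz _ (not_le.1 fun hle => hcon ?_))
    rw [abs_le] at hle
    constructor <;> linarith [hle.1, hle.2]
  have := h.eqn (fun t => η (s - t)) (hη.comp (by fun_prop))
    (hc.comp_homeomorph (Homeomorph.subLeft s)) h3 f g hfg
  have e2 : deriv (deriv fun t => η (s - t)) = fun t => deriv (deriv η) (s - t) := by
    rw [d hη]
    have : (fun t => -deriv η (s - t)) = -(fun t => deriv η (s - t)) := rfl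
    rw [this, deriv.neg', d (contDiff_deriv hη)]
    simp
  rw [e2, d hη] at this
  simp only [sub_zero] at this
  simp only [tconv_apply]
  linarith

end IsBeamCurve

/-! ### Energy estimates for the forced equation with zero initial data -/

namespace IsBeamCurve

variable {L ρ μ τ : ℝ} {u₀ u₁ : L2 L} {X Y F : ℝ → L2 L}

/-- The energy estimate for the mollified equation with zero initial data. -/
lemma tconv_energy_le (hρ : 0 < ρ) (hμ : 0 < μ) (h : IsBeamCurve L ρ μ τ 0 0 X Y F) {β lam : ℝ}
    (hβ : 0 ≤ β) (hlam : 0 < lam) (hF : ∀ᵐ t, ‖F t‖ ≤ β * Real.exp (lam * t)) {ε : ℝ}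
    (hε : 0 < ε) {η : ℝ → ℝ} (hη : IsMollifier ε η) {s : ℝ} (hs : s + ε < τ) :
    ρ * ‖tconv (deriv η) X s‖ ^ 2 + μ * ‖tconv η Y s‖ ^ 2
      ≤ (β * Real.exp (lam * (s + ε))) ^ 2 / (lam ^ 2 * ρ) := by
  have hc := hasCompactSupport_of_abs hη.eq_zero
  have hz1 : ∀ x, ε < |x| → deriv η x = 0 := fun x => deriv_eq_zero_of_abs hη.eq_zero
  have c1 := contDiff_deriv hη.contDiff
  have dA : ∀ r, HasDerivAt (tconv (deriv η) X) (tconv (deriv (deriv η)) X r) r :=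
    hasDerivAt_tconv c1 hc.deriv h.locX
  have dB : ∀ r, HasDerivAt (tconv η Y) (tconv (deriv η) Y r) r :=
    hasDerivAt_tconv hη.contDiff hc h.locY
  set β' := β * Real.exp (lam * ε) with hβ'
  have hFb : ∀ r, ‖tconv η F r‖ ≤ β' * Real.exp (lam * r) := by
    intro r
    refine norm_tconv_le hη ?_
    filter_upwards [hF] with t ht hrt
    refine ht.trans ?_
    rw [hβ', mul_assoc, ← Real.exp_add]
    have : t ≤ r + ε := by linarith [(abs_le.1 hrt).1]
    gcongr
    nlinarith
  set P : ℝ → ℝ := fun r => ρ * ‖tconv (deriv η) X r‖ ^ 2 + μ * ‖tconv η Y r‖ ^ 2 with hP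
  -- The energy identity: the mollified equation is tested with the time derivative of the mollified
  -- curve, so both quadratic terms become derivatives.
  have dP : ∀ r, r + ε < τ → HasDerivAt P (-2 * inner ℝ (tconv η F r) (tconv (deriv η) X r)) r := by
    intro r hr
    have e := h.tconv_eqn hη.contDiff hη.eq_zero hr
      (isWeakD2_tconv c1.continuous hc.deriv h.locX h.locY h.weak r)
    rw [inner_zero_left, mul_zero, mul_zero, add_zero] at e
    refine (((dA r).norm_sq.const_mul ρ).add ((dB r).norm_sq.const_mul μ)).congr_deriv ?_
    rw [real_inner_comm (tconv (deriv (deriv η)) X r) (tconv (deriv η) X r)]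
    linarith
  set c := β' ^ 2 / (lam ^ 2 * ρ) with hcdef
  -- Young's inequality gives `P' ≤ lam P + (β' exp (lam r))² / (lam ρ)`. The weight absorbs `lam
  -- P`, and `c` is chosen so that the last term cancels the rest; hence `Q` is nonincreasing.
  set Q : ℝ → ℝ := fun r => P r * Real.exp (-lam * r) - c * Real.exp (lam * r) with hQ
  have dexp : ∀ (a r : ℝ), HasDerivAt (fun r => Real.exp (a * r)) (a * Real.exp (a * r)) r := by
    intro a r
    have := ((hasDerivAt_id r).const_mul a).exp
    refine this.congr_deriv ?_
    simp only [id]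
    ring
  have dQ : ∀ r, r + ε < τ → HasDerivAt Q
      (-2 * inner ℝ (tconv η F r) (tconv (deriv η) X r) * Real.exp (-lam * r)
        + P r * (-lam * Real.exp (-lam * r)) - c * (lam * Real.exp (lam * r))) r := by
    intro r hr
    exact ((dP r hr).mul (dexp (-lam) r)).sub ((dexp lam r).const_mul c)
  have hanti : AntitoneOn Q (Iio (τ - ε)) := by
    refine antitoneOn_of_deriv_nonpos (convex_Iio _)
      (fun r hr => (dQ r (by linarith [mem_Iio.1 hr])).continuousAt.continuousWithinAt)
      (fun r hr => ?_) (fun r hr => ?_)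
    · rw [interior_Iio] at hr
      exact (dQ r (by linarith [mem_Iio.1 hr])).differentiableAt.differentiableWithinAt
    · rw [interior_Iio] at hr
      rw [(dQ r (by linarith [mem_Iio.1 hr])).deriv]
      set p := ‖tconv (deriv η) X r‖ with hp
      set E := Real.exp (lam * r) with hE
      have hE0 : 0 < E := Real.exp_pos _
      have hE' : Real.exp (-lam * r) = E⁻¹ := by rw [hE, ← Real.exp_neg]; ring_nf
      have i1 : -2 * inner ℝ (tconv η F r) (tconv (deriv η) X r) ≤ 2 * (β' * E) * p := by
        have h1 := (abs_le.1 (abs_real_inner_le_norm (tconv η F r) (tconv (deriv η) X r))).1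
        have h2 := mul_le_mul_of_nonneg_right (hFb r) (norm_nonneg (tconv (deriv η) X r))
        linarith
      have i2 : ρ * p ^ 2 ≤ P r := by
        simp only [hP]
        have : 0 ≤ μ * ‖tconv η Y r‖ ^ 2 := by positivity
        linarith
      have i3 : 2 * (β' * E) * p ≤ lam * (ρ * p ^ 2) + (β' * E) ^ 2 / (lam * ρ) := by
        have h4 : lam * (ρ * p ^ 2) + (β' * E) ^ 2 / (lam * ρ) - 2 * (β' * E) * p
          = (lam * ρ * p - β' * E) ^ 2 / (lam * ρ) := by field_simp; ring
        have : 0 ≤ (lam * ρ * p - β' * E) ^ 2 / (lam * ρ) := by positivity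
        linarith
      have i4 : -2 * inner ℝ (tconv η F r) (tconv (deriv η) X r) - lam * P r
          ≤ (β' * E) ^ 2 / (lam * ρ) := by nlinarith
      have i5 := mul_le_mul_of_nonneg_right i4 (inv_pos.2 hE0).le
      have i6 : (β' * E) ^ 2 / (lam * ρ) * E⁻¹ = c * (lam * E) := by
        rw [hcdef]; field_simp
      rw [hE']
      linarith
  -- Zero initial data are used in this form: before time `-ε` the mollified curve vanishes
  -- identically.
  have hQ0 : ∀ r, r < -ε → Q r ≤ 0 := by
    intro r hr
    have e1 : tconv (deriv η) X r = 0 := tconv_eq_zero hz1 h.zeroX hr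
    have e2 : tconv η Y r = 0 := tconv_eq_zero hη.eq_zero h.zeroY hr
    simp only [hQ, hP, e1, e2, norm_zero]
    have : 0 ≤ c * Real.exp (lam * r) := by positivity
    linarith
  have hQs : Q s ≤ 0 := by
    set r := min s (-ε - 1) with hr
    have h1 : r ≤ s := min_le_left _ _
    have h2 : r < -ε := (min_le_right _ _).trans_lt (by linarith)
    exact (hanti (by simp only [mem_Iio]; linarith) (by simp only [mem_Iio]; linarith) h1).trans
      (hQ0 r h2)
  have hE0 := Real.exp_pos (lam * s)
  have hE' : Real.exp (-lam * s) = (Real.exp (lam * s))⁻¹ := by rw [← Real.exp_neg]; ring_nf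
  simp only [hQ, hE'] at hQs
  have h3 : P s * (Real.exp (lam * s))⁻¹ ≤ c * Real.exp (lam * s) := by linarith
  rw [← div_eq_mul_inv, div_le_iff₀ hE0] at h3
  refine h3.trans (le_of_eq ?_)
  rw [hcdef, hβ', mul_add, Real.exp_add]
  ring

/-- The energy estimate for the equation with zero initial data. -/
lemma energy_le (hρ : 0 < ρ) (hμ : 0 < μ) (h : IsBeamCurve L ρ μ τ 0 0 X Y F) {β lam : ℝ}
    (hβ : 0 ≤ β) (hlam : 0 < lam) (hF : ∀ᵐ t, ‖F t‖ ≤ β * Real.exp (lam * t)) :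
    ∀ᵐ s, s < τ → ‖X s‖ ≤ β * Real.exp (lam * s) / (lam ^ 2 * ρ) ∧
      μ * ‖Y s‖ ^ 2 ≤ (β * Real.exp (lam * s)) ^ 2 / (lam ^ 2 * ρ) := by
  obtain ⟨ε, η, hε, hε0, hη, hlim⟩ := exists_mollifiers
  filter_upwards [hlim h.locX, hlim h.locY] with s h1 h2 hs
  have hev : ∀ᶠ k in atTop, s + ε k < τ := by
    have : Tendsto (fun k => s + ε k) atTop (𝓝 (s + 0)) := hε0.const_add s
    rw [add_zero] at this
    exact this.eventually_lt_const hs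
  have hexp : Tendsto (fun k => β * Real.exp (lam * (s + ε k))) atTop
      (𝓝 (β * Real.exp (lam * s))) := by
    have : Tendsto (fun k => s + ε k) atTop (𝓝 (s + 0)) := hε0.const_add s
    rw [add_zero] at this
    exact ((Real.continuous_exp.tendsto _).comp (this.const_mul lam)).const_mul β
  constructor
  · refine le_of_tendsto_of_tendsto h1.norm (hexp.div_const _) ?_
    filter_upwards [hev] with k hk
    set e := ε k with he
    have hc := hasCompactSupport_of_abs (hη k).eq_zero
    -- An antiderivative of the velocity bound `β exp (lam (r + e)) / (lam ρ)`; integrating the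
    -- exponential gains another `1 / lam`.
    set B : ℝ → ℝ := fun r => β * Real.exp (lam * (r + e)) / (lam ^ 2 * ρ) with hB
    have dB : ∀ r, HasDerivAt B (β * Real.exp (lam * (r + e)) / (lam * ρ)) r := by
      intro r
      have := ((((hasDerivAt_id r).add_const e).const_mul lam).exp.const_mul β).div_const
        (lam ^ 2 * ρ)
      refine this.congr_deriv ?_
      simp only [id]
      field_simp
    set r₀ := min s (-e - 1) with hr0
    have hr1 : r₀ ≤ s := min_le_left _ _
    have hr2 : r₀ < -e := (min_le_right _ _).trans_lt (by linarith)
    refine image_norm_le_of_norm_deriv_right_le_deriv_boundary (f := tconv (η k) X)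
      (f' := tconv (deriv (η k)) X) (a := r₀) (b := s) (B := B)
      (continuous_tconv (hη k).contDiff hc h.locX).continuousOn
      (fun r _ => (hasDerivAt_tconv (hη k).contDiff hc h.locX r).hasDerivWithinAt) ?_
      dB (fun r hr => ?_) ⟨hr1, le_rfl⟩
    · rw [tconv_eq_zero (hη k).eq_zero h.zeroX hr2, norm_zero]
      simp only [hB]
      positivity
    · have he' := h.tconv_energy_le hρ hμ hβ hlam hF (hε k).1 (hη k) (s := r)
        (by linarith [hr.2])
      set D := β * Real.exp (lam * (r + e)) with hD
      have hD0 : 0 ≤ D := by positivity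
      have : 0 ≤ μ * ‖tconv (η k) Y r‖ ^ 2 := by positivity
      refine abs_le_of_sq_le_sq' ?_ (by positivity) |>.2
      have h5 : ρ * ‖tconv (deriv (η k)) X r‖ ^ 2 ≤ D ^ 2 / (lam ^ 2 * ρ) := by linarith
      rw [mul_comm, ← le_div_iff₀ hρ] at h5
      refine h5.trans (le_of_eq ?_)
      field_simp
  · refine le_of_tendsto_of_tendsto ((h2.norm.pow 2).const_mul μ) ((hexp.pow 2).div_const _) ?_
    filter_upwards [hev] with k hk
    have he' := h.tconv_energy_le hρ hμ hβ hlam hF (hε k).1 (hη k) hk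
    have : 0 ≤ ρ * ‖tconv (deriv (η k)) X s‖ ^ 2 := by positivity
    linarith

/-- The bound for the velocity. -/
lemma velocity_le (hρ : 0 < ρ) (hμ : 0 < μ) (h : IsBeamCurve L ρ μ τ 0 0 X Y F) {β lam : ℝ}
    (hβ : 0 ≤ β) (hlam : 0 < lam) (hF : ∀ᵐ t, ‖F t‖ ≤ β * Real.exp (lam * t)) {V : ℝ → L2 L}
    (hV : LocallyIntegrable V)
    (hXV : ∀ θ : ℝ → ℝ, ContDiff ℝ ∞ θ → HasCompactSupport θ → tsupport θ ⊆ Ioi 0 →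
      ∫ t, deriv θ t • X t = - ∫ t, θ t • V t) :
    ∀ᵐ s, 0 < s → s < τ → ρ * ‖V s‖ ^ 2 ≤ (β * Real.exp (lam * s)) ^ 2 / (lam ^ 2 * ρ) := by
  obtain ⟨ε, η, hε, hε0, hη, hlim⟩ := exists_mollifiers
  filter_upwards [hlim hV] with s h1 hs0 hs
  have hl : Tendsto (fun k => s + ε k) atTop (𝓝 s) := by
    simpa using hε0.const_add s
  have hexp : Tendsto (fun k => β * Real.exp (lam * (s + ε k))) atTop
      (𝓝 (β * Real.exp (lam * s))) :=
    ((Real.continuous_exp.tendsto _).comp (hl.const_mul lam)).const_mul β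
  refine le_of_tendsto_of_tendsto ((h1.norm.pow 2).const_mul ρ) ((hexp.pow 2).div_const _) ?_
  filter_upwards [hl.eventually_lt_const hs, hε0.eventually_lt_const hs0] with k hk hk0
  have he' := h.tconv_energy_le hρ hμ hβ hlam hF (hε k).1 (hη k) hk
  have : 0 ≤ μ * ‖tconv (η k) Y s‖ ^ 2 := by positivity
  have hc := hasCompactSupport_of_abs (hη k).eq_zero
  -- The derivative moves from the mollifier to the curve only for tests supported in positive
  -- times, which holds once `ε k < s`.
  have e : tconv (deriv (η k)) X s = tconv (η k) V s := by
    have h3 : tsupport (fun t => η k (s - t)) ⊆ Ioi 0 := by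
      refine (closure_minimal (fun t ht => ?_) isClosed_Ici : _ ⊆ Ici (s - ε k)).trans
        fun t ht => (sub_pos.2 hk0).trans_le ht
      by_contra hcon
      rw [mem_Ici, not_le] at hcon
      exact ht ((hη k).eq_zero _ (lt_abs.2 (Or.inl (by linarith))))
    have := hXV (fun t => η k (s - t)) ((hη k).contDiff.comp (by fun_prop))
      (hc.comp_homeomorph (Homeomorph.subLeft s)) h3
    have d : deriv (fun t => η k (s - t)) = fun t => - deriv (η k) (s - t) := by
      ext t
      rw [deriv_comp_const_sub]
    simp only [d, neg_smul, integral_neg, neg_inj] at this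
    rw [tconv_apply, tconv_apply, this]
  rw [← e]
  linarith

end IsBeamCurve

/-! ### Estimates in weak norms for the equation without force -/

namespace IsBeamCurve

variable {L ρ μ τ : ℝ} {u₀ u₁ : L2 L} {X Y F : ℝ → L2 L}

/-- The mollified equation, integrated once in time. -/
lemma integrated_tconv_eqn (h : IsBeamCurve L ρ μ τ u₀ u₁ X Y F) (hF : ∀ᵐ t, F t = 0) {ε : ℝ}
    (hε : ε < 1) {η : ℝ → ℝ} (hη : IsMollifier ε η) {s : ℝ} (hs1 : -1 ≤ s) (hs : s + ε < τ)
    {f g : L2 L} (hfg : IsWeakD2 L f g) :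
    ρ * inner ℝ (tconv (deriv η) X s) f + μ * inner ℝ (∫ r in (-1)..s, tconv η Y r) g
      = ρ * (∫ r in (-1)..s, η r) * inner ℝ u₁ f + ρ * η s * inner ℝ u₀ f := by
  have hc := hasCompactSupport_of_abs hη.eq_zero
  have hz1 : ∀ x, ε < |x| → deriv η x = 0 := fun x => deriv_eq_zero_of_abs hη.eq_zero
  have c1 := contDiff_deriv hη.contDiff
  have hF0 : ∀ r, tconv η F r = 0 := by
    intro r
    rw [tconv_apply]
    refine integral_eq_zero_of_ae ?_
    filter_upwards [hF] with t ht
    simp [ht]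
  have dI : ∀ r, HasDerivAt (fun s => ∫ r in (-1)..s, tconv η Y r) (tconv η Y r) r := fun r =>
    ((continuous_tconv hη.contDiff hc h.locY).integral_hasStrictDerivAt (-1) r).hasDerivAt
  have dH : ∀ r, HasDerivAt (fun s => ∫ r in (-1)..s, η r) (η r) r := fun r =>
    (hη.contDiff.continuous.integral_hasStrictDerivAt (-1) r).hasDerivAt
  have dη : ∀ r, HasDerivAt η (deriv η r) r := fun r =>
    (hη.contDiff.differentiable (by simp) r).hasDerivAt
  have hin : ∀ {Z : ℝ → L2 L} {Z' : L2 L} {r : ℝ} (q : L2 L), HasDerivAt Z Z' r →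
      HasDerivAt (fun r => inner ℝ (Z r) q) (inner ℝ Z' q) r := by
    intro Z Z' r q hZ
    have := hZ.inner ℝ (hasDerivAt_const r q)
    simpa using this
  set Ψ : ℝ → ℝ := fun s => ρ * inner ℝ (tconv (deriv η) X s) f
    + μ * inner ℝ (∫ r in (-1)..s, tconv η Y r) g
    - ρ * (∫ r in (-1)..s, η r) * inner ℝ u₁ f - ρ * η s * inner ℝ u₀ f with hΨ
  -- The derivative of `Ψ` is the defect in the mollified equation, and `Ψ` vanishes at `-1`, before
  -- the mollified curve and the mollifier are switched on.
  have dΨ : ∀ r, r + ε < τ → HasDerivAt Ψ 0 r := by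
    intro r hr
    have e := h.tconv_eqn hη.contDiff hη.eq_zero hr hfg
    rw [hF0, inner_zero_left, add_zero] at e
    have h1 := (hin f (hasDerivAt_tconv c1 hc.deriv h.locX r)).const_mul ρ
    have h2 := (hin g (dI r)).const_mul μ
    have h3 := ((dH r).const_mul ρ).mul_const (inner ℝ u₁ f)
    have h4 := ((dη r).const_mul ρ).mul_const (inner ℝ u₀ f)
    refine (((h1.add h2).sub h3).sub h4).congr_deriv ?_
    linarith
  have hconst := constant_of_has_deriv_right_zero (f := Ψ) (a := -1) (b := s)
    (fun r hr => (dΨ r (by linarith [hr.2])).continuousAt.continuousWithinAt)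
    (fun r hr => (dΨ r (by linarith [hr.2])).hasDerivWithinAt) s ⟨hs1, le_rfl⟩
  have h0 : Ψ (-1) = 0 := by
    have e1 : tconv (deriv η) X (-1) = 0 := tconv_eq_zero hz1 h.zeroX (by linarith)
    have e2 : η (-1) = 0 := hη.eq_zero _ (by simpa using hε)
    simp [hΨ, e1, e2]
  rw [h0] at hconst
  simp only [hΨ] at hconst
  linarith

/-- An energy estimate in weaker norms for the linear equation. -/
lemma tconv_lower_energy_le (hρ : 0 < ρ) (h : IsBeamCurve L ρ μ τ u₀ u₁ X Y F)
    (hF : ∀ᵐ t, F t = 0) {ε : ℝ} (hε : ε < 1) {η : ℝ → ℝ} (hη : IsMollifier ε η) {T R κ : ℝ}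
    (hT : T + ε < τ) (hR : ∀ r ∈ Icc (-1) T, ‖tconv η X r‖ ≤ R)
    (hκ : ∀ r ∈ Icc (-1) T, |inner ℝ u₁ (∫ x in (-1)..r, tconv η X x)| ≤ κ) {s : ℝ}
    (hs : s ∈ Icc (-1) T) :
    ρ * ‖tconv η X s‖ ^ 2 + μ * ‖∫ r in (-1)..s, tconv η Y r‖ ^ 2
      ≤ 2 * ρ * (‖u₀‖ * R + 2 * κ) := by
  have hc := hasCompactSupport_of_abs hη.eq_zero
  have cX := continuous_tconv hη.contDiff hc h.locX
  have cY := continuous_tconv hη.contDiff hc h.locY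
  set a := tconv η X with ha
  set d : ℝ → L2 L := fun s => ∫ r in (-1)..s, a r with hd
  set e : ℝ → L2 L := fun s => ∫ r in (-1)..s, tconv η Y r with he
  set H : ℝ → ℝ := fun s => ∫ r in (-1)..s, η r with hH
  have da : ∀ r, HasDerivAt a (tconv (deriv η) X r) r := hasDerivAt_tconv hη.contDiff hc h.locX
  have dd : ∀ r, HasDerivAt d (a r) r := fun r => (cX.integral_hasStrictDerivAt (-1) r).hasDerivAt
  have de : ∀ r, HasDerivAt e (tconv η Y r) r := fun r =>
    (cY.integral_hasStrictDerivAt (-1) r).hasDerivAt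
  have dH : ∀ r, HasDerivAt H (η r) r := fun r =>
    (hη.contDiff.continuous.integral_hasStrictDerivAt (-1) r).hasDerivAt
  set c := ‖u₀‖ * R + κ with hcdef
  -- The once integrated equation is tested with the curve `a` itself, and `H ⟨u₁, a⟩` is integrated
  -- by parts in time. Thus `u₁` meets only the primitive `d` of `a`, and the remaining sources
  -- carry the factor `η`, of total mass one; subtracting `2 ρ c H` makes `Q` nonincreasing.
  set Q : ℝ → ℝ := fun r => ρ * ‖a r‖ ^ 2 + μ * ‖e r‖ ^ 2 - 2 * ρ * (H r * inner ℝ u₁ (d r))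
    - 2 * ρ * c * H r with hQ
  have dQ : ∀ r ∈ Icc (-1) T, HasDerivAt Q
      (2 * ρ * η r * (inner ℝ u₀ (a r) - inner ℝ u₁ (d r) - c)) r := by
    intro r hr
    have eq := h.integrated_tconv_eqn hF hε hη hr.1 (s := r) (by linarith [hr.2])
      (isWeakD2_tconv hη.contDiff.continuous hc h.locX h.locY h.weak r)
    have h1 := (da r).norm_sq.const_mul ρ
    have h2 := (de r).norm_sq.const_mul μ
    have h3' : HasDerivAt (fun r => inner ℝ u₁ (d r)) (inner ℝ u₁ (a r)) r := by
      have := (hasDerivAt_const r u₁).inner ℝ (dd r)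
      simpa using this
    have h3 := ((dH r).mul h3').const_mul (2 * ρ)
    have h4 := (dH r).const_mul (2 * ρ * c)
    refine (((h1.add h2).sub h3).sub h4).congr_deriv ?_
    rw [real_inner_comm (tconv (deriv η) X r) (a r)]
    simp only [hH, he, ha] at eq ⊢
    linarith
  have hanti : AntitoneOn Q (Icc (-1) T) := by
    refine antitoneOn_of_deriv_nonpos (convex_Icc _ _)
      (fun r hr => (dQ r hr).continuousAt.continuousWithinAt)
      (fun r hr => (dQ r (interior_subset hr)).differentiableAt.differentiableWithinAt)
      (fun r hr => ?_)
    have hr' := interior_subset hr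
    rw [(dQ r hr').deriv]
    have i1 := (abs_le.1 (hκ r hr')).1
    have i2 : inner ℝ u₀ (a r) ≤ ‖u₀‖ * R :=
      (real_inner_le_norm _ _).trans (mul_le_mul_of_nonneg_left (hR r hr') (norm_nonneg _))
    have i3 : inner ℝ u₀ (a r) - inner ℝ u₁ (d r) - c ≤ 0 := by
      simp only [hd, hcdef]; linarith
    have i4 := hη.nonneg r
    exact mul_nonpos_of_nonneg_of_nonpos (by positivity) i3
  have hQ1 : Q (-1) = 0 := by
    have e1 : a (-1) = 0 := tconv_eq_zero hη.eq_zero h.zeroX (by linarith)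
    simp [hQ, e1, he, hH]
  have hQs := hanti ⟨le_rfl, hs.1.trans hs.2⟩ hs hs.1
  rw [hQ1] at hQs
  have hH0 : 0 ≤ H s := intervalIntegral.integral_nonneg_of_forall hs.1 hη.nonneg
  have hH1 : H s ≤ 1 := by
    rw [← hη.integral]
    simp only [hH]
    rw [intervalIntegral.integral_of_le hs.1]
    exact setIntegral_le_integral (hη.contDiff.continuous.integrable_of_hasCompactSupport hc)
      (ae_of_all _ hη.nonneg)
  have hκs := hκ s hs
  have hκ0 : 0 ≤ κ := (abs_nonneg _).trans hκs
  have hR0 : 0 ≤ R := (norm_nonneg _).trans (hR s hs)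
  have hc0 : 0 ≤ c := by positivity
  have j1 : H s * inner ℝ u₁ (d s) ≤ κ :=
    (mul_le_mul_of_nonneg_left ((le_abs_self _).trans hκs) hH0).trans
      (by nlinarith)
  have j2 : c * H s ≤ c := by nlinarith
  have j3 : 2 * ρ * (H s * inner ℝ u₁ (d s)) ≤ 2 * ρ * κ := by gcongr
  have j4 : 2 * ρ * (c * H s) ≤ 2 * ρ * c := by gcongr
  simp only [hQ] at hQs
  have j5 : 2 * ρ * (‖u₀‖ * R + 2 * κ) = 2 * ρ * κ + 2 * ρ * c := by rw [hcdef]; ring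
  rw [j5]
  linarith

/-- Smallness in `L²` of the solutions of the linear equation whose data are small in a weak
sense. -/
lemma linear_norm_sq_le (hρ : 0 < ρ) (hμ : 0 < μ) (h : IsBeamCurve L ρ μ τ u₀ u₁ X Y F)
    (hF : ∀ᵐ t, F t = 0) {T κ R : ℝ} (hT : 0 ≤ T) (hTτ : T + 1 ≤ τ) (hκ0 : 0 ≤ κ)
    (hκ : ∀ f g : L2 L, IsWeakD2 L f g → |inner ℝ u₁ f| ≤ κ * (‖f‖ + ‖g‖))
    (hRdef : R = 2 * ‖u₀‖ + 4 * (T + 1) * ‖u₁‖) :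
    ∀ᵐ s, 0 < s → s < T →
      ‖X s‖ ^ 2 ≤ 2 * (‖u₀‖ * R + 2 * (κ * ((T + 1) + √(ρ / μ)) * R)) := by
  obtain ⟨ε, η, hε, hε0, hη, hlim⟩ := exists_mollifiers
  filter_upwards [hlim h.locX] with s hlims hs0 hsT
  refine le_of_tendsto (hlims.norm.pow 2) (Eventually.of_forall fun k => ?_)
  have hc := hasCompactSupport_of_abs (hη k).eq_zero
  have cX := continuous_tconv (hη k).contDiff hc h.locX
  have cY := continuous_tconv (hη k).contDiff hc h.locY
  have hTk : T + ε k < τ := by linarith [(hε k).2]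
  have hT1 : -1 ≤ T := by linarith
  -- The estimate is applied twice. With Cauchy–Schwarz for `u₁` it bounds the maximum `R'` by `R`,
  -- a priori; with this bound in hand, the weak smallness of `u₁` gives the sharp version.
  obtain ⟨m, hm, hmax⟩ := isCompact_Icc.exists_isMaxOn (nonempty_Icc.2 hT1) cX.norm.continuousOn
  set R' := ‖tconv (η k) X m‖ with hR'
  have hmax' : ∀ r ∈ Icc (-1) T, ‖tconv (η k) X r‖ ≤ R' := fun r hr => hmax hr
  have hR'0 : 0 ≤ R' := norm_nonneg _
  have hd : ∀ r ∈ Icc (-1) T, ‖∫ x in (-1)..r, tconv (η k) X x‖ ≤ (T + 1) * R' := by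
    intro r hr
    have := intervalIntegral.norm_integral_le_of_norm_le_const (a := -1) (b := r) (C := R')
      (f := tconv (η k) X) fun x hx => by
        rw [uIoc_of_le hr.1] at hx
        exact hmax' x ⟨hx.1.le, hx.2.trans hr.2⟩
    refine this.trans ?_
    rw [abs_of_nonneg (by linarith [hr.1]), mul_comm]
    have := hr.2
    gcongr
    linarith
  -- At a maximum point this reads `R'² ≤ R R'`, which explains the coefficients in the definition
  -- of `R`.
  have crude : ∀ s ∈ Icc (-1) T, ρ * ‖tconv (η k) X s‖ ^ 2
      + μ * ‖∫ r in (-1)..s, tconv (η k) Y r‖ ^ 2 ≤ ρ * (R * R') := by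
    intro s hs
    refine (h.tconv_lower_energy_le hρ hF (hε k).2 (hη k) hTk hmax'
      (κ := ‖u₁‖ * ((T + 1) * R')) (fun r hr => ?_) hs).trans (le_of_eq ?_)
    · refine (abs_real_inner_le_norm _ _).trans ?_
      have := hd r hr
      gcongr
    · rw [hRdef]; ring
  have hR'R : R' ≤ R := by
    have h1 := crude m hm
    have h2 : 0 ≤ μ * ‖∫ r in (-1)..m, tconv (η k) Y r‖ ^ 2 := by positivity
    have h3 : ρ * R' ^ 2 ≤ ρ * (R * R') := by linarith
    have h4 : R' ^ 2 ≤ R * R' := le_of_mul_le_mul_left h3 hρ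
    have hR0 : 0 ≤ R := by rw [hRdef]; positivity
    rcases hR'0.eq_or_lt with h5 | h5
    · rw [← h5]; exact hR0
    · nlinarith
  have hR0 : 0 ≤ R := hR'0.trans hR'R
  -- The primitive of the curve is therefore bounded in `H²`, as needed to apply `hκ`.
  have hdY : ∀ r ∈ Icc (-1) T, ‖∫ x in (-1)..r, tconv (η k) Y x‖ ≤ √(ρ / μ) * R := by
    intro r hr
    have h1 := crude r hr
    have h2 : 0 ≤ ρ * ‖tconv (η k) X r‖ ^ 2 := by positivity
    refine abs_le_of_sq_le_sq' ?_ (by positivity) |>.2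
    rw [mul_pow, Real.sq_sqrt (by positivity)]
    have h3 : μ * ‖∫ x in (-1)..r, tconv (η k) Y x‖ ^ 2 ≤ ρ * (R * R) := by
      have : ρ * (R * R') ≤ ρ * (R * R) := by gcongr
      linarith
    rw [div_mul_eq_mul_div, le_div_iff₀ hμ]
    linarith
  have fine := h.tconv_lower_energy_le hρ hF (hε k).2 (hη k) hTk
    (fun r hr => (hmax' r hr).trans hR'R) (κ := κ * ((T + 1) + √(ρ / μ)) * R) (fun r hr => ?_)
    (s := s) ⟨by linarith, hsT.le⟩
  · have h2 : 0 ≤ μ * ‖∫ r in (-1)..s, tconv (η k) Y r‖ ^ 2 := by positivity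
    refine le_of_mul_le_mul_left ?_ hρ
    linarith
  · have hD2 : IsWeakD2 L (∫ x in (-1)..r, tconv (η k) X x) (∫ x in (-1)..r, tconv (η k) Y x) := by
      rw [intervalIntegral.integral_of_le hr.1, intervalIntegral.integral_of_le hr.1]
      exact isWeakD2_integral (cX.integrableOn_Ioc) (cY.integrableOn_Ioc) fun φ hφ =>
        ae_of_all _ fun t => isWeakD2_tconv (hη k).contDiff.continuous hc h.locX h.locY h.weak t φ hφ
    refine (hκ _ _ hD2).trans ?_
    have h1 := hd r hr
    have h2 := hdY r hr
    have h3 : (T + 1) * R' ≤ (T + 1) * R := by gcongr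
    calc _ ≤ κ * ((T + 1) * R + √(ρ / μ) * R) := by gcongr; linarith
      _ = _ := by ring

end IsBeamCurve

/-! ### Measurability of curves in a separable Hilbert space -/

/-- Orthonormal vectors have distance `√2`, so balls of radius `1/2` around them form a disjoint
open family. -/
lemma Orthonormal.countable_of_separable {E ι : Type*} [NormedAddCommGroup E]
    [InnerProductSpace ℝ E] [TopologicalSpace.SeparableSpace E] {b : ι → E} (hb : Orthonormal ℝ b) :
    Countable ι := by
  have hd : Set.PairwiseDisjoint (univ : Set ι) fun i => Metric.ball (b i) (1 / 2) := by
    intro i _ j _ hij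
    refine Metric.ball_disjoint_ball ?_
    rw [dist_eq_norm]
    have h1 : ‖b i - b j‖ ^ 2 = 2 := by
      rw [norm_sub_sq_real, hb.1 i, hb.1 j, hb.2 hij]
      norm_num
    nlinarith [norm_nonneg (b i - b j)]
  have := hd.countable_of_isOpen (fun i _ => Metric.isOpen_ball)
    fun i _ => ⟨b i, Metric.mem_ball_self (by norm_num)⟩
  exact countable_univ_iff.1 this

/-- A weakly measurable function with values in a separable Hilbert space is strongly
measurable. -/
lemma aestronglyMeasurable_of_inner {α E : Type*} [MeasurableSpace α] {m : Measure α}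
    [NormedAddCommGroup E] [InnerProductSpace ℝ E] [CompleteSpace E]
    [TopologicalSpace.SeparableSpace E] {f : α → E}
    (h : ∀ c : E, AEStronglyMeasurable (fun t => inner ℝ (f t) c) m) :
    AEStronglyMeasurable f m := by
  obtain ⟨w, b, -⟩ := exists_hilbertBasis ℝ E
  have hcount : Countable w := Orthonormal.countable_of_separable b.orthonormal
  refine aestronglyMeasurable_of_tendsto_ae (u := (atTop : Filter (Finset w)))
    (f := fun s t => ∑ i ∈ s, inner ℝ (f t) (b i) • b i) (fun s => ?_)
    (ae_of_all _ fun t => ?_)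
  · exact Finset.aestronglyMeasurable_fun_sum _ fun i _ => (h (b i)).smul_const _
  · have e : ∀ i, inner ℝ (f t) (b i) = b.repr (f t) i := fun i => by
      rw [b.repr_apply_apply, real_inner_comm]
    simp only [e]
    exact b.hasSum_repr (f t)

/-! ### Space-time functions as curves in `L²(0,L)` -/

/-- The curve in `L²(0,L)` given by a function of `(t,x)`, extended by zero to negative times. -/
def curve (L : ℝ) (f : ℝ → ℝ → ℝ) (t : ℝ) : L2 L :=
  open Classical in if 0 < t then ofFun L (f t) else 0

lemma curve_of_pos {L : ℝ} (f : ℝ → ℝ → ℝ) {t : ℝ} (ht : 0 < t) : curve L f t = ofFun L (f t) :=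
  if_pos ht

lemma curve_of_nonpos {L : ℝ} (f : ℝ → ℝ → ℝ) {t : ℝ} (ht : t ≤ 0) : curve L f t = 0 :=
  if_neg (not_lt.2 ht)

lemma restrict_strip (L : ℝ) : (volume : Measure (ℝ × ℝ)).restrict (strip L)
    = (volume.restrict (Ioi (0 : ℝ))).prod (volume.restrict (Ioo (0 : ℝ) L)) := by
  rw [Measure.prod_restrict]
  rfl

/-- `f` is measurable, and defines a locally bounded curve in `L²(0,L)`. -/
structure IsLocBdd (L : ℝ) (f : ℝ → ℝ → ℝ) : Prop where
  aesm : AEStronglyMeasurable (Function.uncurry f) (volume.restrict (strip L))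
  memLp : ∀ᵐ t ∂(volume.restrict (Ioi (0 : ℝ))), MemLp (f t) 2 (volume.restrict (Ioo (0 : ℝ) L))
  bound : ∀ T : ℝ, ∃ C : ℝ, ∀ᵐ t ∂(volume.restrict (Ioi (0 : ℝ))), t < T → ‖ofFun L (f t)‖ ≤ C

namespace IsLocBdd

variable {L : ℝ} {f : ℝ → ℝ → ℝ}

/-- Weak measurability suffices in the separable space `L²(0,L)`, and each pairing is a partial
integral of a jointly measurable function. -/
lemma aestronglyMeasurable_curve (h : IsLocBdd L f) : AEStronglyMeasurable (curve L f) := by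
  have e : curve L f = (Ioi (0 : ℝ)).indicator fun t => ofFun L (f t) := by
    ext1 t
    by_cases ht : 0 < t
    · rw [curve_of_pos f ht, indicator_of_mem (mem_Ioi.2 ht)]
    · rw [curve_of_nonpos f (not_lt.1 ht), indicator_of_notMem (by simpa using ht)]
  rw [e, aestronglyMeasurable_indicator_iff measurableSet_Ioi]
  have : Fact ((2 : ℝ≥0∞) ≠ ⊤) := ⟨by norm_num⟩
  refine aestronglyMeasurable_of_inner fun c => ?_
  have h1 := h.aesm
  rw [restrict_strip] at h1
  have hc : AEStronglyMeasurable (fun p : ℝ × ℝ => c p.2)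
      ((volume.restrict (Ioi (0 : ℝ))).prod (volume.restrict (Ioo (0 : ℝ) L))) :=
    (Lp.aestronglyMeasurable c).comp_snd
  have h2 := (h1.mul hc).integral_prod_right'
  refine h2.congr ?_
  filter_upwards [h.memLp] with t ht
  rw [real_inner_comm, inner_ofFun _ ht]
  simp [Function.uncurry, mul_comm]

lemma locallyIntegrable_curve (h : IsLocBdd L f) : LocallyIntegrable (curve L f) := by
  rw [locallyIntegrable_iff]
  intro K hK
  obtain ⟨T, hT⟩ := hK.bddAbove
  obtain ⟨C, hC⟩ := h.bound (T + 1)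
  refine Measure.integrableOn_of_bounded (M := max C 0) hK.measure_lt_top.ne
    h.aestronglyMeasurable_curve ?_
  refine (ae_restrict_iff' hK.measurableSet).2 ?_
  filter_upwards [(ae_restrict_iff' measurableSet_Ioi).1 hC] with t ht htK
  rcases le_or_gt t 0 with h0 | h0
  · rw [curve_of_nonpos f h0, norm_zero]
    exact le_max_right _ _
  · rw [curve_of_pos f h0]
    exact (ht h0 (by linarith [hT htK])).trans (le_max_left _ _)

/-- By Tonelli: Cauchy–Schwarz in `x` bounds each slice by `‖θ t • curve L f t‖ ‖ψ‖`, which is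
integrable in time. -/
lemma integrable_mul (h : IsLocBdd L f) {θ ψ : ℝ → ℝ} (hθ : Continuous θ)
    (hc : HasCompactSupport θ) (hψ : Continuous ψ) :
    Integrable (fun p : ℝ × ℝ => f p.1 p.2 * (θ p.1 * ψ p.2)) (volume.restrict (strip L)) := by
  have h1 := h.aesm
  rw [restrict_strip] at h1 ⊢
  have h2 : AEStronglyMeasurable (fun p : ℝ × ℝ => f p.1 p.2 * (θ p.1 * ψ p.2))
      ((volume.restrict (Ioi (0 : ℝ))).prod (volume.restrict (Ioo (0 : ℝ) L))) :=
    h1.mul (Continuous.aestronglyMeasurable (by fun_prop))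
  have hψm : MemLp ψ 2 (volume.restrict (Ioo (0 : ℝ) L)) := memLp_of_continuous hψ
  refine (integrable_prod_iff h2).2 ⟨?_, ?_⟩
  · filter_upwards [h.memLp] with t ht
    exact ht.integrable_mul (hψm.const_mul _)
  · have hi := (h.locallyIntegrable_curve.integrable_smul_left_of_hasCompactSupport hθ hc).norm
    have hi' := (hi.mul_const ‖ofFun L ψ‖).restrict (s := Ioi 0)
    refine hi'.mono' h2.norm.integral_prod_right' ?_
    filter_upwards [h.memLp, ae_restrict_mem measurableSet_Ioi] with t ht ht0
    rw [Real.norm_eq_abs, abs_of_nonneg (integral_nonneg fun x => norm_nonneg _),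
      curve_of_pos f ht0, norm_smul]
    have e : ∀ x, ‖f t x * (θ t * ψ x)‖ = ‖θ t‖ * (|f t x| * |ψ x|) := by
      intro x
      rw [norm_mul, norm_mul, Real.norm_eq_abs (f t x), Real.norm_eq_abs (ψ x)]
      ring
    simp only [e]
    rw [integral_const_mul, mul_assoc]
    gcongr
    have habs : ∀ {a : ℝ → ℝ}, MemLp a 2 (volume.restrict (Ioo (0 : ℝ) L)) →
        ‖ofFun L fun x => |a x|‖ = ‖ofFun L a‖ := by
      intro a ha
      have ha' : MemLp (fun x => |a x|) 2 (volume.restrict (Ioo (0 : ℝ) L)) := ha.norm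
      rw [← abs_of_nonneg (norm_nonneg (ofFun L a)),
        ← abs_of_nonneg (norm_nonneg (ofFun L fun x => |a x|)), ← sq_eq_sq_iff_abs_eq_abs,
        norm_sq_eq_integral, norm_sq_eq_integral]
      refine integral_congr_ae ?_
      filter_upwards [coeFn_ofFun ha, coeFn_ofFun ha'] with x h1 h2
      rw [h1, h2, sq_abs]
    rw [← habs ht, ← habs hψm]
    refine le_trans (le_of_eq ?_) (real_inner_le_norm _ _)
    have hψm' : MemLp (fun x => |ψ x|) 2 (volume.restrict (Ioo (0 : ℝ) L)) := hψm.norm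
    have ht' : MemLp (fun x => |f t x|) 2 (volume.restrict (Ioo (0 : ℝ) L)) := ht.norm
    rw [inner_ofFun _ hψm']
    refine integral_congr_ae ?_
    filter_upwards [coeFn_ofFun ht'] with x h1
    rw [h1]

/-- Fubini's theorem for products of functions of `t` and of `x`. -/
lemma integral_mul (h : IsLocBdd L f) {θ ψ : ℝ → ℝ} (hθ : Continuous θ)
    (hc : HasCompactSupport θ) (hψ : Continuous ψ) :
    ∫ p in strip L, f p.1 p.2 * (θ p.1 * ψ p.2)
      = inner ℝ (∫ t, θ t • curve L f t) (ofFun L ψ) := by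
  have h1 := h.integrable_mul hθ hc hψ
  have hψm : MemLp ψ 2 (volume.restrict (Ioo (0 : ℝ) L)) := memLp_of_continuous hψ
  rw [inner_integral_left
    (h.locallyIntegrable_curve.integrable_smul_left_of_hasCompactSupport hθ hc)]
  rw [restrict_strip] at h1 ⊢
  rw [integral_prod _ h1, ← setIntegral_eq_integral_of_forall_compl_eq_zero (s := Ioi (0 : ℝ))
    (f := fun t => inner ℝ (θ t • curve L f t) (ofFun L ψ))]
  · refine integral_congr_ae ?_
    filter_upwards [h.memLp, ae_restrict_mem measurableSet_Ioi] with t ht ht0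
    rw [curve_of_pos f ht0, real_inner_smul_left, inner_ofFun _ hψm, ← integral_const_mul]
    refine integral_congr_ae ?_
    filter_upwards [coeFn_ofFun ht] with x hx
    rw [hx]
    ring
  · intro t ht
    rw [curve_of_nonpos f (by simpa using ht), smul_zero, inner_zero_left]

end IsLocBdd

lemma isLocBdd_of_bound {L : ℝ} {f : ℝ → ℝ → ℝ}
    (h : AEStronglyMeasurable (Function.uncurry f) (volume.restrict (strip L)))
    (hb : ∀ T : ℝ, ∃ C : ℝ, ∀ t ∈ Ioo 0 T, ∀ x ∈ Ioo 0 L, |f t x| ≤ C) : IsLocBdd L f := by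
  refine ⟨h, ?_, fun T => ?_⟩
  · have h1 := h
    rw [restrict_strip] at h1
    filter_upwards [h1.prodMk_left, ae_restrict_mem measurableSet_Ioi] with t ht ht0
    obtain ⟨C, hC⟩ := hb (t + 1)
    exact memLp_of_bound ht (hC t ⟨ht0, by linarith⟩)
  · obtain ⟨C, hC⟩ := hb T
    refine ⟨√L * max C 0, ?_⟩
    filter_upwards [ae_restrict_mem measurableSet_Ioi] with t ht0 htT
    exact norm_ofFun_le (le_max_right _ _) fun x hx =>
      (hC t ⟨ht0, htT⟩ x hx).trans (le_max_left _ _)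

lemma isLocBdd_of_continuousOn {L : ℝ} {u : ℝ → ℝ → ℝ}
    (h : ContinuousOn (Function.uncurry u) (Ici 0 ×ˢ Icc 0 L)) : IsLocBdd L u := by
  refine isLocBdd_of_bound ?_ fun T => ?_
  · exact (h.mono (prod_mono Ioi_subset_Ici_self Ioo_subset_Icc_self)).aestronglyMeasurable
      (measurableSet_Ioi.prod measurableSet_Ioo)
  · obtain ⟨C, hC⟩ := (isCompact_Icc (a := 0) (b := T)).prod (isCompact_Icc (a := 0) (b := L))
      |>.exists_bound_of_continuousOn (h.mono (prod_mono Icc_subset_Ici_self le_rfl))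
    exact ⟨C, fun t ht x hx => hC (t, x) ⟨Ioo_subset_Icc_self ht, Ioo_subset_Icc_self hx⟩⟩

lemma norm_ofFun {L : ℝ} {φ : ℝ → ℝ} (h : MemLp φ 2 (volume.restrict (Ioo (0 : ℝ) L))) :
    ‖ofFun L φ‖ = (eLpNorm φ 2 (volume.restrict (Ioo (0 : ℝ) L))).toReal := by
  rw [ofFun, dif_pos h, Lp.norm_toLp]

lemma isLocBdd_of_memLinfL2 {L : ℝ} {g : ℝ → ℝ → ℝ} (h : MemLinfL2 L g) : IsLocBdd L g := by
  have h1 := h.1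
  rw [restrict_strip] at h1
  have h2 : ∀ᵐ t ∂(volume.restrict (Ioi (0 : ℝ))),
      eLpNorm (g t) 2 (volume.restrict (Ioo 0 L)) ≤ normLinfL2 (Ioi 0) L g := ae_le_essSup
  refine ⟨h.1, ?_, fun T => ⟨(normLinfL2 (Ioi 0) L g).toReal, ?_⟩⟩
  · filter_upwards [h1.prodMk_left, h2] with t ht ht2
    exact ⟨ht, ht2.trans_lt h.2⟩
  · filter_upwards [h1.prodMk_left, h2] with t ht ht2 _
    have hm : MemLp (g t) 2 (volume.restrict (Ioo (0 : ℝ) L)) := ⟨ht, ht2.trans_lt h.2⟩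
    rw [norm_ofFun hm]
    exact ENNReal.toReal_mono h.2.ne ht2

/-! ### Product test functions -/

lemma contDiff_tensor {θ ψ : ℝ → ℝ} (hθ : ContDiff ℝ ∞ θ) (hψ : ContDiff ℝ ∞ ψ) :
    ContDiff ℝ ∞ (Function.uncurry fun t x => θ t * ψ x) :=
  (hθ.comp contDiff_fst).mul (hψ.comp contDiff_snd)

lemma tsupport_tensor_subset (θ ψ : ℝ → ℝ) :
    tsupport (Function.uncurry fun t x => θ t * ψ x) ⊆ tsupport θ ×ˢ tsupport ψ := by
  refine closure_minimal ?_ ((isClosed_tsupport _).prod (isClosed_tsupport _))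
  rintro ⟨t, x⟩ h
  have h' : θ t * ψ x ≠ 0 := h
  exact ⟨subset_tsupport _ (left_ne_zero_of_mul h'), subset_tsupport _ (right_ne_zero_of_mul h')⟩

lemma hasCompactSupport_tensor {θ ψ : ℝ → ℝ} (hθ : HasCompactSupport θ)
    (hψ : HasCompactSupport ψ) : HasCompactSupport (Function.uncurry fun t x => θ t * ψ x) :=
  (hθ.isCompact.prod hψ.isCompact).of_isClosed_subset (isClosed_tsupport _)
    (tsupport_tensor_subset θ ψ)

lemma isInteriorTest_tensor {L : ℝ} {θ φ : ℝ → ℝ} (h1 : ContDiff ℝ ∞ θ)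
    (h2 : HasCompactSupport θ) (h3 : tsupport θ ⊆ Ioi 0) (hφ : IsTest L φ) :
    IsInteriorTest L fun t x => θ t * φ x :=
  ⟨contDiff_tensor h1 hφ.contDiff, hasCompactSupport_tensor h2 hφ.compact,
    (tsupport_tensor_subset θ φ).trans (prod_mono h3 hφ.subset)⟩

lemma iteratedDeriv_two_mul_const (θ : ℝ → ℝ) (c t : ℝ) :
    iteratedDeriv 2 (fun t => θ t * c) t = deriv (deriv θ) t * c := by
  rw [iteratedDeriv_succ, iteratedDeriv_one]
  have : deriv (fun t => θ t * c) = fun t => deriv θ t * c := by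
    ext s
    rw [deriv_mul_const_field]
  rw [this, deriv_mul_const_field]

lemma iteratedDeriv_two_const_mul (c : ℝ) (ψ : ℝ → ℝ) (x : ℝ) :
    iteratedDeriv 2 (fun x => c * ψ x) x = c * deriv (deriv ψ) x := by
  simp only [mul_comm c]
  exact iteratedDeriv_two_mul_const ψ c x

/-! ### From distributional derivatives to curves -/

/-- Product test functions separate the variables. For fixed `φ` the difference of the two sides is
a locally integrable function of time that vanishes as a distribution on `(0,∞)`. -/
lemma IsWeakDxx.ae_inner_eq {L : ℝ} {u g : ℝ → ℝ → ℝ} (h : IsWeakDxx L u g) (hu : IsLocBdd L u)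
    (hg : IsLocBdd L g) {φ : ℝ → ℝ} (hφ : IsTest L φ) :
    ∀ᵐ t, inner ℝ (curve L u t) (ofFun L (deriv (deriv φ)))
      = inner ℝ (curve L g t) (ofFun L φ) := by
  have lin : ∀ {X : ℝ → L2 L} (q : L2 L), LocallyIntegrable X →
      LocallyIntegrable fun t => inner ℝ (X t) q := by
    intro X q hX
    have := (innerSL ℝ q).locallyIntegrableOn_comp (hX.locallyIntegrableOn univ)
    rw [locallyIntegrableOn_univ] at this
    refine this.congr (ae_of_all _ fun t => ?_)
    simp [real_inner_comm]
  set D : ℝ → ℝ := fun t => inner ℝ (curve L u t) (ofFun L (deriv (deriv φ)))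
    - inner ℝ (curve L g t) (ofFun L φ) with hD
  have hDl : LocallyIntegrable D :=
    (lin _ hu.locallyIntegrable_curve).sub (lin _ hg.locallyIntegrable_curve)
  have := isOpen_Ioi.ae_eq_zero_of_integral_contDiff_smul_eq_zero (hDl.locallyIntegrableOn (Ioi 0))
    (fun θ h1 h2 h3 => by
      have e := h.2.2 _ (isInteriorTest_tensor h1 h2 h3 hφ)
      simp only [iteratedDeriv_two_const_mul] at e
      rw [hu.integral_mul h1.continuous h2 hφ.deriv.deriv.continuous,
        hg.integral_mul h1.continuous h2 hφ.continuous] at e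
      have iu := hu.locallyIntegrable_curve.integrable_smul_left_of_hasCompactSupport h1.continuous h2
      have ig := hg.locallyIntegrable_curve.integrable_smul_left_of_hasCompactSupport h1.continuous h2
      rw [inner_integral_left iu, inner_integral_left ig] at e
      have iu' : Integrable fun t => inner ℝ (θ t • curve L u t) (ofFun L (deriv (deriv φ))) :=
        iu.inner_const _
      have ig' : Integrable fun t => inner ℝ (θ t • curve L g t) (ofFun L φ) := ig.inner_const _
      have : ∀ t, θ t • D t = inner ℝ (θ t • curve L u t) (ofFun L (deriv (deriv φ)))
          - inner ℝ (θ t • curve L g t) (ofFun L φ) := by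
        intro t
        simp only [hD, real_inner_smul_left, smul_eq_mul]
        ring
      simp only [this]
      rw [integral_sub iu' ig', e, sub_self])
  filter_upwards [this] with t ht
  rcases le_or_gt t 0 with h0 | h0
  · rw [curve_of_nonpos _ h0, curve_of_nonpos _ h0, inner_zero_left, inner_zero_left]
  · exact sub_eq_zero.1 (ht h0)

lemma IsWeakDt.integral_eq {L : ℝ} {u g : ℝ → ℝ → ℝ} (h : IsWeakDt L u g) (hu : IsLocBdd L u)
    (hg : IsLocBdd L g) {θ : ℝ → ℝ} (h1 : ContDiff ℝ ∞ θ) (h2 : HasCompactSupport θ)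
    (h3 : tsupport θ ⊆ Ioi 0) : ∫ t, deriv θ t • curve L u t = - ∫ t, θ t • curve L g t := by
  refine eq_neg_of_add_eq_zero_left (eq_zero_of_inner_test _ fun φ hφ => ?_)
  have e := h.2.2 _ (isInteriorTest_tensor h1 h2 h3 hφ)
  simp only [deriv_mul_const_field] at e
  rw [hu.integral_mul (contDiff_deriv h1).continuous h2.deriv hφ.continuous,
    hg.integral_mul h1.continuous h2 hφ.continuous] at e
  rw [inner_add_left, e]
  ring

/-! ### Truncation in time -/

/-- The function `h`, truncated at time `τ`. -/
def trunc (τ : ℝ) (h : ℝ → ℝ → ℝ) (t x : ℝ) : ℝ :=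
  open Classical in if t < τ then h t x else 0

lemma aestronglyMeasurable_of_integrableOn {L : ℝ} {h : ℝ → ℝ → ℝ}
    (hi : ∀ T : ℝ, IntegrableOn (Function.uncurry h) (Ioo 0 T ×ˢ Ioo 0 L)) :
    AEStronglyMeasurable (Function.uncurry h) (volume.restrict (strip L)) := by
  have : strip L = ⋃ n : ℕ, Ioo (0 : ℝ) n ×ˢ Ioo 0 L := by
    ext ⟨t, x⟩
    simp only [strip, mem_prod, mem_iUnion, mem_Ioi, mem_Ioo]
    constructor
    · rintro ⟨h1, h2⟩
      obtain ⟨n, hn⟩ := exists_nat_gt t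
      exact ⟨n, ⟨h1, hn⟩, h2⟩
    · rintro ⟨n, h1, h2⟩
      exact ⟨h1.1, h2⟩
  rw [this, aestronglyMeasurable_iUnion_iff]
  exact fun n => (hi n).aestronglyMeasurable

/-- A priori the force is only integrable on bounded time intervals. Cutting it off where its bound
is no longer known gives a curve in `L²(0,L)`, and test functions supported before `τ` do not
notice. -/
lemma isLocBdd_trunc {L τ M : ℝ} {h : ℝ → ℝ → ℝ}
    (hi : ∀ T : ℝ, IntegrableOn (Function.uncurry h) (Ioo 0 T ×ˢ Ioo 0 L))
    (hb : ∀ t ∈ Ioo 0 τ, ∀ x ∈ Ioo 0 L, |h t x| ≤ M) : IsLocBdd L (trunc τ h) := by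
  refine isLocBdd_of_bound ?_ fun T => ⟨max M 0, fun t ht x hx => ?_⟩
  · have e : Function.uncurry (trunc τ h)
        = (Iio τ ×ˢ (univ : Set ℝ)).indicator (Function.uncurry h) := by
      ext ⟨t, x⟩
      by_cases ht : t < τ <;> simp [trunc, ht, indicator]
    rw [e]
    exact (aestronglyMeasurable_of_integrableOn hi).indicator
      (measurableSet_Iio.prod MeasurableSet.univ)
  · unfold trunc
    split_ifs with h0
    · exact (hb t ⟨ht.1, h0⟩ x hx).trans (le_max_left _ _)
    · rw [abs_zero]
      exact le_max_right _ _

/-- A weak solution whose force is bounded up to time `τ` solves the equation for curves up to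
time `τ`. -/
lemma isBeamCurve_of_weakFormulation {L ρ μ τ M : ℝ} (hL : 0 < L) {u₀ u₁ : L2 L}
    {u uxx h : ℝ → ℝ → ℝ} (hu : IsLocBdd L u) (hxx : IsLocBdd L uxx) (hD : IsWeakDxx L u uxx)
    (hi : ∀ T : ℝ, IntegrableOn (Function.uncurry h) (Ioo 0 T ×ˢ Ioo 0 L))
    (hb : ∀ t ∈ Ioo 0 τ, ∀ x ∈ Ioo 0 L, |h t x| ≤ M)
    (hw : WeakFormulation L ρ μ u₀ u₁ u uxx h) :
    IsBeamCurve L ρ μ τ u₀ u₁ (curve L u) (curve L uxx) (curve L (trunc τ h)) := by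
  have hF := isLocBdd_trunc hi hb
  refine ⟨hu.locallyIntegrable_curve, hxx.locallyIntegrable_curve, hF.locallyIntegrable_curve,
    fun t => curve_of_nonpos _, fun t => curve_of_nonpos _, fun φ hφ => hD.ae_inner_eq hu hxx hφ,
    fun θ h1 h2 h3 f g hfg => ?_⟩
  -- For fixed `θ`, the equation tested with `θ(t) ψ(x)` is linear in `ψ` and `ψ''`. The vectors
  -- `r₁`, `r₂` collect its coefficients, so it extends from smooth `ψ` to all of `H²`.
  have key := hfg.inner_add_inner_eq_zero hL
    (r₁ := ρ • (∫ t, deriv (deriv θ) t • curve L u t) + (∫ t, θ t • curve L (trunc τ h) t)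
      - (ρ * θ 0) • u₁ + (ρ * deriv θ 0) • u₀)
    (r₂ := μ • ∫ t, θ t • curve L uxx t) (fun ψ p1 p2 => ?_)
  · simp only [inner_add_left, inner_sub_left, real_inner_smul_left] at key
    linarith
  · have e := hw (fun t x => θ t * ψ x) (contDiff_tensor h1 p1) (hasCompactSupport_tensor h2 p2)
    simp only [iteratedDeriv_two_const_mul, iteratedDeriv_two_mul_const,
      deriv_mul_const_field] at e
    have c1 := (contDiff_deriv (contDiff_deriv h1)).continuous
    have d1 := (contDiff_deriv (contDiff_deriv p1)).continuous
    have k2 : HasCompactSupport (deriv (deriv θ)) := h2.deriv.deriv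
    have i1 := (hu.integrable_mul c1 k2 p1.continuous).const_mul ρ
    have i2 := (hxx.integrable_mul h1.continuous h2 d1).const_mul μ
    have i12 : Integrable (fun p : ℝ × ℝ => ρ * (u p.1 p.2 * (deriv (deriv θ) p.1 * ψ p.2))
        + μ * (uxx p.1 p.2 * (θ p.1 * deriv (deriv ψ) p.2))) (volume.restrict (strip L)) := i1.add i2
    have i3 := hF.integrable_mul h1.continuous h2 p1.continuous
    have split : ∫ p in strip L, (ρ * u p.1 p.2 * (deriv (deriv θ) p.1 * ψ p.2)
          + μ * uxx p.1 p.2 * (θ p.1 * deriv (deriv ψ) p.2) + h p.1 p.2 * (θ p.1 * ψ p.2))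
        = ρ * inner ℝ (∫ t, deriv (deriv θ) t • curve L u t) (ofFun L ψ)
          + μ * inner ℝ (∫ t, θ t • curve L uxx t) (ofFun L (deriv (deriv ψ)))
          + inner ℝ (∫ t, θ t • curve L (trunc τ h) t) (ofFun L ψ) := by
      rw [← hu.integral_mul c1 k2 p1.continuous, ← hxx.integral_mul h1.continuous h2 d1,
        ← hF.integral_mul h1.continuous h2 p1.continuous, ← integral_const_mul,
        ← integral_const_mul, ← integral_add i1 i2, ← integral_add i12 i3]
      refine integral_congr_ae (ae_of_all _ fun p => ?_)
      have : h p.1 p.2 * (θ p.1 * ψ p.2) = trunc τ h p.1 p.2 * (θ p.1 * ψ p.2) := by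
        unfold trunc
        split_ifs with h0
        · rfl
        · rw [image_eq_zero_of_notMem_tsupport fun hh => h0 (h3 hh)]
          ring
      beta_reduce
      rw [this]
      ring
    have s1 : ∫ x in Ioo 0 L, ρ * u₁ x * (θ 0 * ψ x) = ρ * θ 0 * inner ℝ u₁ (ofFun L ψ) := by
      rw [inner_ofFun _ (memLp_of_continuous p1.continuous), ← integral_const_mul]
      congr 1
      ext x
      ring
    have s0 : ∫ x in Ioo 0 L, ρ * u₀ x * (deriv θ 0 * ψ x)
        = ρ * deriv θ 0 * inner ℝ u₀ (ofFun L ψ) := by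
      rw [inner_ofFun _ (memLp_of_continuous p1.continuous), ← integral_const_mul]
      congr 1
      ext x
      ring
    rw [split, s1, s0] at e
    simp only [inner_add_left, inner_sub_left, real_inner_smul_left]
    linarith

/-! ### The initial trace -/

/-- The test functions are `θ(a t) / a` with `a → ∞`, where `θ(t) = t` near `0`. Their value at zero
is `0` and their slope there is `1`, the second derivatives concentrate at zero with mass `-1` on
the half-line, and the term with the merely integrable `m` is `O(1/a)`. The limit is `-q 0 + c₀ =
0`. -/
lemma eq_of_weak_ode {q m : ℝ → ℝ} {c₀ c₁ : ℝ} (hq : Continuous q) (hm : IntegrableOn m (Ioo 0 1))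
    (h : ∀ θ : ℝ → ℝ, ContDiff ℝ ∞ θ → HasCompactSupport θ → tsupport θ ⊆ Iio 1 →
      (∫ t in Ioi 0, q t * deriv (deriv θ) t) + (∫ t in Ioo 0 1, m t * θ t) - c₁ * θ 0
        + c₀ * deriv θ 0 = 0) : q 0 = c₀ := by
  let b : ContDiffBump (0 : ℝ) := ⟨1 / 4, 1 / 2, by norm_num, by norm_num⟩
  set θ : ℝ → ℝ := fun t => t * b t with hθ
  have hθc : ContDiff ℝ ∞ θ := contDiff_id.mul b.contDiff
  have hz : ∀ t, 1 / 2 < |t| → θ t = 0 := by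
    intro t ht
    have : b t = 0 := b.zero_of_le_dist (by rw [Real.dist_eq, sub_zero]; exact ht.le)
    simp [hθ, this]
  have hz1 : ∀ t, 1 / 2 < |t| → deriv θ t = 0 := fun t => deriv_eq_zero_of_abs hz
  have hz2 : ∀ t, 1 / 2 < |t| → deriv (deriv θ) t = 0 := fun t => deriv_eq_zero_of_abs hz1
  have hθs := hasCompactSupport_of_abs hz
  have c1 := contDiff_deriv hθc
  have c2 := contDiff_deriv c1
  have hd0 : deriv θ 0 = 1 := by
    have e : θ =ᶠ[𝓝 0] fun t => t := by
      filter_upwards [b.eventuallyEq_one] with t ht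
      simp [hθ, ht]
    rw [e.deriv_eq]
    simp
  have hθ0 : θ 0 = 0 := by simp [hθ]
  obtain ⟨C, hC⟩ := hθs.exists_bound_of_continuous hθc.continuous
  have heq : ∀ k : ℕ, (∫ t in Ioi 0, q (t / ((k : ℝ) + 1)) * deriv (deriv θ) t)
      + (∫ t in Ioo 0 1, m t * (θ (((k : ℝ) + 1) * t) / ((k : ℝ) + 1))) + c₀ = 0 := by
    intro k
    set a : ℝ := (k : ℝ) + 1 with ha
    have ha0 : 0 < a := by positivity
    have ha1 : 1 ≤ a := by rw [ha]; linarith [Nat.cast_nonneg (α := ℝ) k]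
    have hzk : ∀ t, 1 / 2 < |t| → θ (a * t) / a = 0 := by
      intro t ht
      rw [hz, zero_div]
      rw [abs_mul, abs_of_pos ha0]
      nlinarith
    have e1 : deriv (fun t => θ (a * t) / a) = fun t => deriv θ (a * t) := by
      ext t
      rw [deriv_div_const, deriv_comp_mul_left]
      simp only [smul_eq_mul]
      field_simp
    have e2 : deriv (deriv (fun t => θ (a * t) / a)) = fun t => a * deriv (deriv θ) (a * t) := by
      rw [e1]
      ext t
      rw [deriv_comp_mul_left, smul_eq_mul]
    have hk := h (fun t => θ (a * t) / a) ((hθc.comp (by fun_prop)).div_const a)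
      (hasCompactSupport_of_abs hzk) ((closure_minimal (fun t ht => by
        by_contra hcon
        refine ht (hzk t ?_)
        rw [mem_Icc, ← abs_le, not_le] at hcon
        exact hcon) isClosed_Icc : _ ⊆ Icc (-(1 / 2) : ℝ) (1 / 2)).trans fun t ht => by
          simp only [mem_Iio]; linarith [ht.2])
    rw [e2, e1] at hk
    simp only [mul_zero, hd0, hθ0, zero_div, sub_zero, mul_one] at hk
    have hs := integral_comp_mul_left_Ioi (fun t => q (t / a) * deriv (deriv θ) t) 0 ha0
    rw [mul_zero, smul_eq_mul] at hs
    have hs' : ∫ t in Ioi 0, q t * (a * deriv (deriv θ) (a * t))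
        = ∫ t in Ioi 0, q (t / a) * deriv (deriv θ) t := by
      have : ∀ t, q t * (a * deriv (deriv θ) (a * t))
          = a * (q (a * t / a) * deriv (deriv θ) (a * t)) := by
        intro t
        rw [mul_div_cancel_left₀ _ ha0.ne']
        ring
      simp only [this]
      rw [integral_const_mul, hs]
      field_simp
    rw [hs'] at hk
    exact hk
  have l1 : Tendsto (fun k : ℕ => ∫ t in Ioi 0, q (t / ((k : ℝ) + 1)) * deriv (deriv θ) t) atTop
      (𝓝 (∫ t in Ioi 0, q 0 * deriv (deriv θ) t)) := by
    obtain ⟨B, hB⟩ := (isCompact_Icc (a := (-1 : ℝ)) (b := 1)).exists_bound_of_continuousOn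
      hq.continuousOn
    refine tendsto_integral_of_dominated_convergence (fun t => B * ‖deriv (deriv θ) t‖)
      (fun k => Continuous.aestronglyMeasurable ?_) ?_ (fun k => ae_of_all _ fun t => ?_)
      (ae_of_all _ fun t => ?_)
    · exact (hq.comp (by fun_prop)).mul c2.continuous
    · exact ((c2.continuous.integrable_of_hasCompactSupport hθs.deriv.deriv).norm.const_mul
        B).restrict
    · rw [norm_mul]
      by_cases ht : 1 / 2 < |t|
      · rw [hz2 t ht]
        simp
      · have hk1 : (0 : ℝ) < (k : ℝ) + 1 := by positivity
        have : |t / ((k : ℝ) + 1)| ≤ 1 := by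
          rw [abs_div, abs_of_pos hk1, div_le_one hk1]
          linarith [Nat.cast_nonneg (α := ℝ) k]
        have := hB _ (abs_le.1 this)
        gcongr
    · have ht : Tendsto (fun k : ℕ => t / ((k : ℝ) + 1)) atTop (𝓝 0) := by
        have := tendsto_one_div_add_atTop_nhds_zero_nat (𝕜 := ℝ)
        have := this.const_mul t
        simpa [div_eq_mul_inv] using this
      exact ((hq.tendsto 0).comp ht).mul_const _
  have l2 : Tendsto (fun k : ℕ => ∫ t in Ioo 0 1, m t * (θ (((k : ℝ) + 1) * t) / ((k : ℝ) + 1)))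
      atTop (𝓝 0) := by
    have hlim : Tendsto (fun k : ℕ => (∫ t in Ioo 0 1, ‖m t‖) * (C * (1 / ((k : ℝ) + 1)))) atTop
        (𝓝 0) := by
      have := ((tendsto_one_div_add_atTop_nhds_zero_nat (𝕜 := ℝ)).const_mul C).const_mul
        (∫ t in Ioo 0 1, ‖m t‖)
      simpa using this
    refine squeeze_zero_norm (fun k => ?_) hlim
    rw [← integral_mul_const]
    refine norm_integral_le_of_norm_le (hm.norm.mul_const _) (ae_of_all _ fun t => ?_)
    rw [norm_mul, norm_div, Real.norm_of_nonneg (by positivity : (0:ℝ) ≤ (k : ℝ) + 1),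
      div_eq_mul_one_div]
    have := hC (((k : ℝ) + 1) * t)
    gcongr
  have e3 : ∫ t in Ioi 0, q 0 * deriv (deriv θ) t = - q 0 := by
    rw [integral_const_mul, integral_Ioi_of_hasDerivAt_of_tendsto (f := deriv θ) (m := 0)
      c1.continuous.continuousWithinAt (fun t _ => (c1.differentiable (by simp) t).hasDerivAt)
      (c2.continuous.integrable_of_hasCompactSupport hθs.deriv.deriv).integrableOn, hd0]
    · ring
    · refine tendsto_const_nhds.congr' ?_
      filter_upwards [eventually_gt_atTop 1] with t ht
      rw [hz1 t (by rw [abs_of_pos (by linarith)]; linarith)]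
  have l3 := ((l1.add l2).add_const c₀).congr heq
  have := tendsto_nhds_unique l3 tendsto_const_nhds
  rw [e3] at this
  linarith

/-- A set of full measure is dense, and the inequality passes to the closure by continuity. -/
lemma abs_le_of_ae_Ioo {a b δ : ℝ} (hab : a < b) {f : ℝ → ℝ} (hf : ContinuousOn f (Icc a b))
    (h : ∀ᵐ x ∂(volume.restrict (Ioo a b)), |f x| ≤ δ) : ∀ x ∈ Icc a b, |f x| ≤ δ := by
  have hd : Dense {x | x ∈ Ioo a b → |f x| ≤ δ} :=
    Measure.dense_of_ae ((ae_restrict_iff' measurableSet_Ioo).1 h)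
  set s := Ioo a b ∩ {x | x ∈ Ioo a b → |f x| ≤ δ} with hs
  have hcl : closure s = Icc a b := by
    rw [← closure_Ioo hab.ne]
    refine subset_antisymm (closure_mono inter_subset_left) ?_
    exact closure_minimal (hd.open_subset_closure_inter isOpen_Ioo) isClosed_closure
  intro x hx
  rw [← hcl] at hf hx
  exact le_on_closure (f := fun x => |f x|) (g := fun _ => δ) (fun y hy => hy.2 hy.1) hf.abs
    continuousOn_const hx

/-- The initial displacement of a weak solution is attained. -/
lemma ofFun_initial_eq {L ρ μ : ℝ} (hL : 0 < L) (hρ : 0 < ρ) {u₀ u₁ : L2 L} {u uxx h : ℝ → ℝ → ℝ}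
    (hu : ContinuousOn (Function.uncurry u) (Ici 0 ×ˢ Icc 0 L)) (hxx : IsLocBdd L uxx)
    (hi : ∀ T : ℝ, IntegrableOn (Function.uncurry h) (Ioo 0 T ×ˢ Ioo 0 L))
    (hw : WeakFormulation L ρ μ u₀ u₁ u uxx h) : ofFun L (u 0) = u₀ := by
  refine sub_eq_zero.1 (eq_zero_of_inner_test _ fun ψ hψ => ?_)
  have hub := isLocBdd_of_continuousOn hu
  -- Clamping the arguments extends `u` continuously to the plane, so that the integral over `x` is
  -- continuous at all times.
  set U : ℝ → ℝ → ℝ := fun t x => u (max t 0) (max 0 (min x L)) with hU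
  have hUc : Continuous (Function.uncurry U) := by
    refine hu.comp_continuous (f := fun p : ℝ × ℝ => (max p.1 0, max 0 (min p.2 L)))
      (by fun_prop) fun p => ⟨mem_Ici.2 (le_max_right _ _), le_max_left _ _,
        max_le hL.le (min_le_right _ _)⟩
  have hUu : ∀ t, 0 ≤ t → ∀ x ∈ Icc 0 L, U t x = u t x := by
    intro t ht x hx
    simp only [hU]
    rw [max_eq_left ht, min_eq_left hx.2, max_eq_right hx.1]
  set q : ℝ → ℝ := fun t => ρ * ∫ x in 0..L, U t x * ψ x with hq
  have hqc : Continuous q := by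
    refine continuous_const.mul ?_
    refine intervalIntegral.continuous_parametric_intervalIntegral_of_continuous' (μ := volume)
      (f := fun t x => U t x * ψ x) ?_ 0 L
    exact hUc.mul (hψ.continuous.comp continuous_snd)
  have hqI : ∀ t, 0 ≤ t → q t = ρ * ∫ x in Ioo 0 L, u t x * ψ x := by
    intro t ht
    simp only [hq]
    rw [intervalIntegral.integral_of_le hL.le, integral_Ioc_eq_integral_Ioo]
    congr 1
    refine setIntegral_congr_fun measurableSet_Ioo fun x hx => ?_
    simp only [hUu t ht x (Ioo_subset_Icc_self hx)]
  obtain ⟨C, hC⟩ := hψ.compact.exists_bound_of_continuous hψ.continuous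
  have hbox : IntegrableOn (fun p : ℝ × ℝ => h p.1 p.2 * ψ p.2) (Ioo 0 1 ×ˢ Ioo 0 L) :=
    (hi 1).mul_bdd (c := C) (hψ.continuous.comp continuous_snd).aestronglyMeasurable
      (ae_of_all _ fun p => hC p.2)
  have hbox' : Integrable (fun p : ℝ × ℝ => h p.1 p.2 * ψ p.2)
      ((volume.restrict (Ioo (0 : ℝ) 1)).prod (volume.restrict (Ioo (0 : ℝ) L))) := by
    rw [Measure.prod_restrict]
    exact hbox
  have d1 := hψ.deriv.deriv.continuous
  set m₁ : ℝ → ℝ := fun t => inner ℝ (curve L uxx t) (ofFun L (deriv (deriv ψ))) with hm1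
  set m₂ : ℝ → ℝ := fun t => ∫ x in Ioo 0 L, h t x * ψ x with hm2
  have hm1i : IntegrableOn m₁ (Ioo 0 1) :=
    Integrable.inner_const ((hxx.locallyIntegrable_curve.integrableOn_isCompact
      (isCompact_Icc (a := (0 : ℝ)) (b := 1))).mono_set Ioo_subset_Icc_self) _
  have hm2i : IntegrableOn m₂ (Ioo 0 1) := hbox'.integral_prod_left
  -- Testing with `θ(t) ψ(x)` turns the beam equation into a scalar equation `q'' + m = 0`.
  -- Integrability of the force is enough here, so the initial value is available before any bound
  -- on `u`.
  have key := eq_of_weak_ode (q := q) (m := fun t => μ * m₁ t + m₂ t)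
    (c₀ := ρ * inner ℝ u₀ (ofFun L ψ)) (c₁ := ρ * inner ℝ u₁ (ofFun L ψ)) hqc
    ((hm1i.const_mul μ).add hm2i) fun θ h1 h2 h3 => ?_
  · rw [hqI 0 le_rfl] at key
    have h4 := mul_left_cancel₀ hρ.ne' key
    have hu0 : MemLp (u 0) 2 (volume.restrict (Ioo (0 : ℝ) L)) := by
      refine memLp_of_continuousOn ?_
      exact hu.comp (f := fun x => ((0 : ℝ), x)) (by fun_prop) fun x hx => ⟨mem_Ici.2 le_rfl, hx⟩
    rw [inner_sub_left, ← h4, inner_ofFun _ hψ.memLp, sub_eq_zero]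
    refine integral_congr_ae ?_
    filter_upwards [coeFn_ofFun hu0] with x hx
    rw [hx]
  · have e := hw (fun t x => θ t * ψ x) (contDiff_tensor h1 hψ.contDiff)
      (hasCompactSupport_tensor h2 hψ.compact)
    simp only [iteratedDeriv_two_const_mul, iteratedDeriv_two_mul_const,
      deriv_mul_const_field] at e
    have c1 := (contDiff_deriv (contDiff_deriv h1)).continuous
    have k2 : HasCompactSupport (deriv (deriv θ)) := h2.deriv.deriv
    obtain ⟨Cθ, hCθ⟩ := h2.exists_bound_of_continuous h1.continuous
    have hθ0 : ∀ t, 1 ≤ t → θ t = 0 := fun t ht =>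
      image_eq_zero_of_notMem_tsupport fun hh => not_lt.2 ht (h3 hh)
    have i1 := (hub.integrable_mul c1 k2 hψ.continuous).const_mul ρ
    have i2 := (hxx.integrable_mul h1.continuous h2 d1).const_mul μ
    have i12 : Integrable (fun p : ℝ × ℝ => ρ * (u p.1 p.2 * (deriv (deriv θ) p.1 * ψ p.2))
        + μ * (uxx p.1 p.2 * (θ p.1 * deriv (deriv ψ) p.2))) (volume.restrict (strip L)) := i1.add i2
    have hsub : Ioo (0 : ℝ) 1 ×ˢ Ioo 0 L ⊆ strip L := prod_mono Ioo_subset_Ioi_self le_rfl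
    have hvan : ∀ p ∈ strip L \ (Ioo (0 : ℝ) 1 ×ˢ Ioo 0 L), h p.1 p.2 * (θ p.1 * ψ p.2) = 0 := by
      rintro ⟨t, x⟩ ⟨hp, hp'⟩
      have : 1 ≤ t := by
        by_contra hcon
        exact hp' ⟨⟨hp.1, not_le.1 hcon⟩, hp.2⟩
      simp [hθ0 t this]
    have i3b : IntegrableOn (fun p : ℝ × ℝ => h p.1 p.2 * (θ p.1 * ψ p.2)) (Ioo 0 1 ×ˢ Ioo 0 L) := by
      refine (hbox.bdd_mul (c := Cθ) (f := fun p : ℝ × ℝ => θ p.1)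
        (h1.continuous.comp continuous_fst).aestronglyMeasurable
        (ae_of_all _ fun p => hCθ p.1)).congr (ae_of_all _ fun p => ?_)
      simp only
      ring
    have i3 : IntegrableOn (fun p : ℝ × ℝ => h p.1 p.2 * (θ p.1 * ψ p.2)) (strip L) :=
      i3b.of_forall_sdiff_eq_zero (measurableSet_Ioi.prod measurableSet_Ioo) hvan
    have A : ∫ p in strip L, ρ * (u p.1 p.2 * (deriv (deriv θ) p.1 * ψ p.2))
        = ∫ t in Ioi 0, q t * deriv (deriv θ) t := by
      rw [restrict_strip] at i1 ⊢
      rw [integral_prod _ i1]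
      refine setIntegral_congr_fun measurableSet_Ioi fun t ht => ?_
      simp only
      rw [hqI t (le_of_lt ht), ← integral_const_mul, ← integral_mul_const]
      congr 1
      ext x
      ring
    have B : ∫ p in strip L, μ * (uxx p.1 p.2 * (θ p.1 * deriv (deriv ψ) p.2))
        = ∫ t in Ioo 0 1, μ * m₁ t * θ t := by
      rw [integral_const_mul, hxx.integral_mul h1.continuous h2 d1, inner_integral_left
        (hxx.locallyIntegrable_curve.integrable_smul_left_of_hasCompactSupport h1.continuous h2),
        ← setIntegral_eq_integral_of_forall_compl_eq_zero (s := Ioo (0 : ℝ) 1),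
        ← integral_const_mul]
      · congr 1
        ext t
        rw [real_inner_smul_left]
        simp only [hm1]
        ring
      · intro t ht
        rcases le_or_gt t 0 with h0 | h0
        · rw [curve_of_nonpos _ h0, smul_zero, inner_zero_left]
        · rw [hθ0 t (not_lt.1 fun hh => ht ⟨h0, hh⟩), zero_smul, inner_zero_left]
    have D : ∫ p in strip L, h p.1 p.2 * (θ p.1 * ψ p.2) = ∫ t in Ioo 0 1, m₂ t * θ t := by
      rw [setIntegral_eq_of_subset_of_forall_sdiff_eq_zero
        (show MeasurableSet (strip L) from measurableSet_Ioi.prod measurableSet_Ioo) hsub hvan]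
      have i3b' : Integrable (fun p : ℝ × ℝ => h p.1 p.2 * (θ p.1 * ψ p.2))
          ((volume.restrict (Ioo (0 : ℝ) 1)).prod (volume.restrict (Ioo (0 : ℝ) L))) := by
        rw [Measure.prod_restrict]
        exact i3b
      have er : (volume : Measure (ℝ × ℝ)).restrict (Ioo (0 : ℝ) 1 ×ˢ Ioo 0 L)
          = (volume.restrict (Ioo (0 : ℝ) 1)).prod (volume.restrict (Ioo (0 : ℝ) L)) := by
        rw [Measure.prod_restrict]
        rfl
      rw [er, integral_prod _ i3b']
      congr 1
      ext t
      simp only [hm2]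
      rw [← integral_mul_const]
      congr 1
      ext x
      ring
    have split : ∫ p in strip L, (ρ * u p.1 p.2 * (deriv (deriv θ) p.1 * ψ p.2)
          + μ * uxx p.1 p.2 * (θ p.1 * deriv (deriv ψ) p.2) + h p.1 p.2 * (θ p.1 * ψ p.2))
        = (∫ t in Ioi 0, q t * deriv (deriv θ) t) + ∫ t in Ioo 0 1, (μ * m₁ t + m₂ t) * θ t := by
      have j1 : IntegrableOn (fun t => μ * m₁ t * θ t) (Ioo 0 1) :=
        (hm1i.const_mul μ).mul_bdd (c := Cθ) h1.continuous.aestronglyMeasurable (ae_of_all _ hCθ)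
      have j2 : IntegrableOn (fun t => m₂ t * θ t) (Ioo 0 1) :=
        hm2i.mul_bdd (c := Cθ) h1.continuous.aestronglyMeasurable (ae_of_all _ hCθ)
      have : ∀ t, (μ * m₁ t + m₂ t) * θ t = μ * m₁ t * θ t + m₂ t * θ t := fun t => by ring
      simp only [this]
      rw [integral_add j1 j2, ← A, ← B, ← D, ← add_assoc, ← integral_add i1 i2,
        ← integral_add i12 i3]
      refine integral_congr_ae (ae_of_all _ fun p => ?_)
      beta_reduce
      ring
    have s1 : ∫ x in Ioo 0 L, ρ * u₁ x * (θ 0 * ψ x) = ρ * inner ℝ u₁ (ofFun L ψ) * θ 0 := by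
      rw [inner_ofFun _ hψ.memLp, ← integral_const_mul, ← integral_mul_const]
      congr 1
      ext x
      ring
    have s0 : ∫ x in Ioo 0 L, ρ * u₀ x * (deriv θ 0 * ψ x)
        = ρ * inner ℝ u₀ (ofFun L ψ) * deriv θ 0 := by
      rw [inner_ofFun _ hψ.memLp, ← integral_const_mul, ← integral_mul_const]
      congr 1
      ext x
      ring
    rw [split, s1, s0] at e
    exact e

/-- Two weak solutions with the same initial displacement agree at the initial time. -/
lemma eq_of_ofFun_eq {L : ℝ} (hL : 0 < L) {f g : ℝ → ℝ} (hf : ContinuousOn f (Icc 0 L))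
    (hg : ContinuousOn g (Icc 0 L)) (h : ofFun L f = ofFun L g) : ∀ x ∈ Icc 0 L, f x = g x := by
  intro x hx
  have := abs_le_of_ae_Ioo (δ := 0) hL (hf.sub hg) (by
    filter_upwards [coeFn_ofFun (memLp_of_continuousOn hf),
      coeFn_ofFun (memLp_of_continuousOn hg)] with y h1 h2
    rw [h] at h1
    rw [Pi.sub_apply, ← h1, ← h2]
    simp) x hx
  exact sub_eq_zero.1 (abs_nonpos_iff.1 this)

/-! ### Differences of weak derivatives -/

lemma integrable_mul_of_tsupport_subset {S : Set (ℝ × ℝ)} (hS : MeasurableSet S)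
    {f φ : ℝ × ℝ → ℝ} (hf : LocallyIntegrableOn f S) (hφ : Continuous φ)
    (hc : HasCompactSupport φ) (hs : tsupport φ ⊆ S) :
    IntegrableOn (fun p => f p * φ p) S := by
  obtain ⟨C, hC⟩ := hc.exists_bound_of_continuous hφ
  have h1 : IntegrableOn f (tsupport φ) := hf.integrableOn_compact_subset hs hc
  have h2 : IntegrableOn (fun p => f p * φ p) (tsupport φ) :=
    h1.mul_bdd (c := C) hφ.aestronglyMeasurable (ae_of_all _ hC)
  refine h2.of_forall_sdiff_eq_zero hS fun p hp => ?_
  rw [image_eq_zero_of_notMem_tsupport hp.2, mul_zero]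

lemma setIntegral_sub_mul {S : Set (ℝ × ℝ)} (hS : MeasurableSet S) {a b : ℝ → ℝ → ℝ}
    {ψ : ℝ × ℝ → ℝ} (ha : LocallyIntegrableOn (Function.uncurry a) S)
    (hb : LocallyIntegrableOn (Function.uncurry b) S) (hψ : Continuous ψ)
    (hc : HasCompactSupport ψ) (hs : tsupport ψ ⊆ S) :
    ∫ p in S, (a p.1 p.2 - b p.1 p.2) * ψ p
      = (∫ p in S, a p.1 p.2 * ψ p) - ∫ p in S, b p.1 p.2 * ψ p := by
  have ia : IntegrableOn (fun p => a p.1 p.2 * ψ p) S :=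
    integrable_mul_of_tsupport_subset hS ha hψ hc hs
  have ib : IntegrableOn (fun p => b p.1 p.2 * ψ p) S :=
    integrable_mul_of_tsupport_subset hS hb hψ hc hs
  rw [← integral_sub ia ib]
  simp only [sub_mul]

lemma contDiff_fderiv_apply {ψ : ℝ × ℝ → ℝ} (h : ContDiff ℝ ∞ ψ) (v : ℝ × ℝ) :
    ContDiff ℝ ∞ fun p => fderiv ℝ ψ p v :=
  (h.fderiv_right (m := ∞) (by simp)).clm_apply contDiff_const

lemma deriv_fst_eq {ψ : ℝ × ℝ → ℝ} (h : ContDiff ℝ ∞ ψ) (t x : ℝ) :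
    deriv (fun t => ψ (t, x)) t = fderiv ℝ ψ (t, x) (1, 0) := by
  have h1 : HasDerivAt (fun t : ℝ => (t, x)) (1, 0) t :=
    (hasDerivAt_id t).prodMk (hasDerivAt_const t x)
  exact ((h.differentiable (by simp) (t, x)).hasFDerivAt.comp_hasDerivAt t h1).deriv

lemma deriv_snd_eq {ψ : ℝ × ℝ → ℝ} (h : ContDiff ℝ ∞ ψ) (t x : ℝ) :
    deriv (fun x => ψ (t, x)) x = fderiv ℝ ψ (t, x) (0, 1) := by
  have h1 : HasDerivAt (fun x : ℝ => (t, x)) (0, 1) x :=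
    (hasDerivAt_const x t).prodMk (hasDerivAt_id x)
  exact ((h.differentiable (by simp) (t, x)).hasFDerivAt.comp_hasDerivAt x h1).deriv

lemma measurableSet_strip (L : ℝ) : MeasurableSet (strip L) :=
  measurableSet_Ioi.prod measurableSet_Ioo

/-- Splitting the integral requires each product to be integrable on the strip. The derivative of
`φ` is written as a directional Fréchet derivative, which is continuous in both variables and
supported in the support of `φ`. -/
lemma IsWeakDt.sub {L : ℝ} {u v g k : ℝ → ℝ → ℝ} (hu : IsWeakDt L u g) (hv : IsWeakDt L v k) :
    IsWeakDt L (fun t x => u t x - v t x) (fun t x => g t x - k t x) := by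
  refine ⟨hu.1.sub hv.1, hu.2.1.sub hv.2.1, fun φ hφ => ?_⟩
  have e1 : ∀ p : ℝ × ℝ, deriv (fun t => φ t p.2) p.1 = fderiv ℝ (Function.uncurry φ) p (1, 0) :=
    fun p => deriv_fst_eq hφ.1 p.1 p.2
  have c1 := (contDiff_fderiv_apply hφ.1 (1, 0)).continuous
  have s1 := tsupport_fderiv_apply_subset ℝ (f := Function.uncurry φ) ((1, 0) : ℝ × ℝ)
  have k1 : HasCompactSupport fun p => fderiv ℝ (Function.uncurry φ) p (1, 0) :=
    hφ.2.1.of_isClosed_subset (isClosed_tsupport _) s1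
  have h1 := hu.2.2 φ hφ
  have h2 := hv.2.2 φ hφ
  simp only [e1] at h1 h2 ⊢
  rw [setIntegral_sub_mul (measurableSet_strip L) hu.1 hv.1 c1 k1 (s1.trans hφ.2.2), h1, h2]
  have := setIntegral_sub_mul (measurableSet_strip L) hu.2.1 hv.2.1 hφ.1.continuous hφ.2.1 hφ.2.2
  simp only [Function.uncurry_def] at this
  rw [this]
  ring

lemma IsWeakDxx.sub {L : ℝ} {u v g k : ℝ → ℝ → ℝ} (hu : IsWeakDxx L u g)
    (hv : IsWeakDxx L v k) :
    IsWeakDxx L (fun t x => u t x - v t x) (fun t x => g t x - k t x) := by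
  refine ⟨hu.1.sub hv.1, hu.2.1.sub hv.2.1, fun φ hφ => ?_⟩
  set φ' : ℝ × ℝ → ℝ := fun p => fderiv ℝ (Function.uncurry φ) p (0, 1) with hφ'
  have d1 : ContDiff ℝ ∞ φ' := contDiff_fderiv_apply hφ.1 (0, 1)
  have e1 : ∀ p : ℝ × ℝ, iteratedDeriv 2 (fun x => φ p.1 x) p.2 = fderiv ℝ φ' p (0, 1) := by
    intro p
    rw [iteratedDeriv_succ, iteratedDeriv_one]
    have : deriv (fun x => φ p.1 x) = fun x => φ' (p.1, x) :=
      funext fun x => deriv_snd_eq hφ.1 p.1 x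
    rw [this]
    exact deriv_snd_eq d1 p.1 p.2
  have c1 := (contDiff_fderiv_apply d1 (0, 1)).continuous
  have s1 := (tsupport_fderiv_apply_subset ℝ (f := φ') ((0, 1) : ℝ × ℝ)).trans
    (tsupport_fderiv_apply_subset ℝ (f := Function.uncurry φ) ((0, 1) : ℝ × ℝ))
  have k1 : HasCompactSupport fun p => fderiv ℝ φ' p (0, 1) :=
    hφ.2.1.of_isClosed_subset (isClosed_tsupport _) s1
  have h1 := hu.2.2 φ hφ
  have h2 := hv.2.2 φ hφ
  simp only [e1] at h1 h2 ⊢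
  rw [setIntegral_sub_mul (measurableSet_strip L) hu.1 hv.1 c1 k1 (s1.trans hφ.2.2), h1, h2]
  have := setIntegral_sub_mul (measurableSet_strip L) hu.2.1 hv.2.1 hφ.1.continuous hφ.2.1 hφ.2.2
  simp only [Function.uncurry_def] at this
  rw [this]

/-! ### The adhesion force near zero -/

/-- `Φ` has a minimum at `0`, so `Φ'(0) = 0`, and `Φ''` is bounded on `[-1/2, 1/2]`, away from the
kinks; the mean value inequality does the rest. -/
lemma IsAdhesionPotential.exists_abs_deriv_le {Φ : ℝ → ℝ} {κ : ℝ} (h : IsAdhesionPotential Φ κ) :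
    ∃ C : ℝ, 0 ≤ C ∧ ∀ s : ℝ, |s| ≤ 1 / 2 → |deriv Φ s| ≤ C * |s| := by
  have ho : IsOpen ({1, -1}ᶜ : Set ℝ) := (Set.toFinite _).isClosed.isOpen_compl
  have hsub : Icc (-(1 / 2) : ℝ) (1 / 2) ⊆ ({1, -1}ᶜ : Set ℝ) := by
    intro s hs
    simp only [mem_compl_iff, mem_insert_iff, mem_singleton_iff, not_or]
    constructor <;> rintro rfl <;> norm_num at hs
  have h1 : ContDiffOn ℝ 1 (deriv Φ) {1, -1}ᶜ := h.contDiffOn.deriv_of_isOpen ho (by norm_num)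
  have h2 : ContinuousOn (deriv (deriv Φ)) {1, -1}ᶜ := h1.continuousOn_deriv_of_isOpen ho le_rfl
  obtain ⟨C, hC⟩ := isCompact_Icc.exists_bound_of_continuousOn (h2.mono hsub)
  have h0 : deriv Φ 0 = 0 := by
    refine IsLocalMin.deriv_eq_zero ?_
    filter_upwards [Icc_mem_nhds (show (-1 : ℝ) < 0 by norm_num) (show (0 : ℝ) < 1 by norm_num)]
      with s hs
    rcases le_total s 0 with h' | h'
    · exact h.antitoneOn ⟨hs.1, h'⟩ ⟨by norm_num, le_rfl⟩ h'
    · exact h.monotoneOn ⟨le_rfl, by norm_num⟩ ⟨h', hs.2⟩ h'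
  refine ⟨C, (norm_nonneg _).trans (hC 0 (by norm_num)), fun s hs => ?_⟩
  have := (convex_Icc (-(1 / 2) : ℝ) (1 / 2)).norm_image_sub_le_of_norm_deriv_le (f := deriv Φ)
    (x := 0) (y := s) (C := C)
    (fun x hx => (h1.differentiableOn (by norm_num)).differentiableAt (ho.mem_nhds (hsub hx))) hC
    (by norm_num) (abs_le.1 hs)
  simpa [h0] using this

/-- For the zero potential the one-sided limits at `±1` are `0` as well, so no force is left there
either. -/
lemma InSubdiff.eq_zero {s y : ℝ} (h : InSubdiff (fun _ => 0) s y) : y = 0 := by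
  have hlim : ∀ {l : Filter ℝ} [l.NeBot] {e : EReal},
      Tendsto (fun r : ℝ => ((deriv (fun _ : ℝ => (0 : ℝ)) r : ℝ) : EReal)) l (𝓝 e) → e = 0 := by
    intro l _ e he
    simp only [deriv_const] at he
    exact (tendsto_nhds_unique tendsto_const_nhds he).symm
  rcases lt_trichotomy |s| 1 with h1 | h1 | h1
  · simpa using h.1 h1
  · rcases eq_or_eq_neg_of_abs_eq h1 with h2 | h2
    · obtain ⟨a, l, hl, hy⟩ := h.2.2.1 h2
      rw [hlim hl] at hy
      exact le_antisymm (by exact_mod_cast hy) a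
    · obtain ⟨a, l, hl, hy⟩ := h.2.2.2 h2
      rw [hlim hl] at hy
      exact le_antisymm a (by exact_mod_cast hy)
  · exact h.2.1 h1

/-! ### Weak convergence -/

lemma tendsto_of_tendsto_toWeakSpace {E : Type*} [NormedAddCommGroup E] [NormedSpace ℝ E]
    {x : ℕ → E} (h : Tendsto (fun n => toWeakSpace ℝ E (x n)) atTop (𝓝 0)) (f : E →L[ℝ] ℝ) :
    Tendsto (fun n => f (x n)) atTop (𝓝 0) := by
  have hc : Continuous fun y : WeakSpace ℝ E => (topDualPairing ℝ E).flip y f :=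
    WeakBilin.eval_continuous (topDualPairing ℝ E).flip f
  have := (hc.tendsto 0).comp h
  have e : (topDualPairing ℝ E).flip (0 : WeakSpace ℝ E) f = 0 := map_zero f
  rw [e] at this
  exact this

lemma exists_norm_le_of_weak {H : Type*} [NormedAddCommGroup H] [InnerProductSpace ℝ H]
    [CompleteSpace H] {p : ℕ → H} (hp : ∀ q : H, Tendsto (fun n => inner ℝ (p n) q) atTop (𝓝 0)) :
    ∃ R : ℝ, 0 ≤ R ∧ ∀ n, ‖p n‖ ≤ R := by
  obtain ⟨R, hR⟩ := banach_steinhaus (g := fun n => innerSL ℝ (p n)) fun q => by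
    obtain ⟨C, hC⟩ := (Metric.isBounded_range_of_tendsto _ (hp q)).exists_norm_le
    exact ⟨C, fun n => hC _ ⟨n, rfl⟩⟩
  simp only [innerSL_apply_norm] at hR
  exact ⟨R, (norm_nonneg _).trans (hR 0), hR⟩

lemma H2.tendsto_inner {L : ℝ} {u : ℕ → H2 L}
    (h : Tendsto (fun n => toWeakSpace ℝ (H2 L) (u n)) atTop (𝓝 0)) (i : Fin 3) (q : L2 L) :
    Tendsto (fun n => inner ℝ ((u n).1 i) q) atTop (𝓝 0) := by
  have := tendsto_of_tendsto_toWeakSpace h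
    ((innerSL ℝ q).comp ((PiLp.proj 2 (fun _ : Fin 3 => L2 L) i).comp (H2 L).subtypeL))
  refine this.congr fun n => ?_
  simp [real_inner_comm]

/-! ### The energy of the linear problem -/

lemma energy_zero {L ρ μ : ℝ} (f : ℝ → ℝ) {p q : ℝ → ℝ}
    (hp : MemLp p 2 (volume.restrict (Ioo (0 : ℝ) L)))
    (hq : MemLp q 2 (volume.restrict (Ioo (0 : ℝ) L))) :
    energy L ρ μ (fun _ => 0) f p q = (ρ * ‖ofFun L p‖ ^ 2 + μ * ‖ofFun L q‖ ^ 2) / 2 := by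
  have e : ∀ {a : ℝ → ℝ}, MemLp a 2 (volume.restrict (Ioo (0 : ℝ) L)) →
      ‖ofFun L a‖ ^ 2 = ∫ x in Ioo 0 L, a x ^ 2 := by
    intro a ha
    rw [norm_sq_eq_integral]
    refine integral_congr_ae ?_
    filter_upwards [coeFn_ofFun ha] with x hx
    rw [hx]
  rw [e hp, e hq, energy, ← integral_const_mul, ← integral_const_mul,
    ← integral_add (hp.integrable_sq.const_mul _) (hq.integrable_sq.const_mul _),
    ← integral_div]
  simp only [add_zero]

lemma abs_le_of_ae_rectangle {L T δ : ℝ} (hL : 0 < L) (hT : 0 < T) {f : ℝ → ℝ → ℝ}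
    (hf : ContinuousOn (Function.uncurry f) (Icc 0 T ×ˢ Icc 0 L))
    (h : ∀ᵐ t ∂(volume.restrict (Ioo 0 T)), ∀ᵐ x ∂(volume.restrict (Ioo 0 L)), |f t x| ≤ δ) :
    ∀ t ∈ Icc 0 T, ∀ x ∈ Icc 0 L, |f t x| ≤ δ := by
  intro t ht x hx
  have h1 : ContinuousOn (fun s => f s x) (Icc 0 T) :=
    hf.comp (f := fun s => (s, x)) (by fun_prop) fun s hs => ⟨hs, hx⟩
  refine abs_le_of_ae_Ioo hT h1 ?_ t ht
  filter_upwards [h, ae_restrict_mem measurableSet_Ioo] with s hs hs0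
  have h2 : ContinuousOn (fun y => f s y) (Icc 0 L) :=
    hf.comp (f := fun y => (s, y)) (by fun_prop) fun y hy => ⟨Ioo_subset_Icc_self hs0, hy⟩
  exact abs_le_of_ae_Ioo hL h2 hs x hx

lemma ofFun_zero (L : ℝ) : ofFun L (fun _ => 0) = 0 := by
  have := norm_ofFun_le (L := L) (φ := fun _ => 0) le_rfl (by simp)
  simpa using this

/-- A dissipative solution together with its derivatives and its force. -/
structure IsSolution (L ρ μ : ℝ) (Φ : ℝ → ℝ) (u₀ : H2 L) (u₁ : L2 L) (u ut uxx h : ℝ → ℝ → ℝ) :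
    Prop where
  cont : ContinuousOn (Function.uncurry u) (Ici 0 ×ˢ Icc 0 L)
  dt : IsWeakDt L u ut
  dxx : IsWeakDxx L u uxx
  mem_dt : MemLinfL2 L ut
  mem_dxx : MemLinfL2 L uxx
  integrable : ∀ T : ℝ, IntegrableOn (Function.uncurry h) (Ioo 0 T ×ˢ Ioo 0 L)
  force : ∀ t ∈ Ici (0 : ℝ), ∀ x ∈ Icc 0 L, InSubdiff Φ (u t x) (h t x)
  weak : WeakFormulation L ρ μ (H2.fn u₀) u₁ u uxx h
  energy_le : ∀ᵐ t ∂(volume.restrict (Ioi (0 : ℝ))),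
    energy L ρ μ Φ (u t) (ut t) (uxx t) ≤ energy L ρ μ Φ (H2.fn u₀) u₁ (H2.dxx u₀)

lemma IsDissipativeSolution.exists_isSolution {L ρ μ : ℝ} {Φ : ℝ → ℝ} {u₀ : H2 L} {u₁ : L2 L}
    {u : ℝ → ℝ → ℝ} (hu : IsDissipativeSolution L ρ μ Φ u₀ u₁ u) :
    ∃ ut uxx h, IsSolution L ρ μ Φ u₀ u₁ u ut uxx h := by
  obtain ⟨h0, ut, uxx, h, h1, h2, h3, h4, h5, h6, h7, h8⟩ := hu
  exact ⟨ut, uxx, h, h0, h1, h2, h3, h4, h5, h6, h7, h8⟩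

/-! ### Uniform smallness of the linear solutions -/

namespace IsSolution

variable {L ρ μ : ℝ} {Φ : ℝ → ℝ} {u₀ : H2 L} {u₁ : L2 L} {u ut uxx h v vt vxx k : ℝ → ℝ → ℝ}

lemma isBeamCurve (hL : 0 < L) (hu : IsSolution L ρ μ Φ u₀ u₁ u ut uxx h) {τ M : ℝ}
    (hb : ∀ t ∈ Ioo 0 τ, ∀ x ∈ Ioo 0 L, |h t x| ≤ M) :
    IsBeamCurve L ρ μ τ (H2.fn u₀) u₁ (curve L u) (curve L uxx) (curve L (trunc τ h)) :=
  isBeamCurve_of_weakFormulation hL (isLocBdd_of_continuousOn hu.cont)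
    (isLocBdd_of_memLinfL2 hu.mem_dxx) hu.dxx hu.integrable hb hu.weak

lemma linear_force_eq_zero (hv : IsSolution L ρ μ (fun _ => 0) u₀ u₁ v vt vxx k) {t x : ℝ}
    (ht : 0 ≤ t) (hx : x ∈ Ioo 0 L) : k t x = 0 :=
  (hv.force t ht x (Ioo_subset_Icc_self hx)).eq_zero

lemma linear_curve_force (hv : IsSolution L ρ μ (fun _ => 0) u₀ u₁ v vt vxx k) (τ t : ℝ) :
    curve L (trunc τ k) t = 0 := by
  rcases le_or_gt t 0 with h0 | h0
  · exact curve_of_nonpos _ h0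
  · rw [curve_of_pos _ h0, ← ofFun_zero L]
    refine ofFun_congr fun x hx => ?_
    unfold trunc
    rw [hv.linear_force_eq_zero h0.le hx, ite_self]

lemma linear_isBeamCurve (hL : 0 < L) (hv : IsSolution L ρ μ (fun _ => 0) u₀ u₁ v vt vxx k)
    (τ : ℝ) :
    IsBeamCurve L ρ μ τ (H2.fn u₀) u₁ (curve L v) (curve L vxx) (curve L (trunc τ k)) :=
  hv.isBeamCurve hL (M := 0) fun t ht x hx => by
    rw [hv.linear_force_eq_zero ht.1.le hx, abs_zero]

lemma memLp_slice (hu : IsSolution L ρ μ Φ u₀ u₁ u ut uxx h) {t : ℝ} (ht : 0 ≤ t) :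
    MemLp (u t) 2 (volume.restrict (Ioo (0 : ℝ) L)) := by
  refine memLp_of_continuousOn ?_
  exact hu.cont.comp (f := fun x => (t, x)) (by fun_prop) fun x hx => ⟨mem_Ici.2 ht, hx⟩

/-- The dissipation inequality with zero potential, after dropping the kinetic energy on the left.
-/
lemma linear_dxx_bound (hρ : 0 < ρ) (hμ : 0 < μ)
    (hv : IsSolution L ρ μ (fun _ => 0) u₀ u₁ v vt vxx k) {M : ℝ} (hM : 0 ≤ M)
    (hE : ρ * ‖u₁‖ ^ 2 + μ * ‖H2.dxx u₀‖ ^ 2 ≤ μ * M ^ 2) :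
    ∀ᵐ t ∂(volume.restrict (Ioi (0 : ℝ))), ‖curve L vxx t‖ ≤ M := by
  filter_upwards [hv.energy_le, (isLocBdd_of_memLinfL2 hv.mem_dt).memLp,
    (isLocBdd_of_memLinfL2 hv.mem_dxx).memLp, ae_restrict_mem measurableSet_Ioi] with t h1 h2 h3 ht
  rw [energy_zero _ h2 h3, energy_zero _ (Lp.memLp u₁) (Lp.memLp (H2.dxx u₀)), ofFun_coeFn,
    ofFun_coeFn] at h1
  rw [curve_of_pos _ ht]
  have h4 : 0 ≤ ρ * ‖ofFun L (vt t)‖ ^ 2 := by positivity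
  have h5 : μ * ‖ofFun L (vxx t)‖ ^ 2 ≤ μ * M ^ 2 := by linarith
  exact (abs_le_of_sq_le_sq' (le_of_mul_le_mul_left h5 hμ) hM).2

/-- A bound in the supremum norm for the linear problem. -/
lemma linear_abs_le (hL : 0 < L) (hρ : 0 < ρ) (hμ : 0 < μ)
    (hv : IsSolution L ρ μ (fun _ => 0) u₀ u₁ v vt vxx k) {C M κ R σ r T : ℝ} (hT : 0 < T)
    (hC0 : 0 ≤ C) (hC : ∀ f g : L2 L, IsWeakD2 L f g → ∀ r : ℝ, 0 < r → r ≤ L →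
      ∀ᵐ x ∂(volume.restrict (Ioo (0 : ℝ) L)), |f x| ≤ ‖f‖ / √r + C * (‖f‖ + ‖g‖) * r)
    (hM : 0 ≤ M) (hE : ρ * ‖u₁‖ ^ 2 + μ * ‖H2.dxx u₀‖ ^ 2 ≤ μ * M ^ 2) (hκ0 : 0 ≤ κ)
    (hκ : ∀ f g : L2 L, IsWeakD2 L f g → |inner ℝ u₁ f| ≤ κ * (‖f‖ + ‖g‖))
    (hR : R = 2 * ‖H2.fn u₀‖ + 4 * (T + 1) * ‖u₁‖)
    (hσ : σ = √(2 * (‖H2.fn u₀‖ * R + 2 * (κ * ((T + 1) + √(ρ / μ)) * R)))) (hr : 0 < r)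
    (hrL : r ≤ L) :
    ∀ t ∈ Icc 0 T, ∀ x ∈ Icc 0 L, |v t x| ≤ σ / √r + C * (σ + M) * r := by
  -- The horizon exceeds `T` by one to leave room for mollification.
  have hbc := hv.linear_isBeamCurve hL (T + 1)
  refine abs_le_of_ae_rectangle hL hT (hv.cont.mono (prod_mono Icc_subset_Ici_self le_rfl)) ?_
  have h1 := hbc.linear_norm_sq_le hρ hμ (ae_of_all _ (hv.linear_curve_force (T + 1))) hT.le le_rfl
    hκ0 hκ hR
  refine (ae_restrict_iff' measurableSet_Ioo).2 ?_
  filter_upwards [h1, hbc.ae_isWeakD2, (ae_restrict_iff' measurableSet_Ioi).1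
    (hv.linear_dxx_bound hρ hμ hM hE)] with t h1 h2 h3 ht
  have h3 := h3 ht.1
  have h1 : ‖curve L v t‖ ≤ σ := by
    rw [hσ]
    exact Real.le_sqrt_of_sq_le (h1 ht.1 ht.2)
  have hm := hv.memLp_slice ht.1.le
  have hcur : curve L v t =ᵐ[volume.restrict (Ioo (0 : ℝ) L)] v t := by
    rw [curve_of_pos _ ht.1]
    exact coeFn_ofFun hm
  filter_upwards [hcur, hC _ _ h2 r hr hrL] with x hx1 hx2
  rw [← hx1]
  refine hx2.trans ?_
  gcongr

end IsSolution

/-- Linear solutions with weakly vanishing data converge uniformly to zero. -/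
lemma linear_tendsto_uniformly {L ρ μ : ℝ} (hL : 0 < L) (hρ : 0 < ρ) (hμ : 0 < μ)
    {u₀ : ℕ → H2 L} {u₁ : ℕ → L2 L} {v vt vxx k : ℕ → ℝ → ℝ → ℝ}
    (hv : ∀ n, IsSolution L ρ μ (fun _ => 0) (u₀ n) (u₁ n) (v n) (vt n) (vxx n) (k n))
    (hu₀ : Tendsto (fun n => toWeakSpace ℝ (H2 L) (u₀ n)) atTop (𝓝 0))
    (hu₁ : Tendsto (fun n => toWeakSpace ℝ (L2 L) (u₁ n)) atTop (𝓝 0)) {T δ : ℝ} (hT : 0 < T)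
    (hδ : 0 < δ) : ∀ᶠ n in atTop, ∀ t ∈ Icc 0 T, ∀ x ∈ Icc 0 L, |v n t x| ≤ δ := by
  have w0 : ∀ q : L2 L, Tendsto (fun n => inner ℝ (H2.fn (u₀ n)) q) atTop (𝓝 0) := fun q =>
    H2.tendsto_inner hu₀ 0 q
  have w2 : ∀ q : L2 L, Tendsto (fun n => inner ℝ (H2.dxx (u₀ n)) q) atTop (𝓝 0) := fun q =>
    H2.tendsto_inner hu₀ 2 q
  have w1 : ∀ q : L2 L, Tendsto (fun n => inner ℝ (u₁ n) q) atTop (𝓝 0) := by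
    intro q
    have := tendsto_of_tendsto_toWeakSpace hu₁ (innerSL ℝ q)
    refine this.congr fun n => ?_
    simp [real_inner_comm]
  obtain ⟨R₀, hR₀, b0⟩ := exists_norm_le_of_weak w0
  obtain ⟨R₁, hR₁, b1⟩ := exists_norm_le_of_weak w1
  obtain ⟨R₂, hR₂, b2⟩ := exists_norm_le_of_weak w2
  obtain ⟨κ, hκ0, hκlim, hκ⟩ := exists_tendsto_weak_bound hL b1 w1
  obtain ⟨κ', hκ0', hκlim', hκ'⟩ := exists_tendsto_weak_bound hL b0 w0
  obtain ⟨C, hC0, hC⟩ := IsWeakD2.exists_sup_bound hL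
  -- Rellich's theorem in this setting: the weak bound for the functionals `⟨u₀ n, ·⟩` is evaluated
  -- at `u₀ n` itself, which is bounded in `H²`.
  have l0 : Tendsto (fun n => ‖H2.fn (u₀ n)‖) atTop (𝓝 0) := by
    have hsq : Tendsto (fun n => ‖H2.fn (u₀ n)‖ ^ 2) atTop (𝓝 0) := by
      refine squeeze_zero (fun n => by positivity) (fun n => ?_)
        (by simpa using hκlim'.mul_const (R₀ + R₂))
      have := hκ' n _ _ (H2.isWeakD2 (u₀ n))
      rw [← real_inner_self_eq_norm_sq]
      refine ((le_abs_self _).trans this).trans ?_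
      have := b0 n
      have := b2 n
      have := hκ0' n
      gcongr
    simpa using hsq.sqrt
  set M := √((ρ * R₁ ^ 2 + μ * R₂ ^ 2) / μ) with hM
  have hE : ∀ n, ρ * ‖u₁ n‖ ^ 2 + μ * ‖H2.dxx (u₀ n)‖ ^ 2 ≤ μ * M ^ 2 := by
    intro n
    rw [hM, Real.sq_sqrt (by positivity), mul_div_cancel₀ _ hμ.ne']
    have := b1 n
    have := b2 n
    gcongr
  set R : ℕ → ℝ := fun n => 2 * ‖H2.fn (u₀ n)‖ + 4 * (T + 1) * ‖u₁ n‖ with hR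
  set σ : ℕ → ℝ := fun n =>
    √(2 * (‖H2.fn (u₀ n)‖ * R n + 2 * (κ n * ((T + 1) + √(ρ / μ)) * R n))) with hσ
  have hσlim : Tendsto σ atTop (𝓝 0) := by
    set B := 2 * R₀ + 4 * (T + 1) * R₁ with hB
    have hRB : ∀ n, R n ≤ B := by
      intro n
      have := b0 n
      have := b1 n
      simp only [hR, hB]
      gcongr
    have hup : Tendsto (fun n => √(2 * (‖H2.fn (u₀ n)‖ * B
        + 2 * (κ n * ((T + 1) + √(ρ / μ)) * B)))) atTop (𝓝 0) := by
      have := (((l0.mul_const B).add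
        (((hκlim.mul_const ((T + 1) + √(ρ / μ))).mul_const B).const_mul 2)).const_mul 2).sqrt
      simpa using this
    refine squeeze_zero (fun n => Real.sqrt_nonneg _) (fun n => ?_) hup
    have h1 := hRB n
    have h2 := hκ0 n
    simp only [hσ]
    gcongr
  have hσ0 : ∀ n, 0 ≤ σ n := fun n => Real.sqrt_nonneg _
  have hM0 : 0 ≤ M := Real.sqrt_nonneg _
  -- The interpolation length is fixed before `n`, making the `H²` term at most `δ / 2`; then `n` is
  -- taken so large that `σ n / √r ≤ δ / 2`.
  set r := min L (δ / 2 / (C * (1 + M) + 1)) with hr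
  have hden : 0 < C * (1 + M) + 1 := by positivity
  have hr0 : 0 < r := lt_min hL (by positivity)
  have hrδ : C * (1 + M) * r ≤ δ / 2 := by
    have h1 : r ≤ δ / 2 / (C * (1 + M) + 1) := min_le_right _ _
    rw [le_div_iff₀ hden] at h1
    nlinarith
  have hsr : 0 < √r := Real.sqrt_pos.2 hr0
  filter_upwards [hσlim.eventually_le_const (show (0 : ℝ) < 1 from one_pos),
    hσlim.eventually_le_const (show 0 < δ / 2 * √r by positivity)] with n h1 h2 t ht x hx
  refine ((hv n).linear_abs_le hL hρ hμ hT hC0 hC hM0 (hE n) (hκ0 n) (hκ n) rfl rfl hr0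
    (min_le_left _ _) t ht x hx).trans ?_
  have h3 : σ n / √r ≤ δ / 2 := by rwa [div_le_iff₀ hsr]
  have h4 : C * (σ n + M) * r ≤ C * (1 + M) * r := by gcongr
  change σ n / √r + C * (σ n + M) * r ≤ δ
  linarith

lemma le_div_sqrt_of_sq_le {c ρ lam A y : ℝ} (hc : 0 < c) (hρ : 0 < ρ) (hlam : 0 < lam)
    (hA : 0 ≤ A) (h : c * y ^ 2 ≤ A ^ 2 / (lam ^ 2 * ρ)) : y ≤ A / lam * (1 / √(ρ * c)) := by
  refine (abs_le_of_sq_le_sq' ?_ (by positivity)).2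
  rw [mul_pow, div_pow, div_pow, Real.sq_sqrt (by positivity)]
  rw [mul_comm, ← le_div_iff₀ hc] at h
  refine h.trans (le_of_eq ?_)
  field_simp

/-! ### Comparison of the nonlinear and the linear solution -/

namespace IsSolution

variable {L ρ μ : ℝ} {Φ : ℝ → ℝ} {u₀ : H2 L} {u₁ : L2 L} {u ut uxx h v vt vxx k : ℝ → ℝ → ℝ}

lemma force_eq (hu : IsSolution L ρ μ Φ u₀ u₁ u ut uxx h) {t x : ℝ} (ht : 0 ≤ t)
    (hx : x ∈ Icc 0 L) (h1 : |u t x| ≤ 1 / 2) : h t x = deriv Φ (u t x) :=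
  (hu.force t ht x hx).1 (by linarith)

lemma initial_eq (hL : 0 < L) (hρ : 0 < ρ) (hu : IsSolution L ρ μ Φ u₀ u₁ u ut uxx h)
    {Ψ : ℝ → ℝ} (hv : IsSolution L ρ μ Ψ u₀ u₁ v vt vxx k) : ∀ x ∈ Icc 0 L, u 0 x = v 0 x := by
  have e1 := ofFun_initial_eq hL hρ hu.cont (isLocBdd_of_memLinfL2 hu.mem_dxx) hu.integrable hu.weak
  have e2 := ofFun_initial_eq hL hρ hv.cont (isLocBdd_of_memLinfL2 hv.mem_dxx) hv.integrable hv.weak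
  refine eq_of_ofFun_eq hL ?_ ?_ (e1.trans e2.symm)
  · exact hu.cont.comp (f := fun x => ((0 : ℝ), x)) (by fun_prop) fun x hx =>
      ⟨mem_Ici.2 le_rfl, hx⟩
  · exact hv.cont.comp (f := fun x => ((0 : ℝ), x)) (by fun_prop) fun x hx =>
      ⟨mem_Ici.2 le_rfl, hx⟩

/-- As long as `|u| ≤ 1/2`, a solution is controlled by the linear solution with the same data. -/
lemma nonlinear_estimate (hL : 0 < L) (hρ : 0 < ρ) (hμ : 0 < μ)
    (hu : IsSolution L ρ μ Φ u₀ u₁ u ut uxx h)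
    (hv : IsSolution L ρ μ (fun _ => 0) u₀ u₁ v vt vxx k) {C C₁ lam τ δ : ℝ} (hC0 : 0 ≤ C)
    (hC : ∀ f g : L2 L, IsWeakD2 L f g → ∀ r : ℝ, 0 < r → r ≤ L →
      ∀ᵐ x ∂(volume.restrict (Ioo (0 : ℝ) L)), |f x| ≤ ‖f‖ / √r + C * (‖f‖ + ‖g‖) * r)
    (hC₁0 : 0 ≤ C₁) (hC₁ : ∀ s : ℝ, |s| ≤ 1 / 2 → |deriv Φ s| ≤ C₁ * |s|) (hlam : 1 ≤ lam)
    (hK : 2 * ((1 / √L + C * L) * (1 / ρ + 1 / √(ρ * μ)) * (√L * C₁)) ≤ lam) (hτ : 0 < τ)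
    (hvδ : ∀ t ∈ Icc 0 τ, ∀ x ∈ Icc 0 L, |v t x| ≤ δ)
    (hub : ∀ t ∈ Ico 0 τ, ∀ x ∈ Icc 0 L, |u t x| ≤ 1 / 2) :
    (∀ t ∈ Icc 0 τ, ∀ x ∈ Icc 0 L, |u t x| ≤ 2 * δ * Real.exp (lam * t)) ∧
      ∀ᵐ t, 0 < t → t < τ →
        ‖curve L ut t - curve L vt t‖ ≤ √L * C₁ * (2 * δ) * Real.exp (lam * τ) * (1 / √(ρ * ρ)) ∧
        ‖curve L uxx t - curve L vxx t‖
          ≤ √L * C₁ * (2 * δ) * Real.exp (lam * τ) * (1 / √(ρ * μ)) := by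
  have hlam0 : 0 < lam := by linarith
  have hcu := hu.cont.mono (prod_mono (show Icc 0 τ ⊆ Ici (0:ℝ) from Icc_subset_Ici_self) (le_refl (Icc 0 L)))
  have hcv := hv.cont.mono (prod_mono (show Icc 0 τ ⊆ Ici (0:ℝ) from Icc_subset_Ici_self) (le_refl (Icc 0 L)))
  have hexpc : Continuous fun p : ℝ × ℝ => Real.exp (-(lam * p.1)) := by fun_prop
  obtain ⟨⟨t₀, x₀⟩, ⟨ht₀, hx₀⟩, hmax⟩ := (isCompact_Icc.prod isCompact_Icc).exists_isMaxOn
    (⟨(0, 0), ⟨le_rfl, hτ.le⟩, ⟨le_rfl, hL.le⟩⟩ : (Icc 0 τ ×ˢ Icc 0 L).Nonempty)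
    (hcu.abs.mul hexpc.continuousOn)
  -- The maximum of `|u| exp (-lam t)` on the closed rectangle, the quantity in which the estimate
  -- closes.
  set N := |u t₀ x₀| * Real.exp (-(lam * t₀)) with hN
  have hN0 : 0 ≤ N := by positivity
  have hexp : ∀ t, Real.exp (-(lam * t)) * Real.exp (lam * t) = 1 := fun t => by
    rw [← Real.exp_add]; simp
  have huN : ∀ t ∈ Icc 0 τ, ∀ x ∈ Icc 0 L, |u t x| ≤ N * Real.exp (lam * t) := by
    intro t ht x hx
    have h1 : |u t x| * Real.exp (-(lam * t)) ≤ N := hmax (a := (t, x)) ⟨ht, hx⟩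
    have h2 := mul_le_mul_of_nonneg_right h1 (Real.exp_pos (lam * t)).le
    rwa [mul_assoc, hexp, mul_one] at h2
  have hforce : ∀ t ∈ Ioo 0 τ, ∀ x ∈ Ioo 0 L, |h t x| ≤ C₁ * |u t x| := by
    intro t ht x hx
    have h1 := hub t ⟨ht.1.le, ht.2⟩ x (Ioo_subset_Icc_self hx)
    rw [hu.force_eq ht.1.le (Ioo_subset_Icc_self hx) h1]
    exact hC₁ _ h1
  have hbu := hu.isBeamCurve hL (τ := τ) (M := C₁ * (1 / 2)) fun t ht x hx =>
    (hforce t ht x hx).trans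
      (mul_le_mul_of_nonneg_left (hub t ⟨ht.1.le, ht.2⟩ x (Ioo_subset_Icc_self hx)) hC₁0)
  have hw := hbu.sub (hv.linear_isBeamCurve hL τ)
  rw [sub_self, sub_self] at hw
  set β := √L * (C₁ * N) with hβ
  have hβ0 : 0 ≤ β := by positivity
  have hF : ∀ t, ‖(curve L (trunc τ h) - curve L (trunc τ k)) t‖ ≤ β * Real.exp (lam * t) := by
    intro t
    rw [Pi.sub_apply, hv.linear_curve_force, sub_zero]
    rcases le_or_gt t 0 with h0 | h0
    · rw [curve_of_nonpos _ h0, norm_zero]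
      positivity
    · rw [curve_of_pos _ h0, hβ, mul_assoc]
      refine norm_ofFun_le (by positivity) fun x hx => ?_
      unfold trunc
      split_ifs with h1
      · refine (hforce t ⟨h0, h1⟩ x hx).trans ?_
        rw [mul_assoc]
        have := huN t ⟨h0.le, h1.le⟩ x (Ioo_subset_Icc_self hx)
        gcongr
      · rw [abs_zero]
        positivity
  have hen := hw.energy_le hρ hμ hβ0 hlam0 (ae_of_all _ hF)
  -- The force is at most `β exp (lam t)` in norm, with `β` proportional to `N`. The energy estimate
  -- returns a bound on `u - v` in `H²` with a factor `1 / lam`, and `hK` makes the total factor at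
  -- most `1/2`.
  have hX : ∀ᵐ t, 0 < t → t < τ → ∀ᵐ x ∂(volume.restrict (Ioo 0 L)),
      |(u t x - v t x) * Real.exp (-(lam * t))| ≤ N / 2 := by
    filter_upwards [hen, hw.ae_isWeakD2] with t h1 h2 ht0 htτ
    obtain ⟨h3, h4⟩ := h1 htτ
    have h5 := le_div_sqrt_of_sq_le hμ hρ hlam0 (by positivity) h4
    set E := Real.exp (lam * t) with hE
    have hE0 : 0 < E := Real.exp_pos _
    have h3 : ‖(curve L u - curve L v) t‖ ≤ β * E / lam * (1 / ρ) := by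
      refine h3.trans ?_
      have : β * E / lam * (1 / ρ) = β * E / (lam * ρ) := by field_simp
      rw [this]
      have : lam * ρ ≤ lam ^ 2 * ρ :=
        mul_le_mul_of_nonneg_right (le_self_pow₀ hlam two_ne_zero) hρ.le
      gcongr
    have hcur : (curve L u - curve L v) t =ᵐ[volume.restrict (Ioo 0 L)] fun x => u t x - v t x := by
      rw [Pi.sub_apply, curve_of_pos _ ht0, curve_of_pos _ ht0]
      filter_upwards [coeFn_ofFun (hu.memLp_slice ht0.le), coeFn_ofFun (hv.memLp_slice ht0.le),
        Lp.coeFn_sub (ofFun L (u t)) (ofFun L (v t))] with x a1 a2 a3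
      rw [a3, Pi.sub_apply, a1, a2]
    -- Interpolation at the full length `L` is enough, since smallness comes from `lam` and not from
    -- `r`.
    filter_upwards [hcur, hC _ _ h2 L hL le_rfl] with x a1 a2
    rw [← a1, abs_mul, abs_of_pos (Real.exp_pos _)]
    set p := ‖(curve L u - curve L v) t‖ with hp
    set q := ‖(curve L uxx - curve L vxx) t‖ with hq
    have hq0 : 0 ≤ q := norm_nonneg _
    have hp0 : 0 ≤ p := norm_nonneg _
    have hpq : p + q ≤ β * E / lam * (1 / ρ + 1 / √(ρ * μ)) := by
      rw [mul_add]; exact add_le_add h3 h5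
    have hb : p / √L + C * (p + q) * L ≤ N / 2 * E := by
      have i1 : p / √L ≤ (p + q) * (1 / √L) := by
        rw [div_eq_mul_one_div]
        have : p ≤ p + q := by linarith
        gcongr
      calc p / √L + C * (p + q) * L ≤ (1 / √L + C * L) * (p + q) := by linarith
        _ ≤ (1 / √L + C * L) * (β * E / lam * (1 / ρ + 1 / √(ρ * μ))) := by gcongr
        _ = ((1 / √L + C * L) * (1 / ρ + 1 / √(ρ * μ)) * (√L * C₁)) * (N * E) / lam := by
          rw [hβ]; ring
        _ ≤ (lam / 2) * (N * E) / lam := by gcongr; linarith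
        _ = N / 2 * E := by field_simp
    have h6 := mul_le_mul_of_nonneg_right (a2.trans hb) (Real.exp_pos (-(lam * t))).le
    rw [mul_assoc, mul_comm E, hE, hexp, mul_one] at h6
    exact h6
  have hcw : ContinuousOn (Function.uncurry fun t x => (u t x - v t x) * Real.exp (-(lam * t)))
      (Icc 0 τ ×ˢ Icc 0 L) := (hcu.sub hcv).mul hexpc.continuousOn
  -- Continuity carries the bound to the closed rectangle, including the final time `τ`, where `|u|
  -- ≤ 1/2` is not assumed; the exit-time argument relies on this.
  have hwN := abs_le_of_ae_rectangle hL hτ hcw (δ := N / 2) (by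
    refine (ae_restrict_iff' measurableSet_Ioo).2 ?_
    filter_upwards [hX] with t ht1 ht2
    exact ht1 ht2.1 ht2.2)
  have hδ0 : 0 ≤ δ := (abs_nonneg _).trans (hvδ t₀ ht₀ x₀ hx₀)
  -- At the maximum point `N ≤ N / 2 + δ`, by `u = (u - v) + v`.
  have hN2 : N ≤ 2 * δ := by
    have h1 := hwN t₀ ht₀ x₀ hx₀
    have h2 := hvδ t₀ ht₀ x₀ hx₀
    have hle : Real.exp (-(lam * t₀)) ≤ 1 := by
      rw [Real.exp_le_one_iff]
      have := ht₀.1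
      nlinarith
    have h3 : |v t₀ x₀| * Real.exp (-(lam * t₀)) ≤ δ * 1 := by gcongr
    have h4 : N ≤ |(u t₀ x₀ - v t₀ x₀) * Real.exp (-(lam * t₀))|
        + |v t₀ x₀| * Real.exp (-(lam * t₀)) := by
      rw [abs_mul, abs_of_pos (Real.exp_pos _), ← add_mul, hN]
      gcongr
      have := abs_add_le (u t₀ x₀ - v t₀ x₀) (v t₀ x₀)
      simpa using this
    linarith
  have hβ2 : β ≤ √L * C₁ * (2 * δ) := by
    rw [hβ, mul_assoc]
    gcongr
  refine ⟨fun t ht x hx => (huN t ht x hx).trans (by gcongr), ?_⟩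
  have hlu := isLocBdd_of_memLinfL2 hu.mem_dt
  have hlv := isLocBdd_of_memLinfL2 hv.mem_dt
  have hcu' := isLocBdd_of_continuousOn hu.cont
  have hcv' := isLocBdd_of_continuousOn hv.cont
  have hvel := hw.velocity_le hρ hμ hβ0 hlam0 (ae_of_all _ hF)
    (V := curve L ut - curve L vt) (hlu.locallyIntegrable_curve.sub hlv.locallyIntegrable_curve)
    fun θ h1 h2 h3 => by
      have c1 := (contDiff_deriv h1).continuous
      simp only [Pi.sub_apply, smul_sub]
      rw [integral_sub
          (hcu'.locallyIntegrable_curve.integrable_smul_left_of_hasCompactSupport c1 h2.deriv)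
          (hcv'.locallyIntegrable_curve.integrable_smul_left_of_hasCompactSupport c1 h2.deriv),
        integral_sub
          (hlu.locallyIntegrable_curve.integrable_smul_left_of_hasCompactSupport h1.continuous h2)
          (hlv.locallyIntegrable_curve.integrable_smul_left_of_hasCompactSupport h1.continuous h2),
        hu.dt.integral_eq hcu' hlu h1 h2 h3, hv.dt.integral_eq hcv' hlv h1 h2 h3]
      abel
  have hfin : ∀ t, t < τ → β * Real.exp (lam * t) / lam
      ≤ √L * C₁ * (2 * δ) * Real.exp (lam * τ) := by
    intro t ht
    rw [div_le_iff₀ hlam0]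
    calc β * Real.exp (lam * t) ≤ √L * C₁ * (2 * δ) * Real.exp (lam * τ) := by gcongr
      _ ≤ √L * C₁ * (2 * δ) * Real.exp (lam * τ) * lam := le_mul_of_one_le_right (by positivity) hlam
  filter_upwards [hvel, hen] with t h1 h2 ht0 htτ
  constructor
  · refine (le_div_sqrt_of_sq_le hρ hρ hlam0 (by positivity) (h1 ht0 htτ)).trans ?_
    exact mul_le_mul_of_nonneg_right (hfin t htτ) (by positivity)
  · refine (le_div_sqrt_of_sq_le hμ hρ hlam0 (by positivity) (h2 htτ).2).trans ?_
    exact mul_le_mul_of_nonneg_right (hfin t htτ) (by positivity)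

/-- If the linear solution is small, then the solution stays in the region `|u| < 1/2`. -/
lemma abs_lt_half (hL : 0 < L) (hρ : 0 < ρ) (hμ : 0 < μ)
    (hu : IsSolution L ρ μ Φ u₀ u₁ u ut uxx h)
    (hv : IsSolution L ρ μ (fun _ => 0) u₀ u₁ v vt vxx k) {C C₁ lam T δ : ℝ} (hC0 : 0 ≤ C)
    (hC : ∀ f g : L2 L, IsWeakD2 L f g → ∀ r : ℝ, 0 < r → r ≤ L →
      ∀ᵐ x ∂(volume.restrict (Ioo (0 : ℝ) L)), |f x| ≤ ‖f‖ / √r + C * (‖f‖ + ‖g‖) * r)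
    (hC₁0 : 0 ≤ C₁) (hC₁ : ∀ s : ℝ, |s| ≤ 1 / 2 → |deriv Φ s| ≤ C₁ * |s|) (hlam : 1 ≤ lam)
    (hK : 2 * ((1 / √L + C * L) * (1 / ρ + 1 / √(ρ * μ)) * (√L * C₁)) ≤ lam)
    (hvδ : ∀ t ∈ Icc 0 T, ∀ x ∈ Icc 0 L, |v t x| ≤ δ)
    (hδ : 2 * δ * Real.exp (lam * T) < 1 / 2) :
    ∀ t ∈ Icc 0 T, ∀ x ∈ Icc 0 L, |u t x| < 1 / 2 := by
  by_contra! hcon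
  obtain ⟨t₁, ht₁, x₁, hx₁, h₁⟩ := hcon
  have hcu := hu.cont.mono (prod_mono (show Icc 0 T ⊆ Ici (0:ℝ) from Icc_subset_Ici_self) (le_refl (Icc 0 L)))
  set S := (Icc 0 T ×ˢ Icc 0 L) ∩ (fun p : ℝ × ℝ => |u p.1 p.2|) ⁻¹' Ici (1 / 2) with hS
  have hSc : IsCompact S := by
    refine (isCompact_Icc.prod isCompact_Icc).of_isClosed_subset ?_ inter_subset_left
    exact hcu.abs.preimage_isClosed_of_isClosed (isClosed_Icc.prod isClosed_Icc) isClosed_Ici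
  -- `τ` is the first time at which `|u|` reaches `1/2`. Before it the comparison estimate applies,
  -- and at `τ` it gives `|u| < 1/2`, a contradiction.
  obtain ⟨⟨τ, x₂⟩, ⟨⟨hτ, hx₂⟩, h₂⟩, hmin⟩ := hSc.exists_isMinOn (f := fun p : ℝ × ℝ => p.1)
    ⟨(t₁, x₁), ⟨ht₁, hx₁⟩, h₁⟩ continuous_fst.continuousOn
  have h₂ : 1 / 2 ≤ |u τ x₂| := h₂
  have hτ : τ ∈ Icc 0 T := hτ
  have hδ0 : 0 ≤ δ := (abs_nonneg _).trans (hvδ τ hτ x₂ hx₂)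
  have hmono : 2 * δ * Real.exp (lam * τ) ≤ 2 * δ * Real.exp (lam * T) := by
    have := hτ.2
    gcongr
  -- The estimate needs a nonempty time interval, so exit at time zero is excluded separately: there
  -- `u` and `v` coincide.
  rcases hτ.1.eq_or_lt with h0 | h0
  · subst h0
    have h3 := hu.initial_eq hL hρ hv x₂ hx₂
    have h4 := hvδ 0 hτ x₂ hx₂
    rw [← h3] at h4
    simp only [mul_zero, Real.exp_zero, mul_one] at hmono
    linarith
  · have h3 := (hu.nonlinear_estimate hL hρ hμ hv hC0 hC hC₁0 hC₁ hlam hK h0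
      (fun t ht x hx => hvδ t ⟨ht.1, ht.2.trans hτ.2⟩ x hx) (fun t ht x hx => by
        by_contra! hlt
        have h5 : τ ≤ t := hmin (a := (t, x)) ⟨⟨⟨ht.1, ht.2.le.trans hτ.2⟩, hx⟩, hlt.le⟩
        exact not_lt.2 h5 ht.2)).1 τ ⟨h0.le, le_rfl⟩ x₂ hx₂
    linarith

end IsSolution

lemma normLinfL2_sub_le {L T B : ℝ} {f g : ℝ → ℝ → ℝ} (hf : IsLocBdd L f) (hg : IsLocBdd L g)
    (h : ∀ᵐ t, 0 < t → t < T → ‖curve L f t - curve L g t‖ ≤ B) :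
    normLinfL2 (Ioo 0 T) L (fun t x => f t x - g t x) ≤ ENNReal.ofReal B := by
  refine essSup_le_of_ae_le _ ?_
  refine (ae_restrict_iff' measurableSet_Ioo).2 ?_
  filter_upwards [h, (ae_restrict_iff' measurableSet_Ioi).1 hf.memLp,
    (ae_restrict_iff' measurableSet_Ioi).1 hg.memLp] with t h1 h2 h3 ht
  have m1 := h2 ht.1
  have m2 := h3 ht.1
  have h4 := h1 ht.1 ht.2
  have m : MemLp (fun x => f t x - g t x) 2 (volume.restrict (Ioo (0 : ℝ) L)) := m1.sub m2
  rw [curve_of_pos _ ht.1, curve_of_pos _ ht.1, ← ofFun_sub m1 m2, norm_ofFun m] at h4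
  exact (ENNReal.le_ofReal_iff_toReal_le m.2.ne ((ENNReal.toReal_nonneg).trans h4)).2 h4

end AdhesiveBeam
end

/-! ### Proof of the linearization property -/

open AdhesiveBeam in
theorem theorem3p5 (L ρ μ κ : ℝ) (hL : 0 < L) (hρ : 0 < ρ) (hμ : 0 < μ)
    (Φ : ℝ → ℝ) (hΦ : AdhesiveBeam.IsAdhesionPotential Φ κ)
    (u₀ : ℕ → AdhesiveBeam.H2 L) (u₁ : ℕ → AdhesiveBeam.L2 L) (u v : ℕ → ℝ → ℝ → ℝ)
    (hu : ∀ n, AdhesiveBeam.IsDissipativeSolution L ρ μ Φ (u₀ n) (u₁ n) (u n))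
    (hv : ∀ n, AdhesiveBeam.IsDissipativeSolution L ρ μ (fun _ => 0) (u₀ n) (u₁ n) (v n))
    (hu₀ : Tendsto (fun n => toWeakSpace ℝ (AdhesiveBeam.H2 L) (u₀ n)) atTop (𝓝 0))
    (hu₁ : Tendsto (fun n => toWeakSpace ℝ (AdhesiveBeam.L2 L) (u₁ n)) atTop (𝓝 0))
    (hE : limsup (fun n =>
        ((∫ x in Ioo 0 L, (ρ * u₁ n x ^ 2 + μ * AdhesiveBeam.H2.dxx (u₀ n) x ^ 2) / 2 : ℝ) : EReal)) atTop
      < ((4 * κ * μ / max 3 (2 * κ) : ℝ) : EReal)) :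
    ∃ wt wxx : ℕ → ℝ → ℝ → ℝ,
      (∀ n, AdhesiveBeam.IsWeakDt L (fun t x => u n t x - v n t x) (wt n)) ∧
      (∀ n, AdhesiveBeam.IsWeakDxx L (fun t x => u n t x - v n t x) (wxx n)) ∧
      ∀ T : ℝ, 0 ≤ T →
        Tendsto (fun n => AdhesiveBeam.normLinfL2 (Ioo 0 T) L (wt n)
          + AdhesiveBeam.normLinfL2 (Ioo 0 T) L (wxx n)) atTop (𝓝 0) := by
  choose ut uxx h hu using fun n => (hu n).exists_isSolution
  choose vt vxx k hv using fun n => (hv n).exists_isSolution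
  obtain ⟨C, hC0, hC⟩ := IsWeakD2.exists_sup_bound hL
  obtain ⟨C₁, hC₁0, hC₁⟩ := hΦ.exists_abs_deriv_le
  refine ⟨fun n t x => ut n t x - vt n t x, fun n t x => uxx n t x - vxx n t x,
    fun n => (hu n).dt.sub (hv n).dt, fun n => (hu n).dxx.sub (hv n).dxx, fun T hT => ?_⟩
  -- The rate depends on `L`, `ρ`, `μ` and the constants of the potential and of interpolation, but
  -- neither on `n` nor on `T`.
  set lam := max 1 (2 * ((1 / √L + C * L) * (1 / ρ + 1 / √(ρ * μ)) * (√L * C₁))) with hlamdef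
  have hlam : 1 ≤ lam := le_max_left _ _
  have hK := le_max_right 1 (2 * ((1 / √L + C * L) * (1 / ρ + 1 / √(ρ * μ)) * (√L * C₁)))
  rw [← hlamdef] at hK
  -- The shift keeps the time interval nondegenerate when `T = 0`.
  set τ := T + 1 with hτ
  have hτ0 : 0 < τ := by linarith
  set A := √L * C₁ * 2 * Real.exp (lam * τ) * (1 / √(ρ * ρ)) with hA
  set B := √L * C₁ * 2 * Real.exp (lam * τ) * (1 / √(ρ * μ)) with hB
  have hA0 : 0 ≤ A := by positivity
  have hB0 : 0 ≤ B := by positivity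
  rw [ENNReal.tendsto_nhds_zero]
  intro ε hε
  obtain ⟨η, hη0, hη⟩ : ∃ η : ℝ, 0 < η ∧ ENNReal.ofReal η ≤ ε := by
    rcases eq_or_ne ε ⊤ with rfl | hne
    · exact ⟨1, one_pos, le_top⟩
    · exact ⟨ε.toReal, ENNReal.toReal_pos hε.ne' hne, (ENNReal.ofReal_toReal hne).le⟩
  -- The first entry gives `2 δ exp (lam τ) ≤ 1/4`, which confines `u` to `|u| < 1/2`; the second
  -- makes the final bound `(A + B) δ` at most `η`.
  set δ := min (1 / 8 * Real.exp (-(lam * τ))) (η / (A + B + 1)) with hδ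
  have hδ0 : 0 < δ := lt_min (by positivity) (by positivity)
  have hδ1 : 2 * δ * Real.exp (lam * τ) < 1 / 2 := by
    have h1 : δ ≤ 1 / 8 * Real.exp (-(lam * τ)) := min_le_left _ _
    have h2 : Real.exp (-(lam * τ)) * Real.exp (lam * τ) = 1 := by rw [← Real.exp_add]; simp
    have h3 := mul_le_mul_of_nonneg_right h1 (Real.exp_pos (lam * τ)).le
    rw [mul_assoc, h2] at h3
    linarith
  have hδ2 : (A + B) * δ ≤ η := by
    have h1 : δ ≤ η / (A + B + 1) := min_le_right _ _
    rw [le_div_iff₀ (by positivity)] at h1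
    nlinarith
  filter_upwards [linear_tendsto_uniformly hL hρ hμ hv hu₀ hu₁ hτ0 hδ0] with n hn
  have hhalf := (hu n).abs_lt_half hL hρ hμ (hv n) hC0 hC hC₁0 hC₁ hlam hK hn hδ1
  have hest := ((hu n).nonlinear_estimate hL hρ hμ (hv n) hC0 hC hC₁0 hC₁ hlam hK hτ0 hn
    fun t ht x hx => (hhalf t ⟨ht.1, ht.2.le⟩ x hx).le).2
  have n1 := normLinfL2_sub_le (T := T) (B := A * δ) (isLocBdd_of_memLinfL2 (hu n).mem_dt)
    (isLocBdd_of_memLinfL2 (hv n).mem_dt) (by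
      filter_upwards [hest] with t ht ht0 htT
      refine (ht ht0 (by linarith)).1.trans (le_of_eq ?_)
      rw [hA]; ring)
  have n2 := normLinfL2_sub_le (T := T) (B := B * δ) (isLocBdd_of_memLinfL2 (hu n).mem_dxx)
    (isLocBdd_of_memLinfL2 (hv n).mem_dxx) (by
      filter_upwards [hest] with t ht ht0 htT
      refine (ht ht0 (by linarith)).2.trans (le_of_eq ?_)
      rw [hB]; ring)
  refine (add_le_add n1 n2).trans ?_
  rw [← ENNReal.ofReal_add (by positivity) (by positivity), ← add_mul]
  exact (ENNReal.ofReal_le_ofReal hδ2).trans hη
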